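/- Let $I=(0,1)$ and let $\mathcal Y\subseteq\mathbb R^2$ be open. A (normalized) representation $(A,g_1,g_2)$ of a process $(y_t)_{t\ge 0}$ with values in $\mathcal Y$ consists of the following. (i) $A:I^2\to\mathcal Y$ is a $C^1$ diffeomorphism (with $C^1$ inverse), and $y_t=A(x_{1,t},x_{2,t})$. (ii) For $j=1,2$, $(x_{j,t})_{t\ge0}$ is a Markov source $x_{j,t}=g_j(x_{j,t-1};\varepsilon_{j,t})$, $t\ge1$, where each $\varepsilon_{j,t}\sim N(0,1)$ is independent of $(x_{j,0},\dots,x_{j,t-1})$, each $x_{j,t}$ is uniform on $I$, and $g_j:I\times\mathbb R\to I$ is continuous and, for each fixed $v\in I$, $g_j(v;\cdot)$ is a $C^1$ bijection of $\mathbb R$ onto $I$ with strictly positive derivative. (iii) The processes $(x_{1,t})_t$ and $(x_{2,t})_t$ are independent. Let $(A,g_1,g_2)$ be such a representation. For $j=1,2$ and every horizon $h\ge1$, let $\ell_{jh}(u|v)$ be a strictly positive version of the conditional density of $x_{j,t+h}$ at $u$ given $x_{j,t}=v$, differentiable with respect to $u\in I$ for every $v\in I$. Suppose that for every $u\in I$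 the two score sequences $$\Big[\tfrac{\partial \log \ell_{jh}}{\partial u}(u|v),\ h\ge1,\ v \text{ varying in } I\Big],\qquad j=1,2,$$ are linearly independent, i.e. if real numbers $a,b$ satisfy $a\,\partial_u\log\ell_{1h}(u|v)+b\,\partial_u\log\ell_{2h}(u|v)=0$ for every $h\ge1$ and almost every $v\in I$, then $a=b=0$. Then $(A,g_1,g_2)$ is essentially unique, i.e. unique up to permutation of the sources and transformations of each source that preserve its uniform margin. That is, if $(A',g_1',g_2')$ is any normalized representation, with the same $\mathcal Y$, of a process with the same law as $(y_t)$, there are a permutation $\sigma$ of $\{1,2\}$ and signs $s_1,s_2\in\{1,-1\}$ such that, with $\tau_j(u)=u$ if $s_j=1$ and $\tau_j(u)=1-u$ if $s_j=-1$, $$A'\big(\tau_1(x_{\sigma(1)}),\tau_2(x_{\sigma(2)})\big)=A(x_1,x_2)\quad\text{for all }(x_1,x_2)\in I^2,$$ $$g'_j\big(\tau_j(v);s_j e\big)=\tau_j\big(g_{\sigma(j)}(v;e)\big)\quad\text{for all } j\in\{1,2\},\ v\in I,\ e\in\mathbb R .$$ -/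

import Mathlib

open MeasureTheory ProbabilityTheory Set

universe u v

/-- The open unit interval, the state space of a source with uniform margins. -/
def unitIoo : Set ℝ := Ioo 0 1

/-- The open unit square, the state space of the pair of sources. -/
def openSquare : Set (Fin 2 → ℝ) := {x | ∀ j, x j ∈ unitIoo}

/-- `A` restricts to a `C¹` diffeomorphism from `U` onto `V` (with `C¹` inverse `C`). -/
def IsC1Diffeo (A : (Fin 2 → ℝ) → (Fin 2 → ℝ)) (U V : Set (Fin 2 → ℝ)) : Prop :=
  ContDiffOn ℝ 1 A U ∧ MapsTo A U V ∧
    ∃ C : (Fin 2 → ℝ) → (Fin 2 → ℝ), ContDiffOn ℝ 1 C V ∧ MapsTo C V U ∧ InvOn C A U V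

/-- `g v e` is an admissible autoregressive function on the state space `(0,1)`: it is continuous,
and for each `v` the map `g v` is a one-to-one, continuously differentiable map from `ℝ` onto
`(0,1)` with a strictly positive derivative. -/
structure IsAutoregressive (g : ℝ → ℝ → ℝ) : Prop where
  continuousOn : ContinuousOn (Function.uncurry g) (unitIoo ×ˢ univ)
  contDiff : ∀ v ∈ unitIoo, ContDiff ℝ 1 (g v)
  deriv_pos : ∀ v ∈ unitIoo, ∀ e, 0 < deriv (g v) e
  range_eq : ∀ v ∈ unitIoo, range (g v) = unitIoo

/-- `x` is a stationary Markov source with uniform margins on `(0,1)`, generated by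
`x (t+1) = g (x t) (ε (t+1))`, where each `ε (t+1)` is standard Gaussian and independent
of the past `x 0, …, x t`. -/
structure IsMarkovSource {Ω : Type*} [MeasurableSpace Ω] (P : Measure Ω)
    (g : ℝ → ℝ → ℝ) (x ε : ℕ → Ω → ℝ) : Prop where
  autoregressive : IsAutoregressive g
  measurable_state : ∀ t, Measurable (x t)
  measurable_noise : ∀ t, Measurable (ε t)
  uniform : ∀ t, HasLaw (x t) (volume.restrict unitIoo) P
  gaussian : ∀ t, HasLaw (ε (t + 1)) (gaussianReal 0 1) P
  indep_past : ∀ t, IndepFun (ε (t + 1)) (fun ω (s : Fin (t + 1)) => x s ω) P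
  recursion : ∀ t, ∀ᵐ ω ∂P, x (t + 1) ω = g (x t ω) (ε (t + 1) ω)

/-- The observed process `y t = A (x₁ t, x₂ t)`, as a random path. -/
def observed {Ω : Type*} (A : (Fin 2 → ℝ) → (Fin 2 → ℝ)) (x : Fin 2 → ℕ → Ω → ℝ)
    (ω : Ω) (t : ℕ) : Fin 2 → ℝ :=
  A (fun j => x j t ω)

/-- `(A, g₁, g₂)`, with sources `x` and noises `ε`, is a representation of a process `y` with
state space `Y`, normalized so that the sources have uniform margins: `A` is a diffeomorphism
onto `Y`, and the two source processes are independent. -/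
structure IsRepresentation {Ω : Type*} [MeasurableSpace Ω] (P : Measure Ω)
    (Y : Set (Fin 2 → ℝ)) (A : (Fin 2 → ℝ) → (Fin 2 → ℝ)) (g : Fin 2 → ℝ → ℝ → ℝ)
    (x ε : Fin 2 → ℕ → Ω → ℝ) : Prop where
  diffeo : IsC1Diffeo A openSquare Y
  source : ∀ j, IsMarkovSource P (g j) (x j) (ε j)
  indep : IndepFun (fun ω t => x 0 t ω) (fun ω t => x 1 t ω) P

/-- `ℓ u v` is a strictly positive version of the conditional density at `u` of `x (t+h)` given
`x t = v`. Since `x t` has density one, it is also the joint density of the pair. -/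
structure IsTransitionDensity {Ω : Type*} [MeasurableSpace Ω] (P : Measure Ω)
    (x : ℕ → Ω → ℝ) (h : ℕ) (ℓ : ℝ → ℝ → ℝ) : Prop where
  measurable : Measurable (Function.uncurry ℓ)
  pos : ∀ u ∈ unitIoo, ∀ v ∈ unitIoo, 0 < ℓ u v
  law : ∀ t, P.map (fun ω => (x (t + h) ω, x t ω)) =
    (volume.restrict (unitIoo ×ˢ unitIoo)).withDensity (fun p => ENNReal.ofReal (ℓ p.1 p.2))

/-- The score `∂ log ℓ(u|v) / ∂u`. -/
noncomputable def score (ℓ : ℝ → ℝ → ℝ) (u v : ℝ) : ℝ :=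
  deriv (fun w => Real.log (ℓ w v)) u

/-- At the given `u`, the two score sequences, indexed by the horizon `h ≥ 1` and the conditioning
value `v`, are linearly independent. As the transition densities are determined only for almost
every conditioning value, equality of sequences is equality for almost every `v`. -/
def ScoresLinearlyIndependentAt (ℓ : Fin 2 → ℕ → ℝ → ℝ → ℝ) (u : ℝ) : Prop :=
  ∀ a b : ℝ,
    (∀ h : ℕ, 1 ≤ h → ∀ᵐ v ∂(volume.restrict unitIoo),
      a * score (ℓ 0 h) u v + b * score (ℓ 1 h) u v = 0) →
    a = 0 ∧ b = 0

/-- The one-dimensional transformations of `(0,1)` that preserve the uniform law (the only two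
diffeomorphisms that do): `u ↦ u` for the sign `1` and `u ↦ 1 - u` for the sign `-1`. -/
noncomputable def marginMap (s : ℤˣ) (u : ℝ) : ℝ :=
  if s = 1 then u else 1 - u

/-- `(A', g₁', g₂')` is obtained from `(A, g₁, g₂)` by a permutation of the sources and a
transformation of each source that keeps its margin uniform: the new sources are
`x'ⱼ = marginMap (s j) (x (σ j))`. When a source is reversed, so is its noise, which keeps the new
autoregressive function increasing in the noise. -/
def EquivalentRepresentations (A : (Fin 2 → ℝ) → (Fin 2 → ℝ)) (g : Fin 2 → ℝ → ℝ → ℝ)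
    (A' : (Fin 2 → ℝ) → (Fin 2 → ℝ)) (g' : Fin 2 → ℝ → ℝ → ℝ) : Prop :=
  ∃ (σ : Equiv.Perm (Fin 2)) (s : Fin 2 → ℤˣ),
    (∀ x ∈ openSquare, A' (fun j => marginMap (s j) (x (σ j))) = A x) ∧
    ∀ j, ∀ v ∈ unitIoo, ∀ e : ℝ,
      g' j (marginMap (s j) v) (((s j : ℤ) : ℝ) * e) = marginMap (s j) (g (σ j) v e)

/-- The representation `(A, g₁, g₂)` of a process with law `μ` and state space `Y` is essentially
unique: every normalized representation of a process with the same law, on any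
probability space, is equivalent to it. -/
def IsEssentiallyUnique (μ : Measure (ℕ → Fin 2 → ℝ)) (Y : Set (Fin 2 → ℝ))
    (A : (Fin 2 → ℝ) → (Fin 2 → ℝ)) (g : Fin 2 → ℝ → ℝ → ℝ) : Prop :=
  ∀ (Ω : Type u) [MeasurableSpace Ω] (P : Measure Ω) [IsProbabilityMeasure P]
    (A' : (Fin 2 → ℝ) → (Fin 2 → ℝ)) (g' : Fin 2 → ℝ → ℝ → ℝ) (x' ε' : Fin 2 → ℕ → Ω → ℝ),
    IsRepresentation P Y A' g' x' ε' → HasLaw (observed A' x') μ P →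
    EquivalentRepresentations A g A' g'

/-!
Two representations of the same process are related by a change of sources `T = A'⁻¹ ∘ A`, a `C¹`
diffeomorphism of the unit square with inverse `S`, which preserves the uniform law. The joint law
of the observations at two times is the same in both representations, so the sum of the two
log-densities `log ℓ₁ + log ℓ₂`, written in the new coordinates, is a sum of a function of the
first new coordinates and a function of the second ones (`IsSeparableUnder`). The point is to show
that each row of the derivative of `S` has, at each point, only one nonzero entry
(`IsSquareDiffeo.fderiv_fst_eq_zero_or`). Then, by connectedness, `S` acts separately on the
coordinates, up to their order, and a map of the interval that preserves the uniform law is the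
identity or the reflection.

Suppose that a row of the derivative has no zero entry at some point. Differentiation of the
separable log-density at that point, in the two new coordinates, gives two independent linear
combinations of the scores of the two sources, seen as functions of the conditioning values, that
depend on the first, resp. the second, new source only. Hence the scores are independent
variables with two independent combinations that are independent of each other, and they are
Gaussian by Bernstein's theorem (`gaussian_of_charFun_functional_equation`). One of them can be
chosen not to be constant: a positive density whose score does not depend on the conditioning
value is a product, and then its score vanishes because its margins are uniform, contrary to the
hypothesis.

The scores are, moreover, almost everywhere equal to continuous functions, because each of them is
determined, locally, by averages of the right-hand side along one-dimensional changes of variables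
(`exists_local_continuous_version`), and these continuous functions are injective
(`IsSquareDiffeo.injOn_fst`). A continuous injective function of a uniform variable with a Gaussian
law is an affine function of the Gaussian quantile `Φ⁻¹`. So the change of sources is linear, with a
matrix `m` without zero entries, in Gaussian coordinates for the old sources and suitable
coordinates for the new ones (`IsLinearMixing`).

For all horizons `h` the separability now forces the log-densities to be quadratic in the
Gaussian coordinate of the first argument, with a constant quadratic coefficient and a linear
coefficient that is a multiple of `Φ⁻¹(v)`: it is affine by a Jensen equation, and its constant term
vanishes since both variables of the pair are centred
(`IsCopulaDensity.linear_coefficient_eq_zero`).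
The two multiples are in a ratio that depends on `m` only, and at the median the scores are
proportional to these linear coefficients. This is a linear relation between the two score sequences
at `u = 1 / 2`, which contradicts the hypothesis there.

The relation between the autoregressive functions follows from the equality of the laws of the state
and its successor: two functions that are increasing in the noise and define the same transition law
are equal (`eq_of_map_stateNoise_eq`).
-/

open Filter Topology
open scoped ENNReal

/-! ### Functional equations on the line -/

lemma Continuous.eq_mul_of_map_add {θ : ℝ → ℂ} (hc : Continuous θ)
    (hadd : ∀ x y, θ (x + y) = θ x + θ y) (x : ℝ) : θ x = x * θ 1 := by
  have h := ((AddMonoidHom.mk' θ hadd).toRealLinearMap hc).map_smul x 1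
  rw [smul_eq_mul, mul_one, Complex.real_smul] at h
  exact h

/-- A continuous nowhere vanishing complex function on the line with value `1` at `0` has a
continuous logarithm. -/
lemma exists_continuous_log {f : ℝ → ℂ} (hf : Continuous f) (h0 : f 0 = 1)
    (hne : ∀ x, f x ≠ 0) : ∃ θ : ℝ → ℂ, Continuous θ ∧ θ 0 = 0 ∧ ∀ x, f x = Complex.exp (θ x) := by
  obtain ⟨F, ⟨hF0, hF⟩, -⟩ := Complex.isCoveringMapOn_exp.existsUnique_continuousMap_lifts
    ⟨f, hf⟩ (a₀ := 0) (e₀ := 0) (by simp [h0]) (by simpa using hne)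
  exact ⟨F, F.continuous, hF0, fun x => (congrFun hF x).symm⟩

/-- The quadratic functional equation behind the Darmois–Skitovich theorem: shifting `(s, t)` along
the kernel of `(s, t) ↦ β s + δ t` removes `η` and shows that every increment of `θ` is affine. -/
lemma exists_quadratic_of_functional_equation {θ η : ℝ → ℂ} (hθ : Continuous θ)
    (hθ0 : θ 0 = 0) {α β γ δ : ℝ} (hα : α ≠ 0) (hγ : γ ≠ 0)
    (hdet : α * δ - β * γ ≠ 0)
    (heq : ∀ s t : ℝ, θ (α * s + γ * t) + η (β * s + δ * t)
      = θ (α * s) + η (β * s) + θ (γ * t) + η (δ * t)) :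
    ∃ m l : ℂ, ∀ x : ℝ, θ x = m * x + l * x ^ 2 := by
  -- increments are affine
  have h1 : ∀ k x y : ℝ, θ (x + y + k) - θ (x + y) + (θ k - θ 0)
      = (θ (x + k) - θ x) + (θ (y + k) - θ y) := by
    intro k x y
    set κ := k / (α * δ - β * γ) with hκ
    have hk : k = α * δ * κ - β * γ * κ := by rw [hκ]; field_simp
    have key : ∀ s t : ℝ, θ (α * s + γ * t + k) - θ (α * s + γ * t)
        = (θ (α * s + α * δ * κ) - θ (α * s) + η (β * s + β * δ * κ) - η (β * s))
          + (θ (γ * t - γ * β * κ) - θ (γ * t) + η (δ * t - δ * β * κ) - η (δ * t)) := by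
      intro s t
      have e1 := heq (s + δ * κ) (t - β * κ)
      have e2 := heq s t
      rw [show α * (s + δ * κ) + γ * (t - β * κ) = α * s + γ * t + k by rw [hk]; ring,
        show β * (s + δ * κ) + δ * (t - β * κ) = β * s + δ * t by ring,
        show α * (s + δ * κ) = α * s + α * δ * κ by ring,
        show β * (s + δ * κ) = β * s + β * δ * κ by ring,
        show γ * (t - β * κ) = γ * t - γ * β * κ by ring,
        show δ * (t - β * κ) = δ * t - δ * β * κ by ring] at e1
      linear_combination e1 - e2
    have k1 := key (x / α) (y / γ)
    have k2 := key (x / α) 0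
    have k3 := key 0 (y / γ)
    have k4 := key 0 0
    simp only [mul_div_cancel₀ _ hα, mul_div_cancel₀ _ hγ, mul_zero, zero_add, add_zero]
      at k1 k2 k3 k4
    linear_combination k1 - k2 - k3 + k4
  -- hence the increment is bilinear
  set B : ℝ → ℝ → ℂ := fun k x => θ (x + k) - θ x - θ k with hB
  have hBx : ∀ k x y, B k (x + y) = B k x + B k y := by
    intro k x y
    have := h1 k x y
    simp only [hB]
    rw [hθ0] at this
    linear_combination this
  have hBc : ∀ k, Continuous (B k) := fun k => by simp only [hB]; fun_prop
  have hBlin : ∀ k x, B k x = x * B k 1 := fun k => (hBc k).eq_mul_of_map_add (hBx k)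
  have hsymm : ∀ k x, B k x = B x k := fun k x => by simp only [hB]; rw [add_comm]; ring
  have hB1 : ∀ k, B k 1 = k * B 1 1 := fun k => by rw [hsymm, hBlin]
  set l := B 1 1 / 2 with hl
  have hadd : ∀ x y, (fun x : ℝ => θ x - l * (x : ℂ) ^ 2) (x + y) =
      (fun x : ℝ => θ x - l * (x : ℂ) ^ 2) x + (fun x : ℝ => θ x - l * (x : ℂ) ^ 2) y := by
    intro x y
    have : θ (x + y) - θ x - θ y = x * (y * B 1 1) := by
      have := hBlin y x
      rw [hB1] at this
      simpa [hB] using this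
    simp only [Complex.ofReal_add]
    rw [hl]
    linear_combination this
  have hcont : Continuous (fun x : ℝ => θ x - l * (x : ℂ) ^ 2) := by fun_prop
  refine ⟨θ 1 - l, l, fun x => ?_⟩
  have := hcont.eq_mul_of_map_add hadd x
  simp only [Complex.ofReal_one, one_pow, mul_one] at this
  linear_combination this

/-- A characteristic function that is the exponential of a quadratic polynomial is Gaussian. -/
lemma eq_gaussianReal_of_charFun_eq_exp {μ : Measure ℝ} [IsProbabilityMeasure μ] {m l : ℂ}
    (h : ∀ x : ℝ, charFun μ x = Complex.exp (m * x + l * x ^ 2)) :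
    ∃ s : NNReal, μ = gaussianReal m.im s ∧ l = ((-(s : ℝ) / 2 : ℝ) : ℂ) := by
  have hnorm : ∀ x : ℝ, ‖charFun μ x‖ = Real.exp (m.re * x + l.re * x ^ 2) := by
    intro x
    rw [h, Complex.norm_exp]
    congr 1
    simp [← Complex.ofReal_pow]
  have hconj : ∀ x : ℝ, charFun μ (-x) = starRingEnd ℂ (charFun μ x) := fun x => charFun_neg x
  have hmre : m.re = 0 := by
    have h1 := hnorm 1
    have h2 := hnorm (-1)
    rw [hconj 1, RCLike.norm_conj, h1, Real.exp_eq_exp] at h2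
    linarith
  have hlre : l.re ≤ 0 := by
    have h1 := hnorm 1
    have h2 : ‖charFun μ 1‖ ≤ 1 := norm_charFun_le_one 1
    rw [h1, Real.exp_le_one_iff, hmre] at h2
    linarith
  have hlim : l.im = 0 := by
    by_contra hne
    have key : ∀ x : ℝ, Complex.exp ((2 * l.im * x ^ 2 : ℝ) * Complex.I) = 1 := by
      intro x
      have e1 : charFun μ x * charFun μ (-x) = (‖charFun μ x‖ ^ 2 : ℝ) := by
        rw [hconj, Complex.mul_conj, Complex.normSq_eq_norm_sq]
      rw [h, h, ← Complex.exp_add, ← h, hnorm, hmre, ← Real.exp_nat_mul] at e1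
      push_cast at e1
      have e2 : Complex.exp ((2 * l.im * x ^ 2 : ℝ) * Complex.I)
          = Complex.exp (m * x + l * x ^ 2 + (m * -x + l * (-x) ^ 2)) *
            Complex.exp (-(2 * ((0 : ℂ) * x + l.re * x ^ 2))) := by
        rw [← Complex.exp_add]
        congr 1
        push_cast
        linear_combination (2 * (x : ℂ) ^ 2) * Complex.re_add_im l
      rw [e2, e1, ← Complex.exp_add]
      simp
    have h1 := key (Real.sqrt (Real.pi / (2 * |l.im|)))
    rw [Real.sq_sqrt (by positivity)] at h1
    rcases abs_choice l.im with ha | ha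
    · rw [ha, show 2 * l.im * (Real.pi / (2 * l.im)) = Real.pi by field_simp,
        Complex.exp_pi_mul_I] at h1
      norm_num at h1
    · rw [ha, show 2 * l.im * (Real.pi / (2 * -l.im)) = -Real.pi by field_simp] at h1
      push_cast at h1
      rw [neg_mul, Complex.exp_neg, Complex.exp_pi_mul_I] at h1
      norm_num at h1
  obtain ⟨s, hs⟩ : ∃ s : NNReal, (s : ℝ) = -2 * l.re := ⟨⟨-2 * l.re, by linarith⟩, rfl⟩
  have hl : l = ((-(s : ℝ) / 2 : ℝ) : ℂ) := by
    apply Complex.ext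
    · rw [hs, Complex.ofReal_re]; ring
    · simp only [Complex.ofReal_im, hlim]
  refine ⟨s, ?_, hl⟩
  apply Measure.ext_of_charFun
  ext x
  rw [h, charFun_gaussianReal]
  congr 1
  have hm : m = m.im * Complex.I := by
    apply Complex.ext <;> simp [hmre]
  conv_lhs => rw [hm, hl]
  push_cast
  ring

/-! ### Bernstein's theorem -/

/-- The functional equation propagates nonvanishing from a neighbourhood of `0` to the line: it
enlarges a symmetric interval free of zeros by a fixed factor. -/
lemma ne_zero_of_functional_equation {f g : ℝ → ℂ} (hf : Continuous f) (hg : Continuous g)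
    (hf0 : f 0 = 1) (hg0 : g 0 = 1) {α β γ δ : ℝ} (hα : α ≠ 0) (hβ : β ≠ 0) (hγ : γ ≠ 0)
    (hδ : δ ≠ 0)
    (heq : ∀ s t : ℝ, f (α * s + γ * t) * g (β * s + δ * t)
      = f (α * s) * g (β * s) * f (γ * t) * g (δ * t)) (x : ℝ) : f x ≠ 0 ∧ g x ≠ 0 := by
  set N : ℝ → Prop := fun ρ => ∀ s : ℝ, |s| < ρ →
    f (α * s) ≠ 0 ∧ g (β * s) ≠ 0 ∧ f (γ * s) ≠ 0 ∧ g (δ * s) ≠ 0 with hN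
  -- a point `x` with `|x| < (|a| + |b|) ρ` is `a s + b t` with `|s|, |t| < ρ`
  have split : ∀ a b ρ x : ℝ, a ≠ 0 → b ≠ 0 → |x| < (|a| + |b|) * ρ →
      ∃ s t, |s| < ρ ∧ |t| < ρ ∧ a * s + b * t = x := by
    intro a b ρ x ha hb hx
    have hab : 0 < |a| + |b| := by positivity
    have hsgn : ∀ c : ℝ, c ≠ 0 → |(x / (|a| + |b|)) * SignType.sign c| < ρ := by
      intro c hc
      rw [abs_mul, abs_div, abs_of_pos hab]
      have : |((SignType.sign c : SignType) : ℝ)| = 1 := by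
        rcases lt_or_gt_of_ne hc with h | h <;> simp [h]
      rw [this, mul_one, div_lt_iff₀ hab, mul_comm]
      exact hx
    refine ⟨_, _, hsgn a ha, hsgn b hb, ?_⟩
    have e : ∀ c : ℝ, c * ((x / (|a| + |b|)) * SignType.sign c) = |c| * (x / (|a| + |b|)) := by
      intro c
      rw [mul_left_comm, self_mul_sign, mul_comm]
    rw [e, e]
    field_simp
  have stepf : ∀ ρ, N ρ → ∀ x, |x| < (|α| + |γ|) * ρ → f x ≠ 0 := by
    intro ρ h x hx
    obtain ⟨s, t, hs, ht, rfl⟩ := split α γ ρ x hα hγ hx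
    have h1 := heq s t
    have := mul_ne_zero (mul_ne_zero (mul_ne_zero (h s hs).1 (h s hs).2.1) (h t ht).2.2.1)
      (h t ht).2.2.2
    rw [← h1] at this
    exact left_ne_zero_of_mul this
  have stepg : ∀ ρ, N ρ → ∀ x, |x| < (|β| + |δ|) * ρ → g x ≠ 0 := by
    intro ρ h x hx
    obtain ⟨s, t, hs, ht, rfl⟩ := split β δ ρ x hβ hδ hx
    have h1 := heq s t
    have := mul_ne_zero (mul_ne_zero (mul_ne_zero (h s hs).1 (h s hs).2.1) (h t ht).2.2.1)
      (h t ht).2.2.2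
    rw [← h1] at this
    exact right_ne_zero_of_mul this
  obtain ⟨c, hc0, hc⟩ : ∃ c : ℝ, 0 < c ∧ ∀ p ∈ [(α, γ), (γ, α), (β, δ), (δ, β)],
      (1 + c) * |p.1| ≤ |p.1| + |p.2| := by
    refine ⟨min (min (|γ| / |α|) (|α| / |γ|)) (min (|δ| / |β|) (|β| / |δ|)), by positivity, ?_⟩
    intro p hp
    suffices h : min (min (|γ| / |α|) (|α| / |γ|)) (min (|δ| / |β|) (|β| / |δ|)) ≤ |p.2| / |p.1| ∧
        0 < |p.1| by
      have := (le_div_iff₀ h.2).1 h.1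
      linarith
    simp only [List.mem_cons, List.not_mem_nil, or_false] at hp
    rcases hp with rfl | rfl | rfl | rfl <;> simp [*]
  have grow : ∀ ρ, 0 < ρ → N ρ → N ((1 + c) * ρ) := by
    intro ρ hρ h s hs
    have bound : ∀ a b : ℝ, a ≠ 0 → (1 + c) * |a| ≤ |a| + |b| →
        |a * s| < (|a| + |b|) * ρ := by
      intro a b ha hab
      rw [abs_mul]
      have h1 : |a| * |s| < |a| * ((1 + c) * ρ) := by gcongr
      nlinarith
    refine ⟨stepf ρ h _ (bound α γ hα (hc (α, γ) (by simp))),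
      stepg ρ h _ (bound β δ hβ (hc (β, δ) (by simp))), stepf ρ h _ ?_, stepg ρ h _ ?_⟩
    · rw [add_comm]; exact bound γ α hγ (hc (γ, α) (by simp))
    · rw [add_comm]; exact bound δ β hδ (hc (δ, β) (by simp))
  have start : ∃ r, 0 < r ∧ N r := by
    have h1 : ∀ᶠ s in nhds (0 : ℝ), f (α * s) ≠ 0 ∧ g (β * s) ≠ 0 ∧ f (γ * s) ≠ 0 ∧
        g (δ * s) ≠ 0 := by
      have key : ∀ (k : ℝ → ℂ), Continuous k → k 0 = 1 → ∀ a : ℝ,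
          ∀ᶠ s in nhds (0 : ℝ), k (a * s) ≠ 0 := by
        intro k hk hk0 a
        have : Continuous fun s => k (a * s) := by fun_prop
        exact this.continuousAt.eventually_ne (by simp [hk0])
      filter_upwards [key f hf hf0 α, key g hg hg0 β, key f hf hf0 γ, key g hg hg0 δ]
        with s a b c d using ⟨a, b, c, d⟩
    obtain ⟨r, hr, h⟩ := Metric.eventually_nhds_iff.1 h1
    exact ⟨r, hr, fun s hs => h (by simpa using hs)⟩
  obtain ⟨r, hr, hNr⟩ := start
  have all : ∀ n : ℕ, N ((1 + c) ^ n * r) := by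
    intro n
    induction n with
    | zero => simpa using hNr
    | succ n ih =>
      have := grow _ (by positivity) ih
      rwa [pow_succ', mul_assoc]
  have big : ∀ y : ℝ, ∃ n : ℕ, |y| < (1 + c) ^ n * r := by
    intro y
    obtain ⟨n, hn⟩ := pow_unbounded_of_one_lt (|y| / r) (by linarith : 1 < 1 + c)
    exact ⟨n, (div_lt_iff₀ hr).1 hn⟩
  constructor
  · obtain ⟨n, hn⟩ := big (x / α)
    have := (all n _ hn).1
    rwa [mul_div_cancel₀ _ hα] at this
  · obtain ⟨n, hn⟩ := big (x / β)
    have := (all n _ hn).2.1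
    rwa [mul_div_cancel₀ _ hβ] at this

/-- Uniqueness of continuous logarithms on the plane. -/
lemma eq_of_exp_eq {F G : ℝ × ℝ → ℂ} (hF : Continuous F) (hG : Continuous G)
    (h : ∀ p, Complex.exp (F p) = Complex.exp (G p)) (h0 : F 0 = G 0) (p : ℝ × ℝ) :
    F p = G p := by
  have := (Complex.isCoveringMapOn_exp.existsUnique_continuousMap_lifts
    ⟨fun q => Complex.exp (F q), by fun_prop⟩ (a₀ := 0) (e₀ := F 0) rfl (by simp)).unique
    (y₁ := ⟨F, hF⟩) (y₂ := ⟨G, hG⟩) ⟨rfl, rfl⟩ ⟨h0.symm, by ext q; simp [h]⟩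
  exact congrArg (fun k : C(ℝ × ℝ, ℂ) => k p) this

/-- **Bernstein–Darmois–Skitovich theorem** for two summands, stated for the characteristic
functions: if `X` and `Y` are independent with laws `μ` and `ν`, the hypothesis `heq` says that
`α X + β Y` and `γ X + δ Y` are independent. If moreover `X` enters both forms and is not constant,
then so does `Y`, and both variables are nondegenerate Gaussian. -/
theorem gaussian_of_charFun_functional_equation {μ ν : Measure ℝ} [IsProbabilityMeasure μ]
    [IsProbabilityMeasure ν] {α β γ δ : ℝ} (hα : α ≠ 0) (hγ : γ ≠ 0)
    (hdet : α * δ - β * γ ≠ 0)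
    (heq : ∀ s t : ℝ, charFun μ (α * s + γ * t) * charFun ν (β * s + δ * t)
      = charFun μ (α * s) * charFun ν (β * s) * charFun μ (γ * t) * charFun ν (δ * t))
    (hμ : ∀ c, μ ≠ Measure.dirac c) :
    β ≠ 0 ∧ δ ≠ 0 ∧ (∃ m s, s ≠ 0 ∧ μ = gaussianReal m s) ∧
      ∃ m s, s ≠ 0 ∧ ν = gaussianReal m s := by
  have hf : Continuous (charFun μ) := continuous_charFun
  have hg : Continuous (charFun ν) := continuous_charFun
  have hf0 : charFun μ 0 = 1 := by simp
  have hg0 : charFun ν 0 = 1 := by simp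
  -- a multiplicative characteristic function belongs to a constant variable
  have hmul : ¬ ∀ x y : ℝ, charFun μ (x + y) = charFun μ x * charFun μ y := by
    intro h
    have hne : ∀ x, charFun μ x ≠ 0 := by
      intro x hx
      have := h x (-x)
      rw [hx, add_neg_cancel, hf0, zero_mul] at this
      exact one_ne_zero this
    obtain ⟨θ, hθ, hθ0, hfθ⟩ := exists_continuous_log hf hf0 hne
    have hadd : ∀ x y, θ (x + y) = θ x + θ y := by
      intro x y
      refine eq_of_exp_eq (F := fun p => θ (p.1 + p.2)) (G := fun p => θ p.1 + θ p.2)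
        (by fun_prop) (by fun_prop) ?_ (by simp [hθ0]) (x, y)
      intro p
      rw [Complex.exp_add, ← hfθ, ← hfθ, ← hfθ, h]
    obtain ⟨s, hs, h0⟩ := eq_gaussianReal_of_charFun_eq_exp (μ := μ) (m := θ 1) (l := 0)
      (fun x => by rw [hfθ, hθ.eq_mul_of_map_add hadd]; congr 1; ring)
    have h1 : s = 0 := by
      have h2 : (-(s : ℝ) / 2) = 0 := by exact_mod_cast h0.symm
      have h3 : (s : ℝ) = 0 := by linarith
      exact_mod_cast h3
    rw [h1, gaussianReal_zero_var] at hs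
    exact hμ _ hs
  -- a multiplicative identity near the axis extends to the plane
  have extend : (∃ r > 0, ∀ x y : ℝ, |y| < r → charFun μ (x + y) = charFun μ x * charFun μ y) →
      False := by
    rintro ⟨r, hr, h⟩
    apply hmul
    intro x y
    obtain ⟨n, hn⟩ := exists_nat_gt (|y| / r)
    have hn0 : (0 : ℝ) < n := lt_of_le_of_lt (by positivity) hn
    have hsmall : |y / n| < r := by
      rw [abs_div, abs_of_pos hn0, div_lt_iff₀ hn0]
      rw [div_lt_iff₀ hr] at hn
      linarith
    have key : ∀ k : ℕ, ∀ x, charFun μ (x + k * (y / n)) = charFun μ x * charFun μ (y / n) ^ k := by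
      intro k
      induction k with
      | zero => intro x; simp
      | succ k ih =>
        intro x
        rw [show x + ((k + 1 : ℕ) : ℝ) * (y / n) = (x + k * (y / n)) + y / n by push_cast; ring,
          h _ _ hsmall, ih, pow_succ]
        ring
    have h1 := key n x
    have h2 := key n 0
    rw [mul_div_cancel₀ _ hn0.ne'] at h1 h2
    rw [hf0, one_mul, zero_add] at h2
    rw [h1, h2]
  have near : ∀ c : ℝ, ∃ r > 0, ∀ t, |t| < r → charFun ν (c * t) ≠ 0 := by
    intro c
    have : Continuous fun s => charFun ν (c * s) := by fun_prop
    have h1 := this.continuousAt.eventually_ne (x := 0) (y := 0) (by simp)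
    obtain ⟨r, hr, h⟩ := Metric.eventually_nhds_iff.1 h1
    exact ⟨r, hr, fun t ht => h (by simpa using ht)⟩
  have hβ : β ≠ 0 := by
    rintro rfl
    obtain ⟨r, hr, hne⟩ := near δ
    refine extend ⟨|γ| * r, by positivity, fun x y hy => ?_⟩
    have := heq (x / α) (y / γ)
    have hy' : |y / γ| < r := by
      rw [abs_div, div_lt_iff₀ (by positivity)]; linarith
    have hd := hne _ hy'
    rw [mul_div_cancel₀ _ hα, mul_div_cancel₀ _ hγ, zero_mul, zero_add, hg0, mul_one] at this
    exact mul_right_cancel₀ hd this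
  have hδ : δ ≠ 0 := by
    rintro rfl
    obtain ⟨r, hr, hne⟩ := near β
    refine extend ⟨|α| * r, by positivity, fun x y hy => ?_⟩
    have := heq (y / α) (x / γ)
    have hy' : |y / α| < r := by
      rw [abs_div, div_lt_iff₀ (by positivity)]; linarith
    have hd := hne _ hy'
    rw [mul_div_cancel₀ _ hα, mul_div_cancel₀ _ hγ, zero_mul, add_zero, hg0, mul_one] at this
    apply mul_right_cancel₀ hd
    rw [add_comm x y, this]
    ring
  refine ⟨hβ, hδ, ?_⟩
  have hne := ne_zero_of_functional_equation hf hg hf0 hg0 hα hβ hγ hδ heq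
  obtain ⟨θ, hθ, hθ0, hfθ⟩ := exists_continuous_log hf hf0 fun x => (hne x).1
  obtain ⟨η, hη, hη0, hgη⟩ := exists_continuous_log hg hg0 fun x => (hne x).2
  have hlog : ∀ s t : ℝ, θ (α * s + γ * t) + η (β * s + δ * t)
      = θ (α * s) + η (β * s) + θ (γ * t) + η (δ * t) := by
    intro s t
    refine eq_of_exp_eq (F := fun p => θ (α * p.1 + γ * p.2) + η (β * p.1 + δ * p.2))
      (G := fun p => θ (α * p.1) + η (β * p.1) + θ (γ * p.2) + η (δ * p.2))
      (by fun_prop) (by fun_prop) ?_ (by simp [hθ0, hη0]) (s, t)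
    intro p
    simp only [Complex.exp_add, ← hfθ, ← hgη]
    exact heq _ _
  obtain ⟨m, l, hml⟩ := exists_quadratic_of_functional_equation hθ hθ0 hα hγ hdet hlog
  obtain ⟨m', l', hml'⟩ := exists_quadratic_of_functional_equation hη hη0 hβ hδ
    (α := β) (β := α) (γ := δ) (δ := γ) (η := θ) (by intro h; apply hdet; linarith)
    (fun s t => by linear_combination hlog s t)
  obtain ⟨s, hs, hsl⟩ := eq_gaussianReal_of_charFun_eq_exp (μ := μ)
    (fun x => by rw [hfθ, hml])
  obtain ⟨s', hs', hsl'⟩ := eq_gaussianReal_of_charFun_eq_exp (μ := ν)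
    (fun x => by rw [hgη, hml'])
  have hs0 : s ≠ 0 := by
    rintro rfl
    rw [gaussianReal_zero_var] at hs
    exact hμ _ hs
  -- the coefficient of `s t` in the logarithmic equation: the two forms are uncorrelated
  have hcov : α * γ * s + β * δ * s' = 0 := by
    have h1 := hlog 1 1
    simp only [hml, hml', hsl, hsl'] at h1
    push_cast at h1
    have h2 : ((α * γ * s + β * δ * s' : ℝ) : ℂ) = 0 := by
      push_cast
      linear_combination (-1 : ℂ) * h1
    exact_mod_cast h2
  refine ⟨⟨_, s, hs0, hs⟩, _, s', ?_, hs'⟩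
  rintro rfl
  have : α * γ * (s : ℝ) ≠ 0 := mul_ne_zero (mul_ne_zero hα hγ) (by exact_mod_cast hs0)
  apply this
  simpa using hcov

/-! ### Continuity of solutions of additive equations along curves -/

/-- Averages of a bounded measurable function along a family of one-dimensional changes of variables
depend continuously on the parameter. -/
lemma continuousOn_integral_comp {V K J : Set ℝ} (hK : MeasurableSet K)
    (hKfin : volume K ≠ ⊤) (hJ : MeasurableSet J) (hJfin : volume J ≠ ⊤)
    {τ τ' : ℝ → ℝ → ℝ} {c : ℝ} (hc : 0 < c)
    (hτ : ∀ v ∈ V, ∀ w ∈ K, HasDerivAt (τ v) (τ' v w) w)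
    (hτc : ∀ w ∈ K, ContinuousOn (fun v => τ v w) V)
    (hτ' : ∀ v ∈ V, ∀ w ∈ K, c ≤ |τ' v w|)
    (hinj : ∀ v ∈ V, InjOn (τ v) K) (hmaps : ∀ v ∈ V, MapsTo (τ v) K J)
    {ψ : ℝ → ℝ} (hψ : Measurable ψ) {C : ℝ} (hC : ∀ t, |ψ t| ≤ C) :
    ContinuousOn (fun v => ∫ w in K, ψ (τ v w)) V := by
  have hψi : Integrable (J.indicator ψ) := by
    rw [integrable_indicator_iff hJ]
    exact Measure.integrableOn_of_bounded hJfin hψ.aestronglyMeasurable (M := C)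
      (ae_of_all _ fun t => hC t)
  have hτm : ∀ v ∈ V, AEMeasurable (τ v) (volume.restrict K) := by
    intro v hv
    refine ContinuousOn.aemeasurable (fun w hw => ?_) hK
    exact (hτ v hv w hw).continuousAt.continuousWithinAt
  have : IsFiniteMeasure (volume.restrict K) := ⟨by simpa using hKfin.lt_top⟩
  apply continuousOn_of_uniform_approx_of_continuousOn
  intro U hU
  obtain ⟨ε, hε, hεU⟩ := Metric.mem_uniformity_dist.1 hU
  obtain ⟨g, hg, hgi⟩ := hψi.exists_boundedContinuous_lintegral_sub_le
    (ε := ENNReal.ofReal (c * (ε / 2))) (by simp; positivity)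
  refine ⟨fun v => ∫ w in K, g (τ v w), ?_, ?_⟩
  · apply continuousOn_of_dominated (bound := fun _ => ‖g‖)
    · intro v hv
      exact (g.continuous.measurable.comp_aemeasurable (hτm v hv)).aestronglyMeasurable
    · intro v _
      exact ae_of_all _ fun w => g.norm_coe_le_norm _
    · exact integrable_const _
    · filter_upwards [ae_restrict_mem hK] with w hw
      exact g.continuous.comp_continuousOn (hτc w hw)
  · intro v hv
    apply hεU
    have h1 : Integrable (fun w => ψ (τ v w)) (volume.restrict K) :=
      Integrable.of_bound (hψ.comp_aemeasurable (hτm v hv)).aestronglyMeasurable C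
        (ae_of_all _ fun w => hC _)
    have h2 : Integrable (fun w => g (τ v w)) (volume.restrict K) :=
      Integrable.of_bound
        (g.continuous.measurable.comp_aemeasurable (hτm v hv)).aestronglyMeasurable ‖g‖
        (ae_of_all _ fun w => g.norm_coe_le_norm _)
    rw [dist_eq_norm, ← integral_sub h1 h2]
    have h3 : ∫⁻ w in K, ‖ψ (τ v w) - g (τ v w)‖ₑ ≤ ENNReal.ofReal (ε / 2) := by
      have h4 : ENNReal.ofReal c * ∫⁻ w in K, ‖ψ (τ v w) - g (τ v w)‖ₑ
          ≤ ENNReal.ofReal c * ENNReal.ofReal (ε / 2) := by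
        rw [← lintegral_const_mul' _ _ ENNReal.ofReal_ne_top, ← ENNReal.ofReal_mul hc.le]
        calc ∫⁻ w in K, ENNReal.ofReal c * ‖ψ (τ v w) - g (τ v w)‖ₑ
            ≤ ∫⁻ w in K, ENNReal.ofReal |τ' v w| * ‖J.indicator ψ (τ v w) - g (τ v w)‖ₑ := by
              refine setLIntegral_mono' hK fun w hw => ?_
              rw [indicator_of_mem (hmaps v hv hw)]
              gcongr
              exact hτ' v hv w hw
          _ = ∫⁻ t in τ v '' K, ‖J.indicator ψ t - g t‖ₑ :=
              (lintegral_image_eq_lintegral_abs_deriv_mul hK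
                (fun w hw => (hτ v hv w hw).hasDerivWithinAt) (hinj v hv)
                (fun t => ‖J.indicator ψ t - g t‖ₑ)).symm
          _ ≤ ∫⁻ t, ‖J.indicator ψ t - g t‖ₑ := setLIntegral_le_lintegral _ _
          _ ≤ _ := hg
      exact (ENNReal.mul_le_mul_iff_right (by simpa using hc) ENNReal.ofReal_ne_top).1 h4
    have h5 : ‖∫ w in K, (ψ (τ v w) - g (τ v w))‖ₑ ≤ ENNReal.ofReal (ε / 2) :=
      (enorm_integral_le_lintegral_enorm _).trans h3
    rw [← ofReal_norm, ENNReal.ofReal_le_ofReal_iff (by positivity)] at h5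
    linarith

/-- Local regularity in the equation `X v + Z w = Ψ (τ v w)`: averaging a bounded function of both
sides over `w` expresses `X v` through a continuous function of `v`. -/
lemma exists_continuousOn_of_add_eq_comp {V K J : Set ℝ} (hV : MeasurableSet V)
    (hK : MeasurableSet K) (hK0 : volume K ≠ 0)
    (hKfin : volume K ≠ ⊤) (hJ : MeasurableSet J) (hJfin : volume J ≠ ⊤)
    {τ τ' : ℝ → ℝ → ℝ} {c : ℝ} (hc : 0 < c)
    (hτ : ∀ v ∈ V, ∀ w ∈ K, HasDerivAt (τ v) (τ' v w) w)
    (hτc : ∀ w ∈ K, ContinuousOn (fun v => τ v w) V)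
    (hτ' : ∀ v ∈ V, ∀ w ∈ K, c ≤ |τ' v w|)
    (hinj : ∀ v ∈ V, InjOn (τ v) K) (hmaps : ∀ v ∈ V, MapsTo (τ v) K J)
    {X Z Ψ : ℝ → ℝ} (hZ : Measurable Z) (hΨ : Measurable Ψ)
    (heq : ∀ᵐ v ∂(volume.restrict V), ∀ᵐ w ∂(volume.restrict K), X v + Z w = Ψ (τ v w)) :
    ∃ X' : ℝ → ℝ, ContinuousOn X' V ∧ ∀ᵐ v ∂(volume.restrict V), X v = X' v := by
  have : IsFiniteMeasure (volume.restrict K) := ⟨by simpa using hKfin.lt_top⟩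
  have : NeZero (volume.restrict K) := ⟨by simpa using hK0⟩
  have hatan : ∀ x : ℝ, |Real.arctan x| ≤ Real.pi / 2 := fun x =>
    abs_le.2 ⟨(Real.neg_pi_div_two_lt_arctan x).le, (Real.arctan_lt_pi_div_two x).le⟩
  have hmint : ∀ x, Integrable (fun w => Real.arctan (x + Z w)) (volume.restrict K) := fun x =>
    Integrable.of_bound (Measurable.aestronglyMeasurable (by fun_prop)) (Real.pi / 2)
      (ae_of_all _ fun w => hatan _)
  have hτm : ∀ v ∈ V, AEMeasurable (τ v) (volume.restrict K) := by
    intro v hv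
    refine ContinuousOn.aemeasurable (fun w hw => ?_) hK
    exact (hτ v hv w hw).continuousAt.continuousWithinAt
  have hMint : ∀ v ∈ V, Integrable (fun w => Real.arctan (Ψ (τ v w))) (volume.restrict K) :=
    fun v hv => Integrable.of_bound
      ((Real.measurable_arctan.comp hΨ).comp_aemeasurable (hτm v hv)).aestronglyMeasurable
      (Real.pi / 2) (ae_of_all _ fun w => hatan _)
  set m : ℝ → ℝ := fun x => ∫ w in K, Real.arctan (x + Z w) with hm
  set M : ℝ → ℝ := fun v => ∫ w in K, Real.arctan (Ψ (τ v w)) with hM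
  have lt_of_lt : ∀ {a b : ℝ → ℝ}, Integrable a (volume.restrict K) →
      Integrable b (volume.restrict K) → (∀ w, a w < b w) → ∫ w in K, a w < ∫ w in K, b w := by
    intro a b ha hb hab
    rw [← sub_pos, ← integral_sub hb ha, integral_pos_iff_support_of_nonneg
      (fun w => (sub_pos.2 (hab w)).le) (hb.sub ha)]
    have : Function.support (fun w => b w - a w) = univ := by
      ext w
      simpa using (sub_pos.2 (hab w)).ne'
    rw [this]
    simpa [pos_iff_ne_zero] using hK0
  have hmono : StrictMono m := fun x y hxy =>
    lt_of_lt (hmint x) (hmint y) fun w => Real.arctan_strictMono (by linarith)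
  have hmc : Continuous m := by
    apply continuous_of_dominated (bound := fun _ => Real.pi / 2)
    · exact fun x => (hmint x).aestronglyMeasurable
    · exact fun x => ae_of_all _ fun w => hatan _
    · exact integrable_const _
    · exact ae_of_all _ fun w => by fun_prop
  have hMc : ContinuousOn M V :=
    continuousOn_integral_comp hK hKfin hJ hJfin hc hτ hτc hτ' hinj hmaps
      (ψ := fun t => Real.arctan (Ψ t)) (by fun_prop) (fun t => hatan _)
  have htop : Tendsto m atTop (𝓝 (∫ _ in K, Real.pi / 2)) := by
    apply tendsto_integral_filter_of_dominated_convergence (fun _ => Real.pi / 2)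
    · exact Eventually.of_forall fun x => (hmint x).aestronglyMeasurable
    · exact Eventually.of_forall fun x => ae_of_all _ fun w => hatan _
    · exact integrable_const _
    · exact ae_of_all _ fun w => (tendsto_nhds_of_tendsto_nhdsWithin Real.tendsto_arctan_atTop).comp
        (tendsto_atTop_add_const_right _ _ tendsto_id)
  have hbot : Tendsto m atBot (𝓝 (∫ _ in K, -(Real.pi / 2))) := by
    apply tendsto_integral_filter_of_dominated_convergence (fun _ => Real.pi / 2)
    · exact Eventually.of_forall fun x => (hmint x).aestronglyMeasurable
    · exact Eventually.of_forall fun x => ae_of_all _ fun w => hatan _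
    · exact integrable_const _
    · exact ae_of_all _ fun w => (tendsto_nhds_of_tendsto_nhdsWithin Real.tendsto_arctan_atBot).comp
        (tendsto_atBot_add_const_right _ _ tendsto_id)
  have hsurj : ∀ v ∈ V, ∃ x, m x = M v := by
    intro v hv
    have h1 : M v < ∫ _ in K, Real.pi / 2 :=
      lt_of_lt (hMint v hv) (integrable_const _) fun w => Real.arctan_lt_pi_div_two _
    have h2 : ∫ _ in K, -(Real.pi / 2) < M v :=
      lt_of_lt (integrable_const _) (hMint v hv) fun w => Real.neg_pi_div_two_lt_arctan _
    obtain ⟨b, hb⟩ := (htop.eventually (lt_mem_nhds h1)).exists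
    obtain ⟨a, ha⟩ := (hbot.eventually (gt_mem_nhds h2)).exists
    exact mem_range_of_exists_le_of_exists_ge hmc ⟨a, ha.le⟩ ⟨b, hb.le⟩
  choose! X' hX' using hsurj
  refine ⟨X', ?_, ?_⟩
  · have hemb : IsEmbedding m := hmono.isEmbedding_of_ordConnected
      (isPreconnected_range hmc).ordConnected
    rw [hemb.isInducing.continuousOn_iff]
    exact hMc.congr fun v hv => hX' v hv
  · filter_upwards [heq, ae_restrict_mem hV] with v hv hvV
    apply hmono.injective
    rw [hX' v hvV]
    exact integral_congr_ae (by filter_upwards [hv] with w hw; rw [hw])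

/-- A function that is locally almost everywhere equal to a continuous function is globally so. -/
lemma exists_continuousOn_of_locally {U : Set ℝ} (hU : IsOpen U) {X : ℝ → ℝ}
    (h : ∀ c ∈ U, ∃ V, IsOpen V ∧ c ∈ V ∧ ∃ X' : ℝ → ℝ, ContinuousOn X' V ∧
      ∀ᵐ v ∂(volume.restrict V), X v = X' v) :
    ∃ X' : ℝ → ℝ, ContinuousOn X' U ∧ ∀ᵐ v ∂(volume.restrict U), X v = X' v := by
  choose! V hVo hcV Y hYc hYe using h
  -- two local continuous versions agree where both are defined
  have agree : ∀ c ∈ U, ∀ v ∈ V c ∩ U, Y v v = Y c v := by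
    intro c hc v hv
    have hW : IsOpen (V c ∩ V v) := (hVo c hc).inter (hVo v hv.2)
    have hae : Y v =ᵐ[volume.restrict (V c ∩ V v)] Y c := by
      have h1 := ae_restrict_of_ae_restrict_of_subset (inter_subset_left (t := V v)) (hYe c hc)
      have h2 := ae_restrict_of_ae_restrict_of_subset (inter_subset_right (s := V c)) (hYe v hv.2)
      filter_upwards [h1, h2] with w h1 h2
      rw [← h1, ← h2]
    exact Measure.eqOn_open_of_ae_eq hae hW ((hYc v hv.2).mono inter_subset_right)
      ((hYc c hc).mono inter_subset_left) ⟨hv.1, hcV v hv.2⟩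
  refine ⟨fun v => Y v v, ?_, ?_⟩
  · intro c hc
    have h1 : ContinuousAt (Y c) c := (hYc c hc).continuousAt ((hVo c hc).mem_nhds (hcV c hc))
    refine (h1.congr ?_).continuousWithinAt
    filter_upwards [(hVo c hc).mem_nhds (hcV c hc), hU.mem_nhds hc] with v h2 h3
    exact (agree c hc v ⟨h2, h3⟩).symm
  · rw [ae_restrict_iff' hU.measurableSet, ae_iff]
    apply measure_null_of_locally_null
    intro c hc
    have hcU : c ∈ U := by
      simp only [mem_ofPred_eq, Classical.not_imp] at hc
      exact hc.1
    refine ⟨_ ∩ V c, inter_mem_nhdsWithin _ ((hVo c hcU).mem_nhds (hcV c hcU)), ?_⟩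
    have h1 := hYe c hcU
    rw [ae_restrict_iff' (hVo c hcU).measurableSet, ae_iff] at h1
    refine measure_mono_null ?_ h1
    rintro v ⟨hv1, hv2⟩
    simp only [mem_ofPred_eq, Classical.not_imp] at hv1 ⊢
    exact ⟨hv2, by rw [← agree c hcU v ⟨hv2, hv1.1⟩]; exact hv1.2⟩

/-! ### Measure-preserving diffeomorphisms of the square -/

/-- The uniform law on `(0,1)`. -/
noncomputable abbrev unif : Measure ℝ := volume.restrict unitIoo

/-- The open unit square, as a subset of `ℝ × ℝ`. -/
abbrev unitSq : Set (ℝ × ℝ) := unitIoo ×ˢ unitIoo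

lemma isOpen_unitIoo : IsOpen unitIoo := isOpen_Ioo

lemma isOpen_unitSq : IsOpen unitSq := isOpen_unitIoo.prod isOpen_unitIoo

instance isProbabilityMeasure_unif : IsProbabilityMeasure unif := ⟨by simp [unif, unitIoo]⟩

lemma prod_unif_eq : unif.prod unif = volume.restrict unitSq := Measure.prod_restrict _ _

lemma ae_unif_mem : ∀ᵐ v ∂unif, v ∈ unitIoo := ae_restrict_mem measurableSet_Ioo

lemma half_mem_unitIoo : (1 / 2 : ℝ) ∈ unitIoo := by constructor <;> norm_num

/-- `T` is a `C¹` diffeomorphism of the open unit square with inverse `S`, and it preserves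
the uniform law. -/
structure IsSquareDiffeo (T S : ℝ × ℝ → ℝ × ℝ) : Prop where
  contDiffOn : ContDiffOn ℝ 1 T unitSq
  contDiffOn_inv : ContDiffOn ℝ 1 S unitSq
  mapsTo : MapsTo T unitSq unitSq
  mapsTo_inv : MapsTo S unitSq unitSq
  leftInv : ∀ v ∈ unitSq, S (T v) = v
  rightInv : ∀ v ∈ unitSq, T (S v) = v
  measurable : Measurable T
  measurable_inv : Measurable S
  map_eq : (unif.prod unif).map T = unif.prod unif

namespace IsSquareDiffeo

variable {T S : ℝ × ℝ → ℝ × ℝ}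

lemma ae_mem : ∀ᵐ v ∂(unif.prod unif), v ∈ unitSq := by
  rw [prod_unif_eq]; exact ae_restrict_mem isOpen_unitSq.measurableSet

lemma measurePreserving (d : IsSquareDiffeo T S) :
    MeasurePreserving T (unif.prod unif) (unif.prod unif) := ⟨d.measurable, d.map_eq⟩

lemma symm (d : IsSquareDiffeo T S) : IsSquareDiffeo S T where
  contDiffOn := d.contDiffOn_inv
  contDiffOn_inv := d.contDiffOn
  mapsTo := d.mapsTo_inv
  mapsTo_inv := d.mapsTo
  leftInv := d.rightInv
  rightInv := d.leftInv
  measurable := d.measurable_inv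
  measurable_inv := d.measurable
  map_eq := by
    conv_lhs => rw [← d.map_eq]
    rw [Measure.map_map d.measurable_inv d.measurable]
    conv_rhs => rw [← Measure.map_id (μ := unif.prod unif)]
    exact Measure.map_congr (by filter_upwards [ae_mem] with v hv using d.leftInv v hv)

/-- Exchanging the two coordinates in the target. -/
lemma swap_left (d : IsSquareDiffeo T S) :
    IsSquareDiffeo (fun v => (T v).swap) (fun v => S v.swap) where
  contDiffOn := (contDiff_snd.prodMk contDiff_fst).comp_contDiffOn d.contDiffOn
  contDiffOn_inv := d.contDiffOn_inv.comp
    (contDiff_snd.prodMk contDiff_fst : ContDiff ℝ 1 (Prod.swap : ℝ × ℝ → ℝ × ℝ)).contDiffOn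
    fun _ hv => ⟨hv.2, hv.1⟩
  mapsTo := fun _ hv => ⟨(d.mapsTo hv).2, (d.mapsTo hv).1⟩
  mapsTo_inv := fun v hv => d.mapsTo_inv (x := v.swap) ⟨hv.2, hv.1⟩
  leftInv := fun v hv => by simpa using d.leftInv v hv
  rightInv := fun v hv => by
    rw [d.rightInv v.swap ⟨hv.2, hv.1⟩, Prod.swap_swap]
  measurable := measurable_swap.comp d.measurable
  measurable_inv := d.measurable_inv.comp measurable_swap
  map_eq := by
    have := Measure.prod_swap (μ := unif) (ν := unif)
    conv_rhs => rw [← this, ← d.map_eq]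
    rw [Measure.map_map measurable_swap d.measurable]
    rfl

/-- Exchanging the two coordinates in the source. -/
lemma swap_right (d : IsSquareDiffeo T S) :
    IsSquareDiffeo (fun v => T v.swap) (fun v => (S v).swap) := d.symm.swap_left.symm

lemma differentiableAt (d : IsSquareDiffeo T S) {v : ℝ × ℝ} (hv : v ∈ unitSq) :
    DifferentiableAt ℝ T v :=
  (d.contDiffOn.contDiffAt (isOpen_unitSq.mem_nhds hv)).differentiableAt one_ne_zero

lemma contDiffOn_fst (d : IsSquareDiffeo T S) : ContDiffOn ℝ 1 (fun v => (T v).1) unitSq :=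
  contDiff_fst.comp_contDiffOn d.contDiffOn

lemma contDiffOn_snd (d : IsSquareDiffeo T S) : ContDiffOn ℝ 1 (fun v => (T v).2) unitSq :=
  contDiff_snd.comp_contDiffOn d.contDiffOn

lemma fderiv_ne_zero (d : IsSquareDiffeo T S) {v : ℝ × ℝ} (hv : v ∈ unitSq) {e : ℝ × ℝ}
    (he : e ≠ 0) : fderiv ℝ T v e ≠ 0 := by
  intro h0
  have h1 : fderiv ℝ (S ∘ T) v = ContinuousLinearMap.id ℝ _ := by
    rw [← fderiv_id (𝕜 := ℝ) (x := v)]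
    apply Filter.EventuallyEq.fderiv_eq
    filter_upwards [isOpen_unitSq.mem_nhds hv] with w hw using d.leftInv w hw
  rw [fderiv_comp v (d.symm.differentiableAt (d.mapsTo hv)) (d.differentiableAt hv)] at h1
  have h2 := congrArg (fun L => L e) h1
  simp only [ContinuousLinearMap.comp_apply, h0, map_zero, ContinuousLinearMap.id_apply] at h2
  exact he h2.symm

lemma fderiv_fst_eq (d : IsSquareDiffeo T S) {v : ℝ × ℝ} (hv : v ∈ unitSq) (e : ℝ × ℝ) :
    fderiv ℝ (fun w => (T w).1) v e = (fderiv ℝ T v e).1 := by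
  rw [fderiv.fst (d.differentiableAt hv)]; rfl

lemma fderiv_snd_eq (d : IsSquareDiffeo T S) {v : ℝ × ℝ} (hv : v ∈ unitSq) (e : ℝ × ℝ) :
    fderiv ℝ (fun w => (T w).2) v e = (fderiv ℝ T v e).2 := by
  rw [fderiv.snd (d.differentiableAt hv)]; rfl

end IsSquareDiffeo

section slices

variable {τ : ℝ × ℝ → ℝ}

lemma hasDerivAt_slice_snd (hτ : ContDiffOn ℝ 1 τ unitSq) {v w : ℝ} (hv : (v, w) ∈ unitSq) :
    HasDerivAt (fun w => τ (v, w)) (fderiv ℝ τ (v, w) (0, 1)) w := by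
  have h1 := ((hτ.contDiffAt (isOpen_unitSq.mem_nhds hv)).differentiableAt
    one_ne_zero).hasFDerivAt
  exact h1.comp_hasDerivAt w ((hasDerivAt_const w v).prodMk (hasDerivAt_id w))

lemma hasDerivAt_slice_fst (hτ : ContDiffOn ℝ 1 τ unitSq) {v w : ℝ} (hv : (v, w) ∈ unitSq) :
    HasDerivAt (fun v => τ (v, w)) (fderiv ℝ τ (v, w) (1, 0)) v := by
  have h1 := ((hτ.contDiffAt (isOpen_unitSq.mem_nhds hv)).differentiableAt
    one_ne_zero).hasFDerivAt
  exact h1.comp_hasDerivAt v ((hasDerivAt_id v).prodMk (hasDerivAt_const v w))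

lemma continuousOn_fderiv_apply (hτ : ContDiffOn ℝ 1 τ unitSq) (e : ℝ × ℝ) :
    ContinuousOn (fun v => fderiv ℝ τ v e) unitSq :=
  (hτ.continuousOn_fderiv_of_isOpen isOpen_unitSq le_rfl).clm_apply continuousOn_const

lemma injOn_of_deriv_ne_zero {f f' : ℝ → ℝ} {s : Set ℝ} (hs : s.OrdConnected)
    (hf : ∀ x ∈ s, HasDerivAt f (f' x) x) (hf' : ∀ x ∈ s, f' x ≠ 0) : InjOn f s := by
  have key : ∀ a ∈ s, ∀ b ∈ s, a < b → f a ≠ f b := by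
    intro a ha b hb hab he
    have hsub := hs.out ha hb
    obtain ⟨c, hc, hc0⟩ := exists_hasDerivAt_eq_zero hab
      (fun x hx => (hf x (hsub hx)).continuousAt.continuousWithinAt) he
      (fun x hx => hf x (hsub (Ioo_subset_Icc_self hx)))
    exact hf' c (hsub (Ioo_subset_Icc_self hc)) hc0
  intro a ha b hb he
  rcases lt_trichotomy a b with h | h | h
  · exact absurd he (key a ha b hb h)
  · exact h
  · exact absurd he.symm (key b hb a ha h)

/-- If `X v + Z w = Ψ (τ (v, w))` almost everywhere and `τ` depends on `w` near `(c, w₀)`, then `X`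
is almost everywhere equal to a continuous function near `c`. -/
lemma exists_local_continuous_version (hτ : ContDiffOn ℝ 1 τ unitSq)
    (hmaps : MapsTo τ unitSq unitIoo) {c w₀ : ℝ} (hc : (c, w₀) ∈ unitSq)
    (hne : fderiv ℝ τ (c, w₀) (0, 1) ≠ 0) {X Z Ψ : ℝ → ℝ}
    (hZ : Measurable Z) (hΨ : Measurable Ψ)
    (heq : ∀ᵐ p ∂(unif.prod unif), X p.1 + Z p.2 = Ψ (τ p)) :
    ∃ V, IsOpen V ∧ c ∈ V ∧ ∃ X' : ℝ → ℝ, ContinuousOn X' V ∧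
      ∀ᵐ v ∂(volume.restrict V), X v = X' v := by
  set a := |fderiv ℝ τ (c, w₀) (0, 1)| with ha
  have ha0 : 0 < a := abs_pos.2 hne
  have h1 : ∀ᶠ p in 𝓝 (c, w₀), p ∈ unitSq ∧ a / 2 ≤ |fderiv ℝ τ p (0, 1)| := by
    have h2 : ContinuousAt (fun p => |fderiv ℝ τ p (0, 1)|) (c, w₀) :=
      ((continuousOn_fderiv_apply hτ (0, 1)).continuousAt (isOpen_unitSq.mem_nhds hc)).abs
    filter_upwards [isOpen_unitSq.mem_nhds hc, h2.eventually (lt_mem_nhds (half_lt_self ha0))]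
      with p h3 h4 using ⟨h3, h4.le⟩
  obtain ⟨r, hr, hball⟩ := Metric.eventually_nhds_iff_ball.1 h1
  have hbox : ∀ v ∈ Metric.ball c r, ∀ w ∈ Metric.ball w₀ r,
      (v, w) ∈ unitSq ∧ a / 2 ≤ |fderiv ℝ τ (v, w) (0, 1)| := by
    intro v hv w hw
    apply hball
    rw [← ball_prod_same]
    exact ⟨hv, hw⟩
  refine ⟨Metric.ball c r, Metric.isOpen_ball, Metric.mem_ball_self hr, ?_⟩
  refine exists_continuousOn_of_add_eq_comp (K := Metric.ball w₀ r) (J := unitIoo) (c := a / 2)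
    (τ := fun v w => τ (v, w)) (τ' := fun v w => fderiv ℝ τ (v, w) (0, 1)) (Z := Z) (Ψ := Ψ)
    measurableSet_ball measurableSet_ball (Metric.measure_ball_pos _ _ hr).ne'
    measure_ball_lt_top.ne measurableSet_Ioo (by simp [unitIoo]) (by positivity)
    (fun v hv w hw => hasDerivAt_slice_snd hτ (hbox v hv w hw).1) ?_
    (fun v hv w hw => (hbox v hv w hw).2) ?_ (fun v hv w hw => hmaps (hbox v hv w hw).1) hZ hΨ ?_
  · intro w hw v hv
    exact (hasDerivAt_slice_fst hτ (hbox v hv w hw).1).continuousAt.continuousWithinAt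
  · intro v hv
    refine injOn_of_deriv_ne_zero (f' := fun w => fderiv ℝ τ (v, w) (0, 1)) ?_
      (fun w hw => hasDerivAt_slice_snd hτ (hbox v hv w hw).1) ?_
    · rw [Real.ball_eq_Ioo]; exact ordConnected_Ioo
    · intro w hw h0
      have := (hbox v hv w hw).2
      rw [h0, abs_zero] at this
      linarith
  · have hsub1 : Metric.ball c r ⊆ unitIoo := fun v hv =>
      (hbox v hv w₀ (Metric.mem_ball_self hr)).1.1
    have hsub2 : Metric.ball w₀ r ⊆ unitIoo := fun w hw =>
      (hbox c (Metric.mem_ball_self hr) w hw).1.2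
    have h3 := Measure.ae_ae_of_ae_prod heq
    have h4 := ae_restrict_of_ae_restrict_of_subset hsub1 h3
    filter_upwards [h4] with v hv
    exact ae_restrict_of_ae_restrict_of_subset hsub2 hv

end slices

namespace IsSquareDiffeo

variable {T S : ℝ × ℝ → ℝ × ℝ}

/-- In the pair of equations `α X + β Y = Ψ₁ ∘ T₁`, `γ X + δ Y = Ψ₂ ∘ T₂`, the function `X` has a
continuous version: near each point at least one of `T₁`, `T₂` depends on the second coordinate. -/
lemma exists_continuous_version_fst (d : IsSquareDiffeo T S) {X Y Ψ₁ Ψ₂ : ℝ → ℝ}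
    (hY : Measurable Y) (hΨ₁ : Measurable Ψ₁) (hΨ₂ : Measurable Ψ₂)
    {α β γ δ : ℝ} (hα : α ≠ 0) (hγ : γ ≠ 0)
    (h₁ : ∀ᵐ v ∂(unif.prod unif), α * X v.1 + β * Y v.2 = Ψ₁ (T v).1)
    (h₂ : ∀ᵐ v ∂(unif.prod unif), γ * X v.1 + δ * Y v.2 = Ψ₂ (T v).2) :
    ∃ X', ContinuousOn X' unitIoo ∧ X =ᵐ[unif] X' := by
  apply exists_continuousOn_of_locally isOpen_unitIoo
  intro c hc
  have hp : (c, (1 / 2 : ℝ)) ∈ unitSq := ⟨hc, half_mem_unitIoo⟩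
  by_cases h0 : fderiv ℝ (fun w => (T w).1) (c, 1 / 2) (0, 1) = 0
  · have h0' : fderiv ℝ (fun w => (T w).2) (c, 1 / 2) (0, 1) ≠ 0 := by
      intro h0'
      rw [d.fderiv_fst_eq hp] at h0
      rw [d.fderiv_snd_eq hp] at h0'
      exact d.fderiv_ne_zero hp (e := (0, 1)) (by simp) (Prod.ext h0 h0')
    obtain ⟨V, hV, hcV, X', hX', he⟩ := exists_local_continuous_version
      (X := fun v => γ * X v) (Z := fun w => δ * Y w) d.contDiffOn_snd
      (fun v hv => (d.mapsTo hv).2) hp h0' (by fun_prop) hΨ₂ h₂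
    refine ⟨V, hV, hcV, fun v => γ⁻¹ * X' v, continuousOn_const.mul hX', ?_⟩
    filter_upwards [he] with v hv
    rw [← hv]; field_simp
  · obtain ⟨V, hV, hcV, X', hX', he⟩ := exists_local_continuous_version
      (X := fun v => α * X v) (Z := fun w => β * Y w) d.contDiffOn_fst
      (fun v hv => (d.mapsTo hv).1) hp h0 (by fun_prop) hΨ₁ h₁
    refine ⟨V, hV, hcV, fun v => α⁻¹ * X' v, continuousOn_const.mul hX', ?_⟩
    filter_upwards [he] with v hv
    rw [← hv]; field_simp

lemma ae_swap {p : ℝ × ℝ → Prop} (h : ∀ᵐ v ∂(unif.prod unif), p v) :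
    ∀ᵐ v ∂(unif.prod unif), p v.swap :=
  (Measure.measurePreserving_swap (μ := unif) (ν := unif)).quasiMeasurePreserving.ae h

/-- If `α X v₁ + β Y v₂ = Ψ (T v)₁` almost everywhere, with `X` and `Y` continuous, then `Ψ` has a
continuous version, and the equation holds everywhere with it. -/
lemma exists_continuous_comp_fst (d : IsSquareDiffeo T S) {X Y Ψ : ℝ → ℝ}
    (hX : ContinuousOn X unitIoo) (hY : ContinuousOn Y unitIoo) {α β : ℝ}
    (h : ∀ᵐ v ∂(unif.prod unif), α * X v.1 + β * Y v.2 = Ψ (T v).1) :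
    ∃ Ψ', ContinuousOn Ψ' unitIoo ∧ ∀ v ∈ unitSq, α * X v.1 + β * Y v.2 = Ψ' (T v).1 := by
  set G : ℝ × ℝ → ℝ := fun v => α * X v.1 + β * Y v.2 with hG
  have hGc : ContinuousOn G unitSq :=
    (continuousOn_const.mul (hX.comp continuousOn_fst fun v hv => hv.1)).add
      (continuousOn_const.mul (hY.comp continuousOn_snd fun v hv => hv.2))
  have hGS : ContinuousOn (fun v => G (S v)) unitSq :=
    hGc.comp d.contDiffOn_inv.continuousOn d.mapsTo_inv
  have h1 : ∀ᵐ v ∂(unif.prod unif), G (S v) = Ψ v.1 := by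
    filter_upwards [d.symm.measurePreserving.quasiMeasurePreserving.ae h, ae_mem] with v hv hm
    rw [d.rightInv v hm] at hv
    exact hv
  have h2 : ∀ᵐ z ∂unif, ∀ᵐ y ∂unif, G (S (y, z)) = Ψ y := by
    exact Measure.ae_ae_of_ae_prod (ae_swap h1)
  obtain ⟨z, hz, hzI⟩ := (h2.and ae_unif_mem).exists
  have hslice : ContinuousOn (fun y => G (S (y, z))) unitIoo :=
    hGS.comp (continuousOn_id.prodMk continuousOn_const) fun y hy => ⟨hy, hzI⟩
  refine ⟨fun y => G (S (y, z)), hslice, ?_⟩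
  have h3 : (fun v => G (S v)) =ᵐ[volume.restrict unitSq] fun v : ℝ × ℝ => G (S (v.1, z)) := by
    rw [← prod_unif_eq]
    have h4 := Measure.quasiMeasurePreserving_fst (μ := unif) (ν := unif) |>.ae hz
    filter_upwards [h1, h4] with v h5 h6
    rw [h5, h6]
  have h4 := Measure.eqOn_open_of_ae_eq h3 isOpen_unitSq hGS
    (hslice.comp continuousOn_fst fun v hv => hv.1)
  intro v hv
  have := h4 (d.mapsTo hv)
  simp only [d.leftInv v hv] at this
  exact this

/-- All four functions in the pair of equations `α X + β Y = Ψ₁ ∘ T₁`, `γ X + δ Y = Ψ₂ ∘ T₂` have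
continuous versions, for which the equations hold everywhere. -/
theorem exists_continuous_versions (d : IsSquareDiffeo T S) {X Y Ψ₁ Ψ₂ : ℝ → ℝ}
    (hX : Measurable X) (hY : Measurable Y) (hΨ₁ : Measurable Ψ₁) (hΨ₂ : Measurable Ψ₂)
    {α β γ δ : ℝ} (hα : α ≠ 0) (hβ : β ≠ 0) (hγ : γ ≠ 0) (hδ : δ ≠ 0)
    (h₁ : ∀ᵐ v ∂(unif.prod unif), α * X v.1 + β * Y v.2 = Ψ₁ (T v).1)
    (h₂ : ∀ᵐ v ∂(unif.prod unif), γ * X v.1 + δ * Y v.2 = Ψ₂ (T v).2) :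
    ∃ X' Y' Ψ₁' Ψ₂' : ℝ → ℝ, ContinuousOn X' unitIoo ∧ ContinuousOn Y' unitIoo ∧
      ContinuousOn Ψ₁' unitIoo ∧ ContinuousOn Ψ₂' unitIoo ∧ X =ᵐ[unif] X' ∧ Y =ᵐ[unif] Y' ∧
      ∀ v ∈ unitSq, α * X' v.1 + β * Y' v.2 = Ψ₁' (T v).1 ∧
        γ * X' v.1 + δ * Y' v.2 = Ψ₂' (T v).2 := by
  obtain ⟨X', hX', hXe⟩ := d.exists_continuous_version_fst hY hΨ₁ hΨ₂ hα hγ h₁ h₂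
  obtain ⟨Y', hY', hYe⟩ := d.swap_right.exists_continuous_version_fst hX hΨ₁ hΨ₂ hβ hδ
    (X := Y) (Y := X) (β := α) (δ := γ)
    (by filter_upwards [ae_swap h₁] with v hv; rw [← hv]; simp [add_comm])
    (by filter_upwards [ae_swap h₂] with v hv; rw [← hv]; simp [add_comm])
  have e1 := Measure.quasiMeasurePreserving_fst (μ := unif) (ν := unif) |>.ae hXe
  have e2 := Measure.quasiMeasurePreserving_snd (μ := unif) (ν := unif) |>.ae hYe
  obtain ⟨Ψ₁', hc1, hp1⟩ := d.exists_continuous_comp_fst hX' hY' (α := α) (β := β) (Ψ := Ψ₁)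
    (by filter_upwards [h₁, e1, e2] with v h a b; rw [← a, ← b, h])
  obtain ⟨Ψ₂', hc2, hp2⟩ := d.swap_left.exists_continuous_comp_fst hX' hY' (α := γ) (β := δ)
    (Ψ := Ψ₂) (by filter_upwards [h₂, e1, e2] with v h a b; rw [← a, ← b, h]; rfl)
  exact ⟨X', Y', Ψ₁', Ψ₂', hX', hY', hc1, hc2, hXe, hYe, fun v hv => ⟨hp1 v hv, hp2 v hv⟩⟩

end IsSquareDiffeo

/-! ### Gaussian quantiles -/

/-- The distribution function of the standard Gaussian law. -/
noncomputable def gaussCdf (x : ℝ) : ℝ := (gaussianReal 0 1).real (Iic x)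

/-- The density of the standard Gaussian law. -/
noncomputable abbrev gaussDensity : ℝ → ℝ := gaussianPDFReal 0 1

lemma gaussDensity_pos (x : ℝ) : 0 < gaussDensity x := gaussianPDFReal_pos 0 1 x one_ne_zero

lemma continuous_gaussDensity : Continuous gaussDensity := by
  unfold gaussDensity gaussianPDFReal
  fun_prop

lemma gaussCdf_eq_integral (x : ℝ) : gaussCdf x = ∫ y in Iic x, gaussDensity y := by
  rw [gaussCdf, Measure.real, gaussianReal_apply_eq_integral 0 one_ne_zero,
    ENNReal.toReal_ofReal]
  exact setIntegral_nonneg measurableSet_Iic fun y _ => gaussianPDFReal_nonneg _ _ _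

lemma hasDerivAt_gaussCdf (x : ℝ) : HasDerivAt gaussCdf (gaussDensity x) x := by
  have hi : ∀ y, IntegrableOn gaussDensity (Iic y) := fun y =>
    (integrable_gaussianPDFReal 0 1).integrableOn
  have h1 : gaussCdf = fun y => gaussCdf 0 + ∫ t in (0 : ℝ)..y, gaussDensity t := by
    ext y
    rw [gaussCdf_eq_integral, gaussCdf_eq_integral,
      ← intervalIntegral.integral_Iic_sub_Iic (hi 0) (hi y)]
    ring
  rw [h1]
  exact (intervalIntegral.integral_hasDerivAt_right
    (continuous_gaussDensity.intervalIntegrable _ _)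
    (continuous_gaussDensity.stronglyMeasurableAtFilter _ _)
    continuous_gaussDensity.continuousAt).const_add _

lemma continuous_gaussCdf : Continuous gaussCdf :=
  continuous_iff_continuousAt.2 fun x => (hasDerivAt_gaussCdf x).continuousAt

lemma strictMono_gaussCdf : StrictMono gaussCdf :=
  strictMono_of_deriv_pos fun x => by
    rw [(hasDerivAt_gaussCdf x).deriv]; exact gaussDensity_pos x

lemma gaussCdf_eq_cdf : gaussCdf = cdf (gaussianReal 0 1) := by
  ext x; rw [cdf_eq_real]; rfl

lemma gaussCdf_mem (x : ℝ) : gaussCdf x ∈ unitIoo := by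
  constructor
  · refine lt_of_le_of_lt ?_ (strictMono_gaussCdf (sub_one_lt x))
    rw [gaussCdf_eq_cdf]; exact cdf_nonneg _ _
  · refine lt_of_lt_of_le (strictMono_gaussCdf (lt_add_one x)) ?_
    rw [gaussCdf_eq_cdf]; exact cdf_le_one _ _

lemma exists_gaussCdf_eq {u : ℝ} (hu : u ∈ unitIoo) : ∃ x, gaussCdf x = u := by
  have h1 := (tendsto_cdf_atTop (gaussianReal 0 1)).eventually (lt_mem_nhds hu.2)
  have h2 := (tendsto_cdf_atBot (gaussianReal 0 1)).eventually (gt_mem_nhds hu.1)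
  rw [← gaussCdf_eq_cdf] at h1 h2
  obtain ⟨b, hb⟩ := h1.exists
  obtain ⟨a, ha⟩ := h2.exists
  exact mem_range_of_exists_le_of_exists_ge continuous_gaussCdf ⟨a, ha.le⟩ ⟨b, hb.le⟩

open Classical in
/-- The quantile function of the standard Gaussian law: the inverse of `gaussCdf` on `(0,1)`, and
`0` elsewhere. -/
noncomputable def gaussQuantile (u : ℝ) : ℝ :=
  if h : u ∈ unitIoo then (exists_gaussCdf_eq h).choose else 0

lemma gaussCdf_gaussQuantile {u : ℝ} (hu : u ∈ unitIoo) : gaussCdf (gaussQuantile u) = u := by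
  rw [gaussQuantile, dif_pos hu]; exact (exists_gaussCdf_eq hu).choose_spec

lemma gaussQuantile_gaussCdf (x : ℝ) : gaussQuantile (gaussCdf x) = x :=
  strictMono_gaussCdf.injective (gaussCdf_gaussQuantile (gaussCdf_mem x))

lemma continuousOn_gaussQuantile : ContinuousOn gaussQuantile unitIoo := by
  have hemb : IsEmbedding gaussCdf := strictMono_gaussCdf.isEmbedding_of_ordConnected
    (isPreconnected_range continuous_gaussCdf).ordConnected
  rw [hemb.isInducing.continuousOn_iff]
  exact continuousOn_id.congr fun u hu => gaussCdf_gaussQuantile hu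

lemma measurable_gaussQuantile : Measurable gaussQuantile := by
  classical
  have : gaussQuantile = unitIoo.piecewise gaussQuantile (fun _ => 0) := by
    ext u
    by_cases h : u ∈ unitIoo
    · rw [piecewise_eq_of_mem _ _ _ h]
    · rw [piecewise_eq_of_notMem _ _ _ h, gaussQuantile, dif_neg h]
  rw [this]
  exact continuousOn_gaussQuantile.measurable_piecewise continuousOn_const measurableSet_Ioo

lemma gaussQuantile_le_iff {u x : ℝ} (hu : u ∈ unitIoo) : gaussQuantile u ≤ x ↔ u ≤ gaussCdf x := by
  rw [← strictMono_gaussCdf.le_iff_le, gaussCdf_gaussQuantile hu]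

lemma unif_Iic {u : ℝ} (hu : u ∈ unitIoo) : unif (Iic u) = ENNReal.ofReal u := by
  have : Iic u ∩ unitIoo = Ioc 0 u := by
    ext v
    simp only [mem_inter_iff, mem_Iic, unitIoo, mem_Ioo, mem_Ioc]
    exact ⟨fun h => ⟨h.2.1, h.1⟩, fun h => ⟨h.2, h.1, lt_of_le_of_lt h.2 hu.2⟩⟩
  rw [unif, Measure.restrict_apply measurableSet_Iic, this, Real.volume_Ioc, sub_zero]

lemma unif_Ici {u : ℝ} (hu : u ∈ unitIoo) : unif (Ici u) = ENNReal.ofReal (1 - u) := by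
  have : Ici u ∩ unitIoo = Ico u 1 := by
    ext v
    simp only [mem_inter_iff, mem_Ici, unitIoo, mem_Ioo, mem_Ico]
    exact ⟨fun h => ⟨h.1, h.2.2⟩, fun h => ⟨h.1, lt_of_lt_of_le hu.1 h.1, h.2⟩⟩
  rw [unif, Measure.restrict_apply measurableSet_Ici, this, Real.volume_Ico]

lemma map_gaussQuantile : unif.map gaussQuantile = gaussianReal 0 1 := by
  have : IsProbabilityMeasure (unif.map gaussQuantile) :=
    Measure.isProbabilityMeasure_map measurable_gaussQuantile.aemeasurable
  apply Measure.ext_of_Iic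
  intro x
  rw [Measure.map_apply measurable_gaussQuantile measurableSet_Iic]
  have h1 : unif (gaussQuantile ⁻¹' Iic x) = unif (Iic (gaussCdf x)) := by
    apply measure_congr
    filter_upwards [ae_unif_mem] with v hv
    exact propext (gaussQuantile_le_iff hv)
  rw [h1, unif_Iic (gaussCdf_mem x), gaussCdf, ofReal_measureReal]

lemma map_gaussCdf : (gaussianReal 0 1).map gaussCdf = unif := by
  rw [← map_gaussQuantile, Measure.map_map continuous_gaussCdf.measurable measurable_gaussQuantile]
  conv_rhs => rw [← Measure.map_id (μ := unif)]
  refine Measure.map_congr ?_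
  filter_upwards [ae_unif_mem] with v hv
  exact gaussCdf_gaussQuantile hv

lemma gaussCdf_neg (x : ℝ) : gaussCdf (-x) = 1 - gaussCdf x := by
  have h1 : (gaussianReal 0 1).real (Iic (-x)) = (gaussianReal 0 1).real (Ici x) := by
    have h := gaussianReal_map_neg (μ := 0) (v := 1)
    rw [neg_zero] at h
    conv_lhs => rw [← h]
    rw [map_measureReal_apply measurable_neg measurableSet_Iic]
    congr 1
    ext y; simp
  have h2 : (gaussianReal 0 1).real (Ici x) = (gaussianReal 0 1).real (Ioi x) := by
    have := nullSingletonClass_gaussianReal (μ := 0) (v := 1) one_ne_zero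
    exact measureReal_congr Ioi_ae_eq_Ici.symm
  rw [gaussCdf, gaussCdf, h1, h2, ← compl_Iic, probReal_compl_eq_one_sub measurableSet_Iic]

lemma gaussCdf_zero : gaussCdf 0 = 1 / 2 := by
  have := gaussCdf_neg 0
  rw [neg_zero] at this
  linarith

/-! ### Injectivity of the additive coordinates -/

/-- A continuous function on an interval all of whose points are local maxima is constant. -/
lemma eq_of_forall_isLocalMax {f : ℝ → ℝ} {s : Set ℝ} (hs : IsPreconnected s)
    (hf : ∀ x ∈ s, ContinuousAt f x) (hmax : ∀ x ∈ s, IsLocalMax f x) {x y : ℝ} (hx : x ∈ s)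
    (hy : y ∈ s) : f x = f y := by
  have key : ∀ x ∈ s, ∀ y ∈ s, f y ≤ f x := by
    intro x hx y hy
    have hsub : s ⊆ interior {t | f t ≤ f x} := by
      refine hs.subset_left_of_subset_union isOpen_interior
        (v := interior {t | f x < f t}) isOpen_interior ?_ ?_ ?_
      · refine Disjoint.mono interior_subset interior_subset ?_
        rw [Set.disjoint_left]
        intro t h1 h2
        exact absurd (show f x < f t from h2) (not_lt.2 (show f t ≤ f x from h1))
      · intro t ht
        rcases le_or_gt (f t) (f x) with h | h
        · left
          rw [mem_interior_iff_mem_nhds]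
          filter_upwards [hmax t ht] with r hr using hr.trans h
        · right
          rw [mem_interior_iff_mem_nhds]
          exact (hf t ht).eventually (lt_mem_nhds h)
      · refine ⟨x, hx, ?_⟩
        rw [mem_interior_iff_mem_nhds]
        exact hmax x hx
    exact (interior_subset (hsub hy) : y ∈ {t | f t ≤ f x})
  exact le_antisymm (key y hy x hx) (key x hx y hy)

lemma eq_of_forall_isLocalMin {f : ℝ → ℝ} {s : Set ℝ} (hs : IsPreconnected s)
    (hf : ∀ x ∈ s, ContinuousAt f x) (hmin : ∀ x ∈ s, IsLocalMin f x) {x y : ℝ} (hx : x ∈ s)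
    (hy : y ∈ s) : f x = f y := by
  have := eq_of_forall_isLocalMax (f := fun t => -f t) hs (fun x hx => (hf x hx).neg)
    (fun x hx => (hmin x hx).neg) hx hy
  linarith

namespace IsSquareDiffeo

variable {T S : ℝ × ℝ → ℝ × ℝ}

/-- If `α X v₁ + β Y v₂ = Ψ (T v)₁` and `T₁` depends on both coordinates at a point `(c, w₀)`, then
`X` has no local extremum at `c`, unless it is locally constant: such an extremum would be passed on
to `Ψ` at all points of an interval. -/
lemma eventually_eq_of_isLocalMax (d : IsSquareDiffeo T S) {X Y Ψ : ℝ → ℝ}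
    (hΨ : ContinuousOn Ψ unitIoo) {α β : ℝ} (hα : α ≠ 0)
    (h : ∀ v ∈ unitSq, α * X v.1 + β * Y v.2 = Ψ (T v).1)
    {c w₀ : ℝ} (hc : (c, w₀) ∈ unitSq)
    (h1 : fderiv ℝ (fun v => (T v).1) (c, w₀) (1, 0) ≠ 0)
    (h2 : fderiv ℝ (fun v => (T v).1) (c, w₀) (0, 1) ≠ 0) (hmax : IsLocalMax X c) :
    ∀ᶠ v in 𝓝 c, X v = X c := by
  have hτ := d.contDiffOn_fst
  set τ : ℝ × ℝ → ℝ := fun v => (T v).1 with hτdef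
  have hmapsI : ∀ p ∈ unitSq, τ p ∈ unitIoo := fun p hp => (d.mapsTo hp).1
  obtain ⟨r, hr, hball⟩ : ∃ r > 0, ∀ w ∈ Metric.ball w₀ r, (c, w) ∈ unitSq ∧
      fderiv ℝ τ (c, w) (1, 0) ≠ 0 := by
    have h3 : ContinuousAt (fun w => fderiv ℝ τ (c, w) (1, 0)) w₀ :=
      ContinuousAt.comp (f := fun w => (c, w)) (g := fun p => fderiv ℝ τ p (1, 0))
        ((continuousOn_fderiv_apply hτ (1, 0)).continuousAt (isOpen_unitSq.mem_nhds hc))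
        (by fun_prop)
    have h4 : ∀ᶠ w in 𝓝 w₀, (c, w) ∈ unitSq := by
      filter_upwards [isOpen_unitIoo.mem_nhds hc.2] with w hw using ⟨hc.1, hw⟩
    exact Metric.eventually_nhds_iff_ball.1 (h4.and (h3.eventually_ne h1))
  have hstrict_fst : ∀ w ∈ Metric.ball w₀ r,
      HasStrictDerivAt (fun v => τ (v, w)) (fderiv ℝ τ (c, w) (1, 0)) c := by
    intro w hw
    have h5 := (hτ.contDiffAt (isOpen_unitSq.mem_nhds (hball w hw).1)).hasStrictFDerivAt
      one_ne_zero
    exact HasStrictFDerivAt.comp_hasStrictDerivAt (l := τ) (f := fun v => (v, w)) c h5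
      ((hasStrictDerivAt_id c).prodMk (hasStrictDerivAt_const c w))
  have hstrict_snd :
      HasStrictDerivAt (fun w => τ (c, w)) (fderiv ℝ τ (c, w₀) (0, 1)) w₀ := by
    have h5 := (hτ.contDiffAt (isOpen_unitSq.mem_nhds hc)).hasStrictFDerivAt one_ne_zero
    exact HasStrictFDerivAt.comp_hasStrictDerivAt (l := τ) (f := fun w => (c, w)) w₀ h5
      ((hasStrictDerivAt_const w₀ c).prodMk
      (hasStrictDerivAt_id w₀))
  set s := (fun w => τ (c, w)) '' Metric.ball w₀ r with hs
  have hscon : IsPreconnected s := by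
    apply ((convex_ball w₀ r).isPreconnected).image
    intro w hw
    exact (hasDerivAt_slice_snd hτ (hball w hw).1).continuousAt.continuousWithinAt
  have hsI : ∀ t ∈ s, ContinuousAt Ψ t := by
    rintro _ ⟨w, hw, rfl⟩
    exact hΨ.continuousAt (isOpen_unitIoo.mem_nhds (hmapsI _ (hball w hw).1))
  have hsnhds : s ∈ 𝓝 (τ (c, w₀)) := by
    rw [← hstrict_snd.map_nhds_eq h2]
    exact image_mem_map (Metric.ball_mem_nhds w₀ hr)
  have hmem : τ (c, w₀) ∈ s := mem_of_mem_nhds hsnhds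
  -- transfer of the extremum
  have htransfer : ∀ w ∈ Metric.ball w₀ r,
      (0 < α → IsLocalMax Ψ (τ (c, w))) ∧ (α < 0 → IsLocalMin Ψ (τ (c, w))) := by
    intro w hw
    have hnear : ∀ᶠ v in 𝓝 c, (v, w) ∈ unitSq ∧ X v ≤ X c := by
      filter_upwards [isOpen_unitIoo.mem_nhds hc.1, hmax] with v h6 h7
        using ⟨⟨h6, (hball w hw).1.2⟩, h7⟩
    have e0 := h _ (hball w hw).1
    constructor
    · intro hpos
      rw [IsLocalMax, IsMaxFilter, ← (hstrict_fst w hw).map_nhds_eq (hball w hw).2, eventually_map]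
      filter_upwards [hnear] with v hv
      have e1 := h _ hv.1
      simp only at e0 e1
      change Ψ (T (v, w)).1 ≤ Ψ (T (c, w)).1
      rw [← e0, ← e1]
      have := mul_le_mul_of_nonneg_left hv.2 hpos.le
      linarith
    · intro hneg
      rw [IsLocalMin, IsMinFilter, ← (hstrict_fst w hw).map_nhds_eq (hball w hw).2, eventually_map]
      filter_upwards [hnear] with v hv
      have e1 := h _ hv.1
      simp only at e0 e1
      change Ψ (T (c, w)).1 ≤ Ψ (T (v, w)).1
      rw [← e0, ← e1]
      have := mul_le_mul_of_nonpos_left hv.2 hneg.le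
      linarith
  have hconst : ∀ t ∈ s, Ψ t = Ψ (τ (c, w₀)) := by
    intro t ht
    rcases lt_or_gt_of_ne hα with hneg | hpos
    · refine eq_of_forall_isLocalMin hscon hsI ?_ ht hmem
      rintro _ ⟨w, hw, rfl⟩
      exact (htransfer w hw).2 hneg
    · refine eq_of_forall_isLocalMax hscon hsI ?_ ht hmem
      rintro _ ⟨w, hw, rfl⟩
      exact (htransfer w hw).1 hpos
  have hτc : ContinuousAt (fun v => τ (v, w₀)) c := (hasDerivAt_slice_fst hτ hc).continuousAt
  filter_upwards [hτc.preimage_mem_nhds hsnhds, isOpen_unitIoo.mem_nhds hc.1] with v hv hvI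
  have e1 := h (v, w₀) ⟨hvI, hc.2⟩
  have e0 := h (c, w₀) hc
  have e2 := hconst _ hv
  simp only [hτdef] at e0 e1 e2
  have : α * X v = α * X c := by linarith
  exact mul_left_cancel₀ hα this

/-- If `T₁` is constant in the second coordinate near `(c, w₀)`, then so is `Y` near `w₀`. -/
lemma eventually_eq_snd_of_fderiv_eq_zero (d : IsSquareDiffeo T S) {X Y Ψ : ℝ → ℝ} {α β : ℝ}
    (hβ : β ≠ 0) (h : ∀ v ∈ unitSq, α * X v.1 + β * Y v.2 = Ψ (T v).1)
    {c w₀ : ℝ} (hc : (c, w₀) ∈ unitSq)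
    (h0 : ∀ᶠ w in 𝓝 w₀, fderiv ℝ (fun v => (T v).1) (c, w) (0, 1) = 0) :
    ∀ᶠ w in 𝓝 w₀, Y w = Y w₀ := by
  have hin : ∀ᶠ w in 𝓝 w₀, (c, w) ∈ unitSq := by
    filter_upwards [isOpen_unitIoo.mem_nhds hc.2] with w hw using ⟨hc.1, hw⟩
  obtain ⟨r, hr, hball⟩ := Metric.eventually_nhds_iff_ball.1 (hin.and h0)
  filter_upwards [Metric.ball_mem_nhds w₀ hr] with w hw
  have hT : (T (c, w)).1 = (T (c, w₀)).1 := by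
    refine (convex_ball w₀ r).is_const_of_fderivWithin_eq_zero (𝕜 := ℝ)
      (f := fun w => (T (c, w)).1) ?_ ?_ hw (Metric.mem_ball_self hr)
    · intro y hy
      exact (hasDerivAt_slice_snd d.contDiffOn_fst
        (hball y hy).1).differentiableAt.differentiableWithinAt
    · intro y hy
      have := hasDerivAt_slice_snd d.contDiffOn_fst (hball y hy).1
      rw [(hball y hy).2] at this
      rw [this.hasFDerivAt.hasFDerivWithinAt.fderivWithin
        (Metric.isOpen_ball.uniqueDiffWithinAt hy)]
      ext; simp
  have e1 := h (c, w) (hball w hw).1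
  have e0 := h (c, w₀) hc
  simp only [hT] at e0 e1
  have : β * Y w = β * Y w₀ := by linarith
  exact mul_left_cancel₀ hβ this

/-- In the pair of equations `α X + β Y = Ψ₁ ∘ T₁`, `γ X + δ Y = Ψ₂ ∘ T₂`, with continuous functions
that are not constant on any interval, `X` is injective. -/
lemma injOn_fst (d : IsSquareDiffeo T S) {X Y Ψ₁ Ψ₂ : ℝ → ℝ}
    (hX : ContinuousOn X unitIoo)
    (hΨ₁ : ContinuousOn Ψ₁ unitIoo) (hΨ₂ : ContinuousOn Ψ₂ unitIoo)
    {α β γ δ : ℝ} (hα : α ≠ 0) (hβ : β ≠ 0) (hγ : γ ≠ 0) (hδ : δ ≠ 0)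
    (h₁ : ∀ v ∈ unitSq, α * X v.1 + β * Y v.2 = Ψ₁ (T v).1)
    (h₂ : ∀ v ∈ unitSq, γ * X v.1 + δ * Y v.2 = Ψ₂ (T v).2)
    (hXn : ∀ c ∈ unitIoo, ¬ ∀ᶠ v in 𝓝 c, X v = X c)
    (hYn : ∀ c ∈ unitIoo, ¬ ∀ᶠ v in 𝓝 c, Y v = Y c) : InjOn X unitIoo := by
  -- there is no local extremum
  have hmax : ∀ (X Y Ψ₁ Ψ₂ : ℝ → ℝ), ContinuousOn X unitIoo →
      ContinuousOn Ψ₁ unitIoo → ContinuousOn Ψ₂ unitIoo →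
      (∀ v ∈ unitSq, α * X v.1 + β * Y v.2 = Ψ₁ (T v).1) →
      (∀ v ∈ unitSq, γ * X v.1 + δ * Y v.2 = Ψ₂ (T v).2) →
      (∀ c ∈ unitIoo, ¬ ∀ᶠ v in 𝓝 c, X v = X c) →
      (∀ c ∈ unitIoo, ¬ ∀ᶠ v in 𝓝 c, Y v = Y c) → ∀ c ∈ unitIoo, ¬ IsLocalMax X c := by
    intro X Y Ψ₁ Ψ₂ hX hΨ₁ hΨ₂ h₁ h₂ hXn hYn c hc hm
    have hmem : ∀ w ∈ unitIoo, (c, w) ∈ unitSq := fun w hw => ⟨hc, hw⟩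
    have n1 : ∀ w ∈ unitIoo, fderiv ℝ (fun v => (T v).1) (c, w) (1, 0) = 0 ∨
        fderiv ℝ (fun v => (T v).1) (c, w) (0, 1) = 0 := by
      intro w hw
      by_contra hcon
      push Not at hcon
      exact hXn c hc (d.eventually_eq_of_isLocalMax hΨ₁ hα h₁ (hmem w hw) hcon.1 hcon.2 hm)
    have n2 : ∀ w ∈ unitIoo, fderiv ℝ (fun v => (T v).2) (c, w) (1, 0) = 0 ∨
        fderiv ℝ (fun v => (T v).2) (c, w) (0, 1) = 0 := by
      intro w hw
      by_contra hcon
      push Not at hcon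
      exact hXn c hc (d.swap_left.eventually_eq_of_isLocalMax hΨ₂ hγ h₂ (hmem w hw)
        hcon.1 hcon.2 hm)
    have n3 : ∀ w ∈ unitIoo, ∀ e : ℝ × ℝ, e ≠ 0 →
        fderiv ℝ (fun v => (T v).1) (c, w) e = 0 →
        fderiv ℝ (fun v => (T v).2) (c, w) e ≠ 0 := by
      intro w hw e he h0 h0'
      rw [d.fderiv_fst_eq (hmem w hw)] at h0
      rw [d.fderiv_snd_eq (hmem w hw)] at h0'
      exact d.fderiv_ne_zero (hmem w hw) he (Prod.ext h0 h0')
    have hcont : ∀ {τ : ℝ × ℝ → ℝ}, ContDiffOn ℝ 1 τ unitSq → ∀ w ∈ unitIoo, ∀ e : ℝ × ℝ,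
        ContinuousAt (fun w => fderiv ℝ τ (c, w) e) w := by
      intro τ hτ w hw e
      exact ContinuousAt.comp (f := fun w => (c, w)) (g := fun p => fderiv ℝ τ p e)
        ((continuousOn_fderiv_apply hτ e).continuousAt (isOpen_unitSq.mem_nhds (hmem w hw)))
        (by fun_prop)
    have hI := isOpen_unitIoo.mem_nhds half_mem_unitIoo
    -- on the slice `{c} × I`, near `1 / 2`, exactly one of `T₁`, `T₂` depends on the second coordinate,
    -- so the other equation makes `Y` locally constant
    by_cases h0 : fderiv ℝ (fun v => (T v).1) (c, 1 / 2) (0, 1) = 0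
    · have h0' := n3 _ half_mem_unitIoo (0, 1) (by simp) h0
      refine hYn _ half_mem_unitIoo (d.eventually_eq_snd_of_fderiv_eq_zero hβ h₁
        (hmem _ half_mem_unitIoo) ?_)
      filter_upwards [hI, (hcont d.contDiffOn_snd _ half_mem_unitIoo (0, 1)).eventually_ne h0']
        with w hw h3
      refine (n1 w hw).resolve_left fun h4 => ?_
      exact n3 w hw (1, 0) (by simp) h4 ((n2 w hw).resolve_right h3)
    · refine hYn _ half_mem_unitIoo (d.swap_left.eventually_eq_snd_of_fderiv_eq_zero hδ h₂
        (hmem _ half_mem_unitIoo) ?_)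
      filter_upwards [hI, (hcont d.contDiffOn_fst _ half_mem_unitIoo (0, 1)).eventually_ne h0]
        with w hw h3
      refine (n2 w hw).resolve_left fun h4 => ?_
      exact n3 w hw (1, 0) (by simp) ((n1 w hw).resolve_right h3) h4
  have key : ∀ a ∈ unitIoo, ∀ b ∈ unitIoo, a < b → X a ≠ X b := by
    intro a ha b hb hab he
    have hsub : Icc a b ⊆ unitIoo := fun x hx =>
      ⟨lt_of_lt_of_le ha.1 hx.1, lt_of_le_of_lt hx.2 hb.2⟩
    obtain ⟨c, hc, hext⟩ := exists_isLocalExtr_Ioo hab (hX.mono hsub) he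
    have hcI := hsub (Ioo_subset_Icc_self hc)
    rcases hext with hmin | hm
    · refine hmax (fun t => -X t) (fun t => -Y t) (fun t => -Ψ₁ t) (fun t => -Ψ₂ t) hX.neg hΨ₁.neg
        hΨ₂.neg (fun v hv => by rw [← h₁ v hv]; ring) (fun v hv => by rw [← h₂ v hv]; ring)
        (by simpa using hXn) (by simpa using hYn) c hcI hmin.neg
    · exact hmax X Y Ψ₁ Ψ₂ hX hΨ₁ hΨ₂ h₁ h₂ hXn hYn c hcI hm
  intro a ha b hb he
  rcases lt_trichotomy a b with h | h | h
  · exact absurd he (key a ha b hb h)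
  · exact h
  · exact absurd he.symm (key b hb a ha h)

end IsSquareDiffeo

/-! ### Gaussian coordinates -/

/-- A strictly increasing function of a uniform variable with standard Gaussian law is the
Gaussian quantile function. -/
lemma eq_gaussQuantile_of_strictMonoOn {Z : ℝ → ℝ} (hmono : StrictMonoOn Z unitIoo)
    (hlaw : HasLaw Z (gaussianReal 0 1) unif) {v : ℝ} (hv : v ∈ unitIoo) :
    Z v = gaussQuantile v := by
  apply strictMono_gaussCdf.injective
  rw [gaussCdf_gaussQuantile hv, gaussCdf]
  have h1 : (gaussianReal 0 1).real (Iic (Z v)) = unif.real {w | Z w ∈ Iic (Z v)} :=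
    (hlaw.measureReal_eq (p := fun x => x ∈ Iic (Z v)) measurableSet_Iic).symm
  have : unif {w | Z w ∈ Iic (Z v)} = unif (Iic v) := by
    apply measure_congr
    filter_upwards [ae_unif_mem] with w hw
    exact propext (hmono.le_iff_le hw hv)
  rw [h1, Measure.real, this, unif_Iic hv, ENNReal.toReal_ofReal hv.1.le]

/-- An injective continuous function of a uniform variable with Gaussian law is an affine function
of the Gaussian quantile. -/
lemma exists_eq_gaussQuantile {X : ℝ → ℝ} (hc : ContinuousOn X unitIoo) (hinj : InjOn X unitIoo)
    {m : ℝ} {s : NNReal} (hs : s ≠ 0) (hlaw : HasLaw X (gaussianReal m s) unif) :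
    ∃ σ, σ ≠ 0 ∧ ∀ v ∈ unitIoo, X v = m + σ * gaussQuantile v := by
  set r := Real.sqrt s with hr
  have hr0 : 0 < r := Real.sqrt_pos.2 (by exact_mod_cast pos_iff_ne_zero.2 hs)
  have hZ : HasLaw (fun v => (X v - m) / r) (gaussianReal 0 1) unif := by
    have h1 := gaussianReal_div_const (gaussianReal_sub_const hlaw m) r
    convert h1 using 1
    rw [sub_self, zero_div]
    congr 1
    ext
    have hs' : (s : ℝ) ≠ 0 := by exact_mod_cast hs
    simp [hr, hs']
  rcases hc.strictMonoOn_of_injOn_Ioo zero_lt_one hinj with h | h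
  · refine ⟨r, hr0.ne', fun v hv => ?_⟩
    have := eq_gaussQuantile_of_strictMonoOn (Z := fun v => (X v - m) / r)
      (fun a ha b hb hab => div_lt_div_of_pos_right (sub_lt_sub_right (h ha hb hab) _) hr0) hZ hv
    rw [← this]; field_simp; ring
  · refine ⟨-r, neg_ne_zero.2 hr0.ne', fun v hv => ?_⟩
    have hZ' : HasLaw (fun v => -((X v - m) / r)) (gaussianReal 0 1) unif := by
      simpa using! gaussianReal_neg hZ
    have := eq_gaussQuantile_of_strictMonoOn (Z := fun v => -((X v - m) / r))
      (fun a ha b hb hab => neg_lt_neg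
        (div_lt_div_of_pos_right (sub_lt_sub_right (h ha hb hab) _) hr0)) hZ' hv
    rw [← this]; field_simp; ring

lemma not_eventually_eq_of_hasLaw_gaussianReal {X : ℝ → ℝ} {m : ℝ} {s : NNReal} (hs : s ≠ 0)
    (hlaw : HasLaw X (gaussianReal m s) unif) {c : ℝ} (hc : c ∈ unitIoo) :
    ¬ ∀ᶠ v in 𝓝 c, X v = X c := by
  intro h
  have h0 : unif {v | X v ∈ ({X c} : Set ℝ)} = 0 := by
    rw [hlaw.measure_eq (p := fun x => x ∈ ({X c} : Set ℝ)) (measurableSet_singleton _)]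
    have := nullSingletonClass_gaussianReal (μ := m) hs
    exact measure_singleton _
  obtain ⟨U, hU, hUo, hcU⟩ := eventually_nhds_iff.1
    (h.and (isOpen_unitIoo.eventually_mem hc))
  have h1 : 0 < volume U := hUo.measure_pos _ ⟨c, hcU⟩
  have h2 : volume U ≤ unif {v | X v ∈ ({X c} : Set ℝ)} := by
    rw [unif, ← inter_eq_self_of_subset_left (fun v hv => (hU v hv).2 : U ⊆ unitIoo),
      ← Measure.restrict_apply hUo.measurableSet]
    exact measure_mono fun v hv => (hU v hv).1
  rw [h0] at h2
  exact absurd h1 (not_lt.2 h2)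

namespace IsSquareDiffeo

variable {T S : ℝ × ℝ → ℝ × ℝ}

/-- As `T` preserves the product law, functions of `T₁` and of `T₂` are independent; for linear
forms in independent variables this is the functional equation of Bernstein's theorem. -/
lemma charFun_functional_equation (d : IsSquareDiffeo T S) {X Y Ψ₁ Ψ₂ : ℝ → ℝ}
    (hX : Measurable X) (hY : Measurable Y) (hΨ₁ : Measurable Ψ₁) (hΨ₂ : Measurable Ψ₂)
    {α β γ δ : ℝ}
    (h₁ : ∀ᵐ v ∂(unif.prod unif), α * X v.1 + β * Y v.2 = Ψ₁ (T v).1)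
    (h₂ : ∀ᵐ v ∂(unif.prod unif), γ * X v.1 + δ * Y v.2 = Ψ₂ (T v).2) (s t : ℝ) :
    charFun (unif.map X) (α * s + γ * t) * charFun (unif.map Y) (β * s + δ * t)
      = charFun (unif.map X) (α * s) * charFun (unif.map Y) (β * s) *
        charFun (unif.map X) (γ * t) * charFun (unif.map Y) (δ * t) := by
  have hchar : ∀ {Z : ℝ → ℝ}, Measurable Z → ∀ t : ℝ,
      charFun (unif.map Z) t = ∫ v, Complex.exp (t * Z v * Complex.I) ∂unif := by
    intro Z hZ t
    rw [charFun_apply_real, integral_map hZ.aemeasurable (by fun_prop)]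
  have key : ∀ s t : ℝ,
      charFun (unif.map X) (α * s + γ * t) * charFun (unif.map Y) (β * s + δ * t)
      = charFun (unif.map Ψ₁) s * charFun (unif.map Ψ₂) t := by
    intro s t
    rw [hchar hX, hchar hY, hchar hΨ₁, hchar hΨ₂, ← integral_prod_mul, ← integral_prod_mul]
    have hmp : ∫ v, Complex.exp (s * Ψ₁ v.1 * Complex.I) * Complex.exp (t * Ψ₂ v.2 * Complex.I)
        ∂(unif.prod unif) = ∫ v, Complex.exp (s * Ψ₁ (T v).1 * Complex.I) *
          Complex.exp (t * Ψ₂ (T v).2 * Complex.I) ∂(unif.prod unif) := by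
      conv_lhs => rw [← d.map_eq]
      rw [integral_map d.measurable.aemeasurable
        (Measurable.aestronglyMeasurable (by fun_prop))]
    rw [hmp]
    apply integral_congr_ae
    filter_upwards [h₁, h₂] with v e1 e2
    rw [← Complex.exp_add, ← Complex.exp_add, ← e1, ← e2]
    congr 1
    push_cast
    ring
  have : IsProbabilityMeasure (unif.map X) := Measure.isProbabilityMeasure_map hX.aemeasurable
  have : IsProbabilityMeasure (unif.map Y) := Measure.isProbabilityMeasure_map hY.aemeasurable
  have : IsProbabilityMeasure (unif.map Ψ₁) := Measure.isProbabilityMeasure_map hΨ₁.aemeasurable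
  have : IsProbabilityMeasure (unif.map Ψ₂) := Measure.isProbabilityMeasure_map hΨ₂.aemeasurable
  have k1 := key s 0
  have k2 := key 0 t
  simp only [mul_zero, add_zero, zero_add, charFun_zero, probReal_univ, Complex.ofReal_one,
    mul_one, one_mul] at k1 k2
  rw [key, mul_assoc, k1, k2]

/-- If `α X + β Y = Ψ₁ ∘ T₁` and `γ X + δ Y = Ψ₂ ∘ T₂` with `X` not constant and `α, γ ≠ 0`,
then `T` becomes linear, with no vanishing entry, when the
coordinates of the source are replaced by their Gaussian quantiles. -/
theorem exists_gaussian_coordinates (d : IsSquareDiffeo T S) {X Y Ψ₁ Ψ₂ : ℝ → ℝ}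
    (hX : Measurable X) (hY : Measurable Y) (hΨ₁ : Measurable Ψ₁) (hΨ₂ : Measurable Ψ₂)
    {α β γ δ : ℝ} (hα : α ≠ 0) (hγ : γ ≠ 0) (hdet : α * δ - β * γ ≠ 0)
    (h₁ : ∀ᵐ v ∂(unif.prod unif), α * X v.1 + β * Y v.2 = Ψ₁ (T v).1)
    (h₂ : ∀ᵐ v ∂(unif.prod unif), γ * X v.1 + δ * Y v.2 = Ψ₂ (T v).2)
    (hXn : ¬ ∃ c, ∀ᵐ v ∂unif, X v = c) :
    ∃ a₁ a₂ b₁ b₂ : ℝ, a₁ ≠ 0 ∧ a₂ ≠ 0 ∧ b₁ ≠ 0 ∧ b₂ ≠ 0 ∧ a₁ * b₂ - a₂ * b₁ ≠ 0 ∧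
      ∃ P Q : ℝ → ℝ, ContinuousOn P unitIoo ∧ ContinuousOn Q unitIoo ∧ ∀ v ∈ unitSq,
        a₁ * gaussQuantile v.1 + a₂ * gaussQuantile v.2 = P (T v).1 ∧
        b₁ * gaussQuantile v.1 + b₂ * gaussQuantile v.2 = Q (T v).2 := by
  have : IsProbabilityMeasure (unif.map X) := Measure.isProbabilityMeasure_map hX.aemeasurable
  have : IsProbabilityMeasure (unif.map Y) := Measure.isProbabilityMeasure_map hY.aemeasurable
  have hdirac : ∀ c, unif.map X ≠ Measure.dirac c := by
    intro c hc
    apply hXn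
    refine ⟨c, ?_⟩
    have h1 : ∀ᵐ x ∂(unif.map X), x = c := by
      rw [hc, ae_dirac_eq]; exact rfl
    exact ae_of_ae_map hX.aemeasurable h1
  obtain ⟨hβ, hδ, ⟨m, s, hs, hXlaw⟩, m', s', hs', hYlaw⟩ :=
    gaussian_of_charFun_functional_equation hα hγ hdet
      (d.charFun_functional_equation hX hY hΨ₁ hΨ₂ h₁ h₂) hdirac
  obtain ⟨X', Y', P, Q, hX'c, hY'c, hPc, hQc, hXe, hYe, heq⟩ :=
    d.exists_continuous_versions hX hY hΨ₁ hΨ₂ hα hβ hγ hδ h₁ h₂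
  have hX'law : HasLaw X' (gaussianReal m s) unif :=
    (⟨hX.aemeasurable, hXlaw⟩ : HasLaw X (gaussianReal m s) unif).congr hXe.symm
  have hY'law : HasLaw Y' (gaussianReal m' s') unif :=
    (⟨hY.aemeasurable, hYlaw⟩ : HasLaw Y (gaussianReal m' s') unif).congr hYe.symm
  have hX'n := fun c hc => not_eventually_eq_of_hasLaw_gaussianReal hs hX'law (c := c) hc
  have hY'n := fun c hc => not_eventually_eq_of_hasLaw_gaussianReal hs' hY'law (c := c) hc
  have hX'inj := d.injOn_fst hX'c hPc hQc hα hβ hγ hδ (fun v hv => (heq v hv).1)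
    (fun v hv => (heq v hv).2) hX'n hY'n
  have hY'inj := d.swap_right.injOn_fst (X := Y') (Y := X') hY'c hPc hQc hβ hα hδ hγ
    (fun v hv => by
      rw [← (heq v.swap ⟨hv.2, hv.1⟩).1]; simp [add_comm])
    (fun v hv => by
      rw [← (heq v.swap ⟨hv.2, hv.1⟩).2]; simp [add_comm]) hY'n hX'n
  obtain ⟨σ, hσ, hσe⟩ := exists_eq_gaussQuantile hX'c hX'inj hs hX'law
  obtain ⟨σ', hσ', hσe'⟩ := exists_eq_gaussQuantile hY'c hY'inj hs' hY'law
  refine ⟨α * σ, β * σ', γ * σ, δ * σ', mul_ne_zero hα hσ, mul_ne_zero hβ hσ', mul_ne_zero hγ hσ,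
    mul_ne_zero hδ hσ', ?_, fun y => P y - (α * m + β * m'), fun y => Q y - (γ * m + δ * m'),
    hPc.sub continuousOn_const, hQc.sub continuousOn_const, fun v hv => ?_⟩
  · rw [show α * σ * (δ * σ') - β * σ' * (γ * σ) = σ * σ' * (α * δ - β * γ) by ring]
    exact mul_ne_zero (mul_ne_zero hσ hσ') hdet
  · have e := heq v hv
    rw [hσe _ hv.1, hσe' _ hv.2] at e
    constructor
    · linear_combination e.1
    · linear_combination e.2

end IsSquareDiffeo

/-! ### Copula densities and their scores -/

/-- `ℓ u v` is a positive density on the unit square with uniform margins, differentiable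
in its first argument: the transition density of a stationary source. -/
structure IsCopulaDensity (ℓ : ℝ → ℝ → ℝ) : Prop where
  measurable : Measurable (Function.uncurry ℓ)
  pos : ∀ u ∈ unitIoo, ∀ v ∈ unitIoo, 0 < ℓ u v
  differentiableAt : ∀ u ∈ unitIoo, ∀ v ∈ unitIoo, DifferentiableAt ℝ (fun w => ℓ w v) u
  lintegral_fst : ∀ᵐ v ∂unif, ∫⁻ u, ENNReal.ofReal (ℓ u v) ∂unif = 1
  lintegral_snd : ∀ᵐ u ∂unif, ∫⁻ v, ENNReal.ofReal (ℓ u v) ∂unif = 1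

namespace IsCopulaDensity

variable {ℓ : ℝ → ℝ → ℝ}

lemma hasDerivAt_log (hℓ : IsCopulaDensity ℓ) {u v : ℝ} (hu : u ∈ unitIoo) (hv : v ∈ unitIoo) :
    HasDerivAt (fun w => Real.log (ℓ w v)) (score ℓ u v) u :=
  ((hℓ.differentiableAt u hu v hv).log (hℓ.pos u hu v hv).ne').hasDerivAt

lemma continuousOn_log (hℓ : IsCopulaDensity ℓ) {v : ℝ} (hv : v ∈ unitIoo) :
    ContinuousOn (fun w => Real.log (ℓ w v)) unitIoo := fun _ hu =>
  (hℓ.hasDerivAt_log hu hv).continuousAt.continuousWithinAt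

lemma measurable_score (hℓ : IsCopulaDensity ℓ) :
    Measurable (unitSq.indicator (Function.uncurry (score ℓ))) := by
  have hm := hℓ.measurable
  have hq : ∀ n : ℕ, Measurable (unitSq.indicator (fun p : ℝ × ℝ =>
      (1 / ((n : ℝ) + 1))⁻¹ •
        (Real.log (ℓ (p.1 + 1 / ((n : ℝ) + 1)) p.2) - Real.log (ℓ p.1 p.2)))) := by
    intro n
    refine Measurable.indicator ?_ isOpen_unitSq.measurableSet
    have h1 : Measurable fun p : ℝ × ℝ => ℓ (p.1 + 1 / ((n : ℝ) + 1)) p.2 :=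
      hm.comp (f := fun p : ℝ × ℝ => (p.1 + 1 / ((n : ℝ) + 1), p.2)) (by fun_prop)
    have h2 : Measurable fun p : ℝ × ℝ => ℓ p.1 p.2 := hm
    simp only [smul_eq_mul]
    exact (h1.log.sub h2.log).const_mul _
  refine measurable_of_tendsto_metrizable hq ?_
  rw [tendsto_pi_nhds]
  intro p
  by_cases hp : p ∈ unitSq
  · simp only [indicator_of_mem hp]
    have h1 := hasDerivAt_iff_tendsto_slope_zero.1 (hℓ.hasDerivAt_log hp.1 hp.2)
    refine h1.comp (tendsto_nhdsWithin_iff.2 ⟨tendsto_one_div_add_atTop_nhds_zero_nat, ?_⟩)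
    exact Eventually.of_forall fun n => by
      have : (1 : ℝ) / ((n : ℝ) + 1) ≠ 0 := by positivity
      simpa using this
  · simp only [indicator_of_notMem hp]
    exact tendsto_const_nhds

lemma measurable_score_right (hℓ : IsCopulaDensity ℓ) {u : ℝ} (hu : u ∈ unitIoo) :
    Measurable (unitIoo.indicator (score ℓ u)) := by
  have h1 := hℓ.measurable_score.comp (f := fun v : ℝ => (u, v)) (by fun_prop)
  convert h1 using 1
  ext v
  by_cases hv : v ∈ unitIoo
  · rw [indicator_of_mem hv, Function.comp_apply,
      indicator_of_mem (show (u, v) ∈ unitSq from ⟨hu, hv⟩)]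
    rfl
  · rw [indicator_of_notMem hv, Function.comp_apply,
      indicator_of_notMem (fun h : (u, v) ∈ unitSq => hv h.2)]

/-- If on an interval the score at `u` does not depend on the conditioning value, then the density
is there of the form `k u * m v`; integration over `v` shows that `k` is constant, so that the score
vanishes. -/
lemma score_eq_zero_of_ae_const (hℓ : IsCopulaDensity ℓ) {a b : ℝ} (hab : Ioo a b ⊆ unitIoo)
    (h : ∀ u ∈ Ioo a b, ∃ c, ∀ᵐ v ∂unif, score ℓ u v = c) :
    ∀ᵐ v ∂unif, ∀ u ∈ Ioo a b, score ℓ u v = 0 := by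
  set sc := unitSq.indicator (Function.uncurry (score ℓ)) with hsc
  have hscm : Measurable sc := hℓ.measurable_score
  have hscv : ∀ u ∈ unitIoo, ∀ v ∈ unitIoo, sc (u, v) = score ℓ u v := fun u hu v hv =>
    indicator_of_mem (show (u, v) ∈ unitSq from ⟨hu, hv⟩) _
  -- for almost all pairs of conditioning values the log-densities differ by a constant
  have h1 : ∀ᵐ u ∂(volume.restrict (Ioo a b)), ∀ᵐ p ∂(unif.prod unif),
      sc (u, p.1) = sc (u, p.2) := by
    filter_upwards [ae_restrict_mem measurableSet_Ioo] with u hu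
    obtain ⟨c, hc⟩ := h u hu
    have e1 := Measure.quasiMeasurePreserving_fst (μ := unif) (ν := unif) |>.ae (hc.and ae_unif_mem)
    have e2 := Measure.quasiMeasurePreserving_snd (μ := unif) (ν := unif) |>.ae (hc.and ae_unif_mem)
    filter_upwards [e1, e2] with p h1 h2
    rw [hscv u (hab hu) _ h1.2, hscv u (hab hu) _ h2.2, h1.1, h2.1]
  have hmeas : MeasurableSet {x : ℝ × (ℝ × ℝ) | sc (x.1, x.2.1) = sc (x.1, x.2.2)} :=
    measurableSet_eq_fun (hscm.comp (by fun_prop)) (hscm.comp (by fun_prop))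
  replace h1 := (Measure.ae_ae_comm (p := fun u (p : ℝ × ℝ) => sc (u, p.1) = sc (u, p.2))
    hmeas).1 h1
  have h2 : ∀ᵐ p ∂(unif.prod unif), ∀ u ∈ Ioo a b, ∀ u' ∈ Ioo a b,
      ℓ u p.1 * ℓ u' p.2 = ℓ u' p.1 * ℓ u p.2 := by
    filter_upwards [h1, IsSquareDiffeo.ae_mem] with p hp hpm
    have hD : ∀ u ∈ Ioo a b, HasDerivAt (fun w => Real.log (ℓ w p.1) - Real.log (ℓ w p.2))
        (sc (u, p.1) - sc (u, p.2)) u := by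
      intro u hu
      rw [hscv u (hab hu) _ hpm.1, hscv u (hab hu) _ hpm.2]
      exact (hℓ.hasDerivAt_log (hab hu) hpm.1).sub (hℓ.hasDerivAt_log (hab hu) hpm.2)
    intro u hu u' hu'
    have hsub : uIcc u u' ⊆ Ioo a b := fun x hx =>
      ⟨lt_of_lt_of_le (lt_min hu.1 hu'.1) hx.1, lt_of_le_of_lt hx.2 (max_lt hu.2 hu'.2)⟩
    have hz : ∀ᵐ x ∂(volume.restrict (uIoc u u')), sc (x, p.1) - sc (x, p.2) = 0 := by
      have := ae_restrict_of_ae_restrict_of_subset (uIoc_subset_uIcc.trans hsub) hp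
      filter_upwards [this] with x hx
      rw [hx, sub_self]
    have hint : IntervalIntegrable (fun x => sc (x, p.1) - sc (x, p.2)) volume u u' := by
      rw [intervalIntegrable_iff]
      exact (integrable_zero ℝ ℝ _).congr (by filter_upwards [hz] with x hx; exact hx.symm)
    have e1 := intervalIntegral.integral_eq_sub_of_hasDerivAt
      (fun x hx => hD x (hsub hx)) hint
    rw [intervalIntegral.integral_zero_ae ((ae_restrict_iff' measurableSet_uIoc).1 hz)] at e1
    have p1 := hℓ.pos u (hab hu) _ hpm.1
    have p2 := hℓ.pos u (hab hu) _ hpm.2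
    have p3 := hℓ.pos u' (hab hu') _ hpm.1
    have p4 := hℓ.pos u' (hab hu') _ hpm.2
    apply Real.log_injOn_pos (mul_pos p1 p4) (mul_pos p3 p2)
    rw [Real.log_mul p1.ne' p4.ne', Real.log_mul p3.ne' p2.ne']
    linarith
  have h3 := Measure.ae_ae_of_ae_prod (IsSquareDiffeo.ae_swap h2)
  obtain ⟨w, hw, hwI⟩ := (h3.and ae_unif_mem).exists
  simp only [Prod.fst_swap, Prod.snd_swap] at hw
  have hℓw : ∀ u ∈ Ioo a b, 0 < ℓ u w := fun u hu => hℓ.pos u (hab hu) w hwI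
  -- integrate over the conditioning value
  have hgood : ∀ᵐ u ∂(volume.restrict (Ioo a b)), ∫⁻ v, ENNReal.ofReal (ℓ u v) ∂unif = 1 :=
    ae_restrict_of_ae_restrict_of_subset hab hℓ.lintegral_snd
  have heqgood : ∀ u ∈ Ioo a b, ∫⁻ v, ENNReal.ofReal (ℓ u v) ∂unif = 1 → ∀ u' ∈ Ioo a b,
      ∫⁻ v, ENNReal.ofReal (ℓ u' v) ∂unif = 1 → ℓ u w = ℓ u' w := by
    intro u hu e u' hu' e'
    have e3 : ∫⁻ v, ENNReal.ofReal (ℓ u' w) * ENNReal.ofReal (ℓ u v) ∂unif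
        = ∫⁻ v, ENNReal.ofReal (ℓ u w) * ENNReal.ofReal (ℓ u' v) ∂unif := by
      apply lintegral_congr_ae
      filter_upwards [hw, ae_unif_mem] with v hv hvI
      rw [← ENNReal.ofReal_mul (hℓw u' hu').le, ← ENNReal.ofReal_mul (hℓw u hu).le]
      congr 1
      rw [mul_comm, hv u hu u' hu', mul_comm]
    rw [lintegral_const_mul' _ _ ENNReal.ofReal_ne_top,
      lintegral_const_mul' _ _ ENNReal.ofReal_ne_top, e, e', mul_one, mul_one,
      ENNReal.ofReal_eq_ofReal_iff (hℓw u' hu').le (hℓw u hu).le] at e3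
    exact e3.symm
  rcases le_or_gt b a with hba | hlt
  · rw [Ioo_eq_empty (not_lt.2 hba)]; simp
  have hconst : ∃ k : ℝ, ∀ u ∈ Ioo a b, ℓ u w = k := by
    have hne : (ae (volume.restrict (Ioo a b))).NeBot := by
      rw [ae_neBot, Ne, Measure.restrict_eq_zero, Real.volume_Ioo]
      simpa using hlt
    obtain ⟨u₀, hu₀, hu₀m⟩ := (hgood.and (ae_restrict_mem measurableSet_Ioo)).exists
    refine ⟨ℓ u₀ w, ?_⟩
    have hae : (fun u => ℓ u w) =ᵐ[volume.restrict (Ioo a b)] fun _ => ℓ u₀ w := by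
      filter_upwards [hgood, ae_restrict_mem measurableSet_Ioo] with u hu hum
      exact heqgood u hum hu u₀ hu₀m hu₀
    exact Measure.eqOn_open_of_ae_eq hae isOpen_Ioo
      (fun u hu => (hℓ.differentiableAt u (hab hu) w hwI).continuousAt.continuousWithinAt)
      continuousOn_const
  obtain ⟨k, hk⟩ := hconst
  filter_upwards [hw, ae_unif_mem] with v hv hvI u hu
  have hloc : (fun x => Real.log (ℓ x v)) =ᶠ[𝓝 u] fun _ => Real.log (ℓ u v) := by
    filter_upwards [isOpen_Ioo.mem_nhds hu] with x hx
    have e := hv x hx u hu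
    rw [hk u hu, hk x hx] at e
    have hk0 : k ≠ 0 := by rw [← hk u hu]; exact (hℓw u hu).ne'
    rw [mul_right_cancel₀ hk0 e]
  rw [score, hloc.deriv_eq, deriv_const]

end IsCopulaDensity

/-- A continuous function on the square that almost everywhere depends on the second coordinate only
does so everywhere. -/
lemma eq_of_ae_eq_snd {G : ℝ × ℝ → ℝ} (hG : ContinuousOn G unitSq) {β : ℝ → ℝ}
    (h : ∀ᵐ p ∂(unif.prod unif), G p = β p.2) {x x' y : ℝ} (hx : x ∈ unitIoo) (hx' : x' ∈ unitIoo)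
    (hy : y ∈ unitIoo) : G (x, y) = G (x', y) := by
  obtain ⟨x₀, h0, hx₀⟩ := ((Measure.ae_ae_of_ae_prod h).and ae_unif_mem).exists
  have hslice : ContinuousOn (fun p : ℝ × ℝ => G (x₀, p.2)) unitSq :=
    hG.comp (by fun_prop) fun p hp => ⟨hx₀, hp.2⟩
  have h1 : G =ᵐ[volume.restrict unitSq] fun p => G (x₀, p.2) := by
    rw [← prod_unif_eq]
    have h2 := Measure.quasiMeasurePreserving_snd (μ := unif) (ν := unif) |>.ae h0
    filter_upwards [h, h2] with p e1 e2
    rw [e1, e2]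
  have h2 := Measure.eqOn_open_of_ae_eq h1 isOpen_unitSq hG hslice
  have e1 := h2 (show (x, y) ∈ unitSq from ⟨hx, hy⟩)
  have e2 := h2 (show (x', y) ∈ unitSq from ⟨hx', hy⟩)
  simp only at e1 e2
  rw [e1, e2]

/-- A continuous function on the square that is almost everywhere a sum of functions of the two
coordinates has vanishing cross differences. -/
lemma cross_difference_eq_zero {H : ℝ × ℝ → ℝ} (hH : ContinuousOn H unitSq) {a b : ℝ → ℝ}
    (h : ∀ᵐ p ∂(unif.prod unif), H p = a p.1 + b p.2) {x x' y y' : ℝ} (hx : x ∈ unitIoo)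
    (hx' : x' ∈ unitIoo) (hy : y ∈ unitIoo) (hy' : y' ∈ unitIoo) :
    H (x, y) - H (x, y') = H (x', y) - H (x', y') := by
  obtain ⟨y₀, h0, hy₀⟩ :=
    ((Measure.ae_ae_of_ae_prod (IsSquareDiffeo.ae_swap h)).and ae_unif_mem).exists
  have hslice : ContinuousOn (fun p : ℝ × ℝ => H (p.1, y₀)) unitSq :=
    hH.comp (by fun_prop) fun p hp => ⟨hp.1, hy₀⟩
  have h1 : ∀ᵐ p ∂(unif.prod unif), H p - H (p.1, y₀) = b p.2 - b y₀ := by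
    have h2 := Measure.quasiMeasurePreserving_fst (μ := unif) (ν := unif) |>.ae h0
    filter_upwards [h, h2] with p e1 e2
    simp only [Prod.swap_prod_mk] at e2
    rw [e1, e2]; ring
  have key : ∀ y ∈ unitIoo, H (x, y) - H (x, y₀) = H (x', y) - H (x', y₀) := fun y hy =>
    eq_of_ae_eq_snd (G := fun p => H p - H (p.1, y₀)) (β := fun y => b y - b y₀)
      (hH.sub hslice) h1 hx hx' hy
  have k1 := key y hy
  have k2 := key y' hy'
  linarith

/-! ### Separable log-densities -/

/-- The logarithm of the transition density of the pair of sources, at the point of the square with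
image `u'` under the change of sources, given the value `v` of the sources. -/
noncomputable def logPairDensity (S : ℝ × ℝ → ℝ × ℝ) (ℓ₁ ℓ₂ : ℝ → ℝ → ℝ) (u' v : ℝ × ℝ) : ℝ :=
  Real.log (ℓ₁ (S u').1 v.1) + Real.log (ℓ₂ (S u').2 v.2)

/-- The new sources, obtained from the old ones through the inverse of `S`, are again
independent: in the new coordinates the joint transition density is a product. -/
def IsSeparableUnder (S : ℝ × ℝ → ℝ × ℝ) (ℓ₁ ℓ₂ : ℝ → ℝ → ℝ) : Prop :=
  ∃ a b : ℝ → ℝ → ℝ, ∀ᵐ p ∂((unif.prod unif).prod (unif.prod unif)),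
    logPairDensity S ℓ₁ ℓ₂ p.1 (S p.2) = a p.1.1 p.2.1 + b p.1.2 p.2.2

namespace IsSeparableUnder

variable {T S : ℝ × ℝ → ℝ × ℝ} {ℓ₁ ℓ₂ : ℝ → ℝ → ℝ}

lemma swap_target (h : IsSeparableUnder S ℓ₁ ℓ₂) :
    IsSeparableUnder (fun v => S v.swap) ℓ₁ ℓ₂ := by
  obtain ⟨a, b, hab⟩ := h
  refine ⟨b, a, ?_⟩
  have hs := Measure.measurePreserving_swap (μ := unif) (ν := unif)
  filter_upwards [(hs.prod hs).quasiMeasurePreserving.ae hab] with p hp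
  simp only [Prod.map_fst, Prod.map_snd, Prod.fst_swap, Prod.snd_swap] at hp
  rw [add_comm, ← hp]
  rfl

lemma swap_source (h : IsSeparableUnder S ℓ₁ ℓ₂) :
    IsSeparableUnder (fun v => (S v).swap) ℓ₂ ℓ₁ := by
  obtain ⟨a, b, hab⟩ := h
  refine ⟨a, b, ?_⟩
  filter_upwards [hab] with p hp
  rw [← hp, logPairDensity, logPairDensity, add_comm]
  rfl

lemma continuousOn_logPairDensity (d : IsSquareDiffeo T S) (hℓ₁ : IsCopulaDensity ℓ₁)
    (hℓ₂ : IsCopulaDensity ℓ₂) {v : ℝ × ℝ} (hv : v ∈ unitSq) :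
    ContinuousOn (fun u' => logPairDensity S ℓ₁ ℓ₂ u' v) unitSq :=
  ((hℓ₁.continuousOn_log hv.1).comp d.symm.contDiffOn_fst.continuousOn
    fun _ hu => (d.mapsTo_inv hu).1).add
  ((hℓ₂.continuousOn_log hv.2).comp d.symm.contDiffOn_snd.continuousOn
    fun _ hu => (d.mapsTo_inv hu).2)

/-- For almost every value of the sources, the log-density is everywhere a sum of functions of the
two new coordinates. -/
lemma cross_difference (d : IsSquareDiffeo T S) (hℓ₁ : IsCopulaDensity ℓ₁)
    (hℓ₂ : IsCopulaDensity ℓ₂) (h : IsSeparableUnder S ℓ₁ ℓ₂) :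
    ∀ᵐ v ∂(unif.prod unif), ∀ x ∈ unitIoo, ∀ x' ∈ unitIoo, ∀ y ∈ unitIoo, ∀ y' ∈ unitIoo,
      logPairDensity S ℓ₁ ℓ₂ (x, y) v - logPairDensity S ℓ₁ ℓ₂ (x, y') v
        = logPairDensity S ℓ₁ ℓ₂ (x', y) v - logPairDensity S ℓ₁ ℓ₂ (x', y') v := by
  obtain ⟨a, b, hab⟩ := h
  have h1 : ∀ᵐ v' ∂(unif.prod unif), ∀ᵐ u' ∂(unif.prod unif),
      logPairDensity S ℓ₁ ℓ₂ u' (S v') = a u'.1 v'.1 + b u'.2 v'.2 :=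
    Measure.ae_ae_of_ae_prod
      ((Measure.measurePreserving_swap (μ := unif.prod unif)
        (ν := unif.prod unif)).quasiMeasurePreserving.ae hab)
  filter_upwards [d.measurePreserving.quasiMeasurePreserving.ae h1, IsSquareDiffeo.ae_mem]
    with v hv hvm x hx x' hx' y hy y' hy'
  rw [d.leftInv v hvm] at hv
  exact cross_difference_eq_zero (H := fun u' => logPairDensity S ℓ₁ ℓ₂ u' v)
    (a := fun x => a x (T v).1) (b := fun y => b y (T v).2)
    (continuousOn_logPairDensity d hℓ₁ hℓ₂ hvm) hv hx hx' hy hy'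

/-- Increments of the log-density in the first new coordinate depend on the value of the sources
through its first new coordinate only. -/
lemma exists_reference (d : IsSquareDiffeo T S) (hℓ₁ : IsCopulaDensity ℓ₁)
    (hℓ₂ : IsCopulaDensity ℓ₂) (h : IsSeparableUnder S ℓ₁ ℓ₂) :
    ∃ z ∈ unitIoo, ∀ᵐ v ∂(unif.prod unif), ∀ x ∈ unitIoo, ∀ x' ∈ unitIoo, ∀ y ∈ unitIoo,
      logPairDensity S ℓ₁ ℓ₂ (x, y) v - logPairDensity S ℓ₁ ℓ₂ (x', y) v
        = logPairDensity S ℓ₁ ℓ₂ (x, y) (S ((T v).1, z))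
          - logPairDensity S ℓ₁ ℓ₂ (x', y) (S ((T v).1, z)) := by
  obtain ⟨a, b, hab⟩ := h
  have h1 : ∀ᵐ v' ∂(unif.prod unif), ∀ᵐ u' ∂(unif.prod unif),
      logPairDensity S ℓ₁ ℓ₂ u' (S v') = a u'.1 v'.1 + b u'.2 v'.2 :=
    Measure.ae_ae_of_ae_prod
      ((Measure.measurePreserving_swap (μ := unif.prod unif)
        (ν := unif.prod unif)).quasiMeasurePreserving.ae hab)
  obtain ⟨z, hz, hzI⟩ :=
    ((Measure.ae_ae_of_ae_prod (IsSquareDiffeo.ae_swap h1)).and ae_unif_mem).exists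
  refine ⟨z, hzI, ?_⟩
  have h2 : ∀ᵐ v' ∂(unif.prod unif), ∀ᵐ u' ∂(unif.prod unif),
      logPairDensity S ℓ₁ ℓ₂ u' (S (v'.1, z)) = a u'.1 v'.1 + b u'.2 z :=
    Measure.quasiMeasurePreserving_fst (μ := unif) (ν := unif) |>.ae hz
  filter_upwards [d.measurePreserving.quasiMeasurePreserving.ae h1,
    d.measurePreserving.quasiMeasurePreserving.ae h2, IsSquareDiffeo.ae_mem]
    with v hv1 hv2 hvm x hx x' hx' y hy
  rw [d.leftInv v hvm] at hv1
  have hm2 : S ((T v).1, z) ∈ unitSq := d.mapsTo_inv ⟨(d.mapsTo hvm).1, hzI⟩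
  have := eq_of_ae_eq_snd
    (G := fun u' => logPairDensity S ℓ₁ ℓ₂ u' v - logPairDensity S ℓ₁ ℓ₂ u' (S ((T v).1, z)))
    (β := fun y => b y (T v).2 - b y z)
    ((continuousOn_logPairDensity d hℓ₁ hℓ₂ hvm).sub (continuousOn_logPairDensity d hℓ₁ hℓ₂ hm2))
    (by filter_upwards [hv1, hv2] with u' e1 e2; rw [e1, e2]; ring) hx hx' hy
  linarith

lemma measurable_logPairDensity (hℓ₁ : IsCopulaDensity ℓ₁) (hℓ₂ : IsCopulaDensity ℓ₂)
    (u' : ℝ × ℝ) : Measurable (logPairDensity S ℓ₁ ℓ₂ u') := by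
  have h1 : Measurable fun v : ℝ × ℝ => ℓ₁ (S u').1 v.1 :=
    hℓ₁.measurable.comp (f := fun v : ℝ × ℝ => ((S u').1, v.1)) (by fun_prop)
  have h2 : Measurable fun v : ℝ × ℝ => ℓ₂ (S u').2 v.2 :=
    hℓ₂.measurable.comp (f := fun v : ℝ × ℝ => ((S u').2, v.2)) (by fun_prop)
  exact h1.log.add h2.log

lemma exists_increment_eq_comp_fst (d : IsSquareDiffeo T S) (hℓ₁ : IsCopulaDensity ℓ₁)
    (hℓ₂ : IsCopulaDensity ℓ₂) (h : IsSeparableUnder S ℓ₁ ℓ₂) {x x' y : ℝ} (hx : x ∈ unitIoo)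
    (hx' : x' ∈ unitIoo) (hy : y ∈ unitIoo) :
    ∃ Ψ : ℝ → ℝ, Measurable Ψ ∧ ∀ᵐ v ∂(unif.prod unif),
      logPairDensity S ℓ₁ ℓ₂ (x, y) v - logPairDensity S ℓ₁ ℓ₂ (x', y) v = Ψ (T v).1 := by
  obtain ⟨z, -, hz⟩ := h.exists_reference d hℓ₁ hℓ₂
  have hS : Measurable fun t : ℝ => S (t, z) := d.measurable_inv.comp (by fun_prop)
  refine ⟨fun t => logPairDensity S ℓ₁ ℓ₂ (x, y) (S (t, z)) -
    logPairDensity S ℓ₁ ℓ₂ (x', y) (S (t, z)),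
    ((measurable_logPairDensity hℓ₁ hℓ₂ _).comp hS).sub
      ((measurable_logPairDensity hℓ₁ hℓ₂ _).comp hS), ?_⟩
  filter_upwards [hz] with v hv
  exact hv x hx x' hx' y hy

lemma hasDerivAt_logPairDensity (d : IsSquareDiffeo T S) (hℓ₁ : IsCopulaDensity ℓ₁)
    (hℓ₂ : IsCopulaDensity ℓ₂) {x y : ℝ} (hxy : (x, y) ∈ unitSq) {v : ℝ × ℝ} (hv : v ∈ unitSq) :
    HasDerivAt (fun x => logPairDensity S ℓ₁ ℓ₂ (x, y) v)
      ((fderiv ℝ S (x, y) (1, 0)).1 * score ℓ₁ (S (x, y)).1 v.1 +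
        (fderiv ℝ S (x, y) (1, 0)).2 * score ℓ₂ (S (x, y)).2 v.2) x := by
  have h1 := hasDerivAt_slice_fst d.symm.contDiffOn_fst hxy
  have h2 := hasDerivAt_slice_fst d.symm.contDiffOn_snd hxy
  rw [d.symm.fderiv_fst_eq hxy] at h1
  rw [d.symm.fderiv_snd_eq hxy] at h2
  have hm := d.mapsTo_inv hxy
  rw [mul_comm _ (score ℓ₁ _ _), mul_comm _ (score ℓ₂ _ _)]
  exact (HasDerivAt.comp x (hℓ₁.hasDerivAt_log hm.1 hv.1) h1).add
    (HasDerivAt.comp x (hℓ₂.hasDerivAt_log hm.2 hv.2) h2)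

/-- At a given point, the combination of the two scores with the coefficients
`∂S₁/∂x₁`, `∂S₂/∂x₁` depends on the value of the sources through the first new coordinate only. -/
lemma exists_score_combination_eq_comp_fst (d : IsSquareDiffeo T S) (hℓ₁ : IsCopulaDensity ℓ₁)
    (hℓ₂ : IsCopulaDensity ℓ₂) (h : IsSeparableUnder S ℓ₁ ℓ₂) {u' : ℝ × ℝ} (hu' : u' ∈ unitSq) :
    ∃ Ψ : ℝ → ℝ, Measurable Ψ ∧ ∀ᵐ v ∂(unif.prod unif),
      (fderiv ℝ S u' (1, 0)).1 * unitIoo.indicator (score ℓ₁ (S u').1) v.1 +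
        (fderiv ℝ S u' (1, 0)).2 * unitIoo.indicator (score ℓ₂ (S u').2) v.2 = Ψ (T v).1 := by
  obtain ⟨z, hzI, hz⟩ := h.exists_reference d hℓ₁ hℓ₂
  have hm := d.mapsTo_inv hu'
  have hS : Measurable fun t : ℝ => S (t, z) := d.measurable_inv.comp (by fun_prop)
  have hs1 := hℓ₁.measurable_score_right hm.1
  have hs2 := hℓ₂.measurable_score_right hm.2
  refine ⟨fun t => (fderiv ℝ S u' (1, 0)).1 * unitIoo.indicator (score ℓ₁ (S u').1) (S (t, z)).1 +
        (fderiv ℝ S u' (1, 0)).2 * unitIoo.indicator (score ℓ₂ (S u').2) (S (t, z)).2,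
    ((hs1.comp hS.fst).const_mul _).add ((hs2.comp hS.snd).const_mul _), ?_⟩
  filter_upwards [hz, IsSquareDiffeo.ae_mem] with v hv hvm
  have hm2 : S ((T v).1, z) ∈ unitSq := d.mapsTo_inv ⟨(d.mapsTo hvm).1, hzI⟩
  rw [indicator_of_mem hvm.1, indicator_of_mem hvm.2, indicator_of_mem hm2.1,
    indicator_of_mem hm2.2]
  obtain ⟨x, y⟩ := u'
  have e1 := hasDerivAt_logPairDensity d hℓ₁ hℓ₂ hu' hvm
  have e2 := hasDerivAt_logPairDensity d hℓ₁ hℓ₂ hu' hm2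
  refine (e1.congr_of_eventuallyEq ?_).unique (e2.add_const
    (logPairDensity S ℓ₁ ℓ₂ (x, y) v - logPairDensity S ℓ₁ ℓ₂ (x, y) (S ((T v).1, z))))
  filter_upwards [isOpen_unitIoo.mem_nhds hu'.1] with x' hx'
  have := hv x' hx' x hu'.1 y hu'.2
  linarith

end IsSeparableUnder

/-! ### Quadratic log-densities in Gaussian coordinates -/

/-- A measurable solution of Jensen's equation on the line is affine. -/
lemma eq_affine_of_map_add_add {r : ℝ → ℝ} (hr : Measurable r)
    (h : ∀ x y, r (x + y) + r 0 = r x + r y) : ∃ μ, ∀ x, r x = r 0 + μ * x := by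
  set f : ℝ →+ ℝ := AddMonoidHom.mk' (fun x => r x - r 0) (fun x y => by
    have := h x y; linarith) with hf
  have hfm : Measurable f := hr.sub_const _
  have hfc : Continuous f := Measure.AddMonoidHom.continuous_of_measurable f hfm
  refine ⟨f 1, fun x => ?_⟩
  have h1 := (f.toRealLinearMap hfc).map_smul x 1
  have h2 : f x = x * f 1 := by simpa using! h1
  have h3 : f x = r x - r 0 := rfl
  linarith

/-- Functions `f`, `k` on the line for which two independent combinations of `f (m₁₁ p + m₁₂ q)` and
`k (m₂₁ p + m₂₂ q)` depend on `p` only, resp. on `q` only: elimination of `k` gives Jensen's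
equation for `f`. -/
lemma map_add_add_of_combinations {f k : ℝ → ℝ} {m₁₁ m₁₂ m₂₁ m₂₂ : ℝ} (h₁₁ : m₁₁ ≠ 0)
    (h₁₂ : m₁₂ ≠ 0) (hdet : m₁₁ * m₂₂ - m₁₂ * m₂₁ ≠ 0)
    (hA : ∀ p q q' : ℝ, m₁₁ * f (m₁₁ * p + m₁₂ * q) + m₂₁ * k (m₂₁ * p + m₂₂ * q)
      = m₁₁ * f (m₁₁ * p + m₁₂ * q') + m₂₁ * k (m₂₁ * p + m₂₂ * q'))
    (hB : ∀ p p' q : ℝ, m₁₂ * f (m₁₁ * p + m₁₂ * q) + m₂₂ * k (m₂₁ * p + m₂₂ * q)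
      = m₁₂ * f (m₁₁ * p' + m₁₂ * q) + m₂₂ * k (m₂₁ * p' + m₂₂ * q)) (x y : ℝ) :
    f (x + y) + f 0 = f x + f y := by
  have a1 := hA (x / m₁₁) (y / m₁₂) 0
  have b1 := hB (x / m₁₁) 0 (y / m₁₂)
  have b0 := hB (x / m₁₁) 0 0
  have a0 := hA 0 (y / m₁₂) 0
  simp only [mul_div_cancel₀ _ h₁₁, mul_div_cancel₀ _ h₁₂, mul_zero, add_zero, zero_add]
    at a1 b1 b0 a0
  apply mul_left_cancel₀ hdet
  linear_combination m₂₂ * a1 - m₂₁ * b1 + m₂₁ * b0 - m₂₂ * a0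

/-- If `f (m₁₁ p + m₁₂ q) + k (m₂₁ p + m₂₂ q)` is the sum of a function of `p` and a function of
`q`, then `f` is a quadratic polynomial: elimination of `k'` from the two partial derivatives gives
Jensen's equation for `f'`. -/
lemma exists_quadratic_of_cross_difference {f k : ℝ → ℝ} (hf : Differentiable ℝ f)
    (hk : Differentiable ℝ k) {m₁₁ m₁₂ m₂₁ m₂₂ : ℝ} (h₁₁ : m₁₁ ≠ 0) (h₁₂ : m₁₂ ≠ 0)
    (hdet : m₁₁ * m₂₂ - m₁₂ * m₂₁ ≠ 0)
    (h : ∀ p p' q q' : ℝ, f (m₁₁ * p + m₁₂ * q) + k (m₂₁ * p + m₂₂ * q)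
        - (f (m₁₁ * p + m₁₂ * q') + k (m₂₁ * p + m₂₂ * q'))
      = f (m₁₁ * p' + m₁₂ * q) + k (m₂₁ * p' + m₂₂ * q)
        - (f (m₁₁ * p' + m₁₂ * q') + k (m₂₁ * p' + m₂₂ * q'))) :
    ∃ β μ : ℝ, ∀ y, f y = f 0 + β * y + μ / 2 * y ^ 2 := by
  have hp : ∀ p q : ℝ, HasDerivAt (fun p => f (m₁₁ * p + m₁₂ * q) + k (m₂₁ * p + m₂₂ * q))
      (m₁₁ * deriv f (m₁₁ * p + m₁₂ * q) + m₂₁ * deriv k (m₂₁ * p + m₂₂ * q)) p := by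
    intro p q
    have e1 : HasDerivAt (fun p => m₁₁ * p + m₁₂ * q) m₁₁ p := by
      simpa using ((hasDerivAt_id p).const_mul m₁₁).add_const (m₁₂ * q)
    have e2 : HasDerivAt (fun p => m₂₁ * p + m₂₂ * q) m₂₁ p := by
      simpa using ((hasDerivAt_id p).const_mul m₂₁).add_const (m₂₂ * q)
    rw [mul_comm m₁₁ (deriv f _), mul_comm m₂₁ (deriv k _)]
    exact ((hf _).hasDerivAt.comp p e1).add ((hk _).hasDerivAt.comp p e2)
  have hq : ∀ p q : ℝ, HasDerivAt (fun q => f (m₁₁ * p + m₁₂ * q) + k (m₂₁ * p + m₂₂ * q))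
      (m₁₂ * deriv f (m₁₁ * p + m₁₂ * q) + m₂₂ * deriv k (m₂₁ * p + m₂₂ * q)) q := by
    intro p q
    have e1 : HasDerivAt (fun q => m₁₁ * p + m₁₂ * q) m₁₂ q := by
      simpa using ((hasDerivAt_id q).const_mul m₁₂).const_add (m₁₁ * p)
    have e2 : HasDerivAt (fun q => m₂₁ * p + m₂₂ * q) m₂₂ q := by
      simpa using ((hasDerivAt_id q).const_mul m₂₂).const_add (m₂₁ * p)
    rw [mul_comm m₁₂ (deriv f _), mul_comm m₂₂ (deriv k _)]
    exact ((hf _).hasDerivAt.comp q e1).add ((hk _).hasDerivAt.comp q e2)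
  have hA : ∀ p q q' : ℝ,
      m₁₁ * deriv f (m₁₁ * p + m₁₂ * q) + m₂₁ * deriv k (m₂₁ * p + m₂₂ * q)
      = m₁₁ * deriv f (m₁₁ * p + m₁₂ * q') + m₂₁ * deriv k (m₂₁ * p + m₂₂ * q') := by
    intro p q q'
    have e := (hp p q).sub (hp p q')
    have e0 : (fun p => f (m₁₁ * p + m₁₂ * q) + k (m₂₁ * p + m₂₂ * q)
        - (f (m₁₁ * p + m₁₂ * q') + k (m₂₁ * p + m₂₂ * q'))) = fun _ =>
          f (m₁₁ * 0 + m₁₂ * q) + k (m₂₁ * 0 + m₂₂ * q)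
        - (f (m₁₁ * 0 + m₁₂ * q') + k (m₂₁ * 0 + m₂₂ * q')) := by
      funext p
      exact h p 0 q q'
    have e1 := e.unique (by
      change HasDerivAt (fun p => f (m₁₁ * p + m₁₂ * q) + k (m₂₁ * p + m₂₂ * q)
        - (f (m₁₁ * p + m₁₂ * q') + k (m₂₁ * p + m₂₂ * q'))) 0 p
      rw [e0]; exact hasDerivAt_const _ _)
    linarith
  have hB : ∀ p p' q : ℝ,
      m₁₂ * deriv f (m₁₁ * p + m₁₂ * q) + m₂₂ * deriv k (m₂₁ * p + m₂₂ * q)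
      = m₁₂ * deriv f (m₁₁ * p' + m₁₂ * q) + m₂₂ * deriv k (m₂₁ * p' + m₂₂ * q) := by
    intro p p' q
    have e := (hq p q).sub (hq p' q)
    have e0 : (fun q => f (m₁₁ * p + m₁₂ * q) + k (m₂₁ * p + m₂₂ * q)
        - (f (m₁₁ * p' + m₁₂ * q) + k (m₂₁ * p' + m₂₂ * q))) = fun _ =>
          f (m₁₁ * p + m₁₂ * 0) + k (m₂₁ * p + m₂₂ * 0)
        - (f (m₁₁ * p' + m₁₂ * 0) + k (m₂₁ * p' + m₂₂ * 0)) := by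
      funext q
      have := h p p' q 0
      linarith
    have e1 := e.unique (by
      change HasDerivAt (fun q => f (m₁₁ * p + m₁₂ * q) + k (m₂₁ * p + m₂₂ * q)
        - (f (m₁₁ * p' + m₁₂ * q) + k (m₂₁ * p' + m₂₂ * q))) 0 q
      rw [e0]; exact hasDerivAt_const _ _)
    linarith
  have hJ := map_add_add_of_combinations (f := deriv f) (k := deriv k) h₁₁ h₁₂ hdet hA hB
  obtain ⟨μ, hμ⟩ := eq_affine_of_map_add_add (measurable_deriv f) hJ
  refine ⟨deriv f 0, μ, fun y => ?_⟩
  have hd : ∀ y, HasDerivAt (fun y => f y - (f 0 + deriv f 0 * y + μ / 2 * y ^ 2)) 0 y := by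
    intro y
    have e1 : HasDerivAt (fun y => f 0 + deriv f 0 * y + μ / 2 * y ^ 2)
        (deriv f 0 + μ * y) y := by
      have := (((hasDerivAt_id y).const_mul (deriv f 0)).const_add (f 0)).add
        (((hasDerivAt_id y).pow 2).const_mul (μ / 2))
      refine this.congr_deriv ?_
      simp
      ring
    refine ((hf y).hasDerivAt.sub e1).congr_deriv ?_
    rw [hμ y]; ring
  have := is_const_of_deriv_eq_zero (fun y => (hd y).differentiableAt) (fun y => (hd y).deriv) y 0
  simp only [mul_zero, ne_eq, OfNat.ofNat_ne_zero, not_false_eq_true, zero_pow, add_zero,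
    sub_self] at this
  linarith

lemma integrable_gaussQuantile : Integrable gaussQuantile unif := by
  have h : Integrable (fun x : ℝ => x) (unif.map gaussQuantile) := by
    rw [map_gaussQuantile]
    exact (memLp_id_gaussianReal 1).integrable le_rfl
  exact h.comp_measurable measurable_gaussQuantile

lemma integral_gaussQuantile : ∫ v, gaussQuantile v ∂unif = 0 := by
  have h := integral_map (μ := unif) measurable_gaussQuantile.aemeasurable (f := fun x : ℝ => x)
    (by fun_prop)
  rw [map_gaussQuantile, integral_id_gaussianReal] at h
  exact h.symm

lemma integrable_gaussQuantile_comp {α : Type*} [MeasurableSpace α] {ν : Measure α} {f : α → ℝ}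
    (hf : MeasurePreserving f ν unif) : Integrable (fun p => gaussQuantile (f p)) ν :=
  hf.integrable_comp_of_integrable integrable_gaussQuantile

lemma integral_gaussQuantile_comp {α : Type*} [MeasurableSpace α] {ν : Measure α} {f : α → ℝ}
    (hf : MeasurePreserving f ν unif) : ∫ p, gaussQuantile (f p) ∂ν = 0 := by
  rw [← integral_map hf.measurable.aemeasurable measurable_gaussQuantile.aestronglyMeasurable,
    hf.map_eq, integral_gaussQuantile]

lemma hasDerivAt_gaussDensity (y : ℝ) : HasDerivAt gaussDensity (-y * gaussDensity y) y := by
  have h1 : gaussDensity = fun y => (Real.sqrt (2 * Real.pi * (1 : NNReal)))⁻¹ *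
      Real.exp (-y ^ 2 / 2) := by
    ext y
    simp [gaussDensity, gaussianPDFReal]
  have h2 : HasDerivAt (fun y : ℝ => -y ^ 2 / 2) (-y) y := by
    refine ((((hasDerivAt_id y).pow 2).neg).div_const 2).congr_deriv ?_
    simp
    ring
  rw [h1]
  refine (h2.exp.const_mul _).congr_deriv ?_
  ring

namespace IsCopulaDensity

variable {ℓ : ℝ → ℝ → ℝ}

lemma lintegral_mul_fst (hℓ : IsCopulaDensity ℓ) {a : ℝ → ENNReal} (ha : Measurable a) :
    ∫⁻ p, a p.1 * ENNReal.ofReal (ℓ p.1 p.2) ∂(unif.prod unif) = ∫⁻ u, a u ∂unif := by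
  have hm : Measurable fun p : ℝ × ℝ => ℓ p.1 p.2 := hℓ.measurable
  rw [lintegral_prod _ (by fun_prop)]
  apply lintegral_congr_ae
  filter_upwards [hℓ.lintegral_snd] with u hu
  have hm' : Measurable fun v => ℓ u v := hm.comp (f := fun v : ℝ => (u, v)) (by fun_prop)
  rw [lintegral_const_mul _ (by fun_prop), hu, mul_one]

/-- The law of the pair with density `ℓ`. -/
noncomputable def pairLaw (ℓ : ℝ → ℝ → ℝ) : Measure (ℝ × ℝ) :=
  (unif.prod unif).withDensity fun p => ENNReal.ofReal (ℓ p.1 p.2)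

lemma map_fst_pairLaw (hℓ : IsCopulaDensity ℓ) : (pairLaw ℓ).map Prod.fst = unif := by
  have hm : Measurable fun p : ℝ × ℝ => ℓ p.1 p.2 := hℓ.measurable
  refine Measure.ext_of_lintegral _ fun a ha => ?_
  rw [lintegral_map ha measurable_fst, pairLaw, lintegral_withDensity_eq_lintegral_mul _
    (by fun_prop) (by fun_prop), ← hℓ.lintegral_mul_fst ha]
  exact lintegral_congr fun p => mul_comm _ _

lemma map_snd_pairLaw (hℓ : IsCopulaDensity ℓ) : (pairLaw ℓ).map Prod.snd = unif := by
  have hm : Measurable fun p : ℝ × ℝ => ℓ p.1 p.2 := hℓ.measurable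
  refine Measure.ext_of_lintegral _ fun a ha => ?_
  rw [lintegral_map ha measurable_snd, pairLaw, lintegral_withDensity_eq_lintegral_mul _
    (by fun_prop) (by fun_prop)]
  rw [lintegral_prod_symm _ (by simp only [Pi.mul_def]; fun_prop)]
  apply lintegral_congr_ae
  filter_upwards [hℓ.lintegral_fst] with v hv
  have hm' : Measurable fun u => ℓ u v := hm.comp (f := fun u : ℝ => (u, v)) (by fun_prop)
  simp only [Pi.mul_apply]
  rw [lintegral_mul_const _ (by fun_prop), hv, one_mul]

lemma ae_nonneg (hℓ : IsCopulaDensity ℓ) : ∀ᵐ p ∂(unif.prod unif), 0 ≤ ℓ p.1 p.2 := by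
  filter_upwards [IsSquareDiffeo.ae_mem] with p hp using (hℓ.pos _ hp.1 _ hp.2).le

lemma isProbabilityMeasure_pairLaw (hℓ : IsCopulaDensity ℓ) :
    IsProbabilityMeasure (pairLaw ℓ) := by
  refine ⟨?_⟩
  rw [← preimage_univ (f := Prod.fst), ← Measure.map_apply measurable_fst MeasurableSet.univ,
    hℓ.map_fst_pairLaw, measure_univ]

lemma integrable_mul_of_pairLaw (hℓ : IsCopulaDensity ℓ) {J : ℝ × ℝ → ℝ}
    (hJ : Integrable J (pairLaw ℓ)) :
    Integrable (fun p : ℝ × ℝ => ℓ p.1 p.2 * J p) (unif.prod unif) := by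
  have hm : Measurable fun p : ℝ × ℝ => ℓ p.1 p.2 := hℓ.measurable
  have := (integrable_withDensity_iff_integrable_smul' (μ := unif.prod unif)
    (f := fun p : ℝ × ℝ => ENNReal.ofReal (ℓ p.1 p.2)) (by fun_prop) (by simp) (g := J)).1 hJ
  refine this.congr ?_
  filter_upwards [hℓ.ae_nonneg] with p hp
  rw [ENNReal.toReal_ofReal hp, smul_eq_mul]

lemma integral_pairLaw (hℓ : IsCopulaDensity ℓ) (J : ℝ × ℝ → ℝ) :
    ∫ p, J p ∂(pairLaw ℓ) = ∫ p, ℓ p.1 p.2 * J p ∂(unif.prod unif) := by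
  have hm : Measurable fun p : ℝ × ℝ => ℓ p.1 p.2 := hℓ.measurable
  rw [pairLaw, integral_withDensity_eq_integral_toReal_smul (by fun_prop) (by simp)]
  apply integral_congr_ae
  filter_upwards [hℓ.ae_nonneg] with p hp
  rw [ENNReal.toReal_ofReal hp, smul_eq_mul]

end IsCopulaDensity

lemma integrable_gaussDensity_mul {F : ℝ → ℝ} (hF : Integrable F unif) :
    Integrable fun y => gaussDensity y * F (gaussCdf y) := by
  rw [← map_gaussCdf] at hF
  have h1 := hF.comp_measurable continuous_gaussCdf.measurable
  rw [gaussianReal_of_var_ne_zero _ one_ne_zero, integrable_withDensity_iff_integrable_smul'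
      (measurable_gaussianPDF 0 1) (ae_of_all _ fun x => gaussianPDF_lt_top)] at h1
  simpa [toReal_gaussianPDF] using h1

lemma integral_unif_eq {F : ℝ → ℝ} (hF : Integrable F unif) :
    ∫ u, F u ∂unif = ∫ y, gaussDensity y * F (gaussCdf y) := by
  have hF := hF.aestronglyMeasurable
  rw [← map_gaussCdf] at hF ⊢
  rw [integral_map continuous_gaussCdf.measurable.aemeasurable hF,
    integral_gaussianReal_eq_integral_smul one_ne_zero]
  rfl

namespace IsCopulaDensity

variable {ℓ : ℝ → ℝ → ℝ}

/-- The derivative of `φ(y) f(Φ(y))` integrates to zero; as `φ'(y) = -y φ(y)`, it is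
`φ(y) f(Φ(y))` times `b + (μ - 1) y`. -/
lemma integral_score_eq_zero {f : ℝ → ℝ} {b μ c : ℝ} (hf : ∀ u ∈ unitIoo, 0 < f u)
    (h : ∀ y, Real.log (f (gaussCdf y)) = c + b * y + μ / 2 * y ^ 2)
    (i0 : Integrable f unif)
    (i1 : Integrable (fun u => f u * (b + (μ - 1) * gaussQuantile u)) unif) :
    ∫ u, f u * (b + (μ - 1) * gaussQuantile u) ∂unif = 0 := by
  have hd : ∀ y, HasDerivAt (fun y => f (gaussCdf y)) ((b + μ * y) * f (gaussCdf y)) y := by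
    intro y
    have e1 : (fun y => f (gaussCdf y)) = fun y => Real.exp (c + b * y + μ / 2 * y ^ 2) := by
      ext y
      rw [← h y, Real.exp_log (hf _ (gaussCdf_mem y))]
    have e2 : HasDerivAt (fun y => c + b * y + μ / 2 * y ^ 2) (b + μ * y) y := by
      have := (((hasDerivAt_id y).const_mul b).const_add c).add
        (((hasDerivAt_id y).pow 2).const_mul (μ / 2))
      refine this.congr_deriv ?_
      simp
      ring
    have e3 := congrFun e1 y
    rw [e3, e1, mul_comm]
    exact e2.exp
  have g1 := integrable_gaussDensity_mul i1
  have g0 := integrable_gaussDensity_mul i0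
  rw [integral_unif_eq i1]
  refine integral_eq_zero_of_hasDerivAt_of_integrable (fun y => ?_) g1 g0
  refine ((hasDerivAt_gaussDensity y).mul (hd y)).congr_deriv ?_
  simp only [gaussQuantile_gaussCdf]
  ring

/-- If in Gaussian coordinates the log-density is quadratic in the first variable, with linear
coefficient `k N(v) + m`, then `m = 0`: given `v`, the derivative of the density of the first
variable integrates to zero, and both variables are centred. -/
lemma linear_coefficient_eq_zero (hℓ : IsCopulaDensity ℓ) {e : ℝ → ℝ} {k m μ : ℝ}
    (h : ∀ᵐ v ∂unif, ∀ y, Real.log (ℓ (gaussCdf y) v)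
      = e v + (k * gaussQuantile v + m) * y + μ / 2 * y ^ 2) : m = 0 := by
  have hfst : MeasurePreserving Prod.fst (pairLaw ℓ) unif := ⟨measurable_fst, hℓ.map_fst_pairLaw⟩
  have hsnd : MeasurePreserving Prod.snd (pairLaw ℓ) unif := ⟨measurable_snd, hℓ.map_snd_pairLaw⟩
  have i1 : Integrable (fun p : ℝ × ℝ => gaussQuantile p.1) (pairLaw ℓ) :=
    integrable_gaussQuantile_comp hfst
  have i2 : Integrable (fun p : ℝ × ℝ => gaussQuantile p.2) (pairLaw ℓ) :=
    integrable_gaussQuantile_comp hsnd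
  have hprob := hℓ.isProbabilityMeasure_pairLaw
  have z1 := integral_gaussQuantile_comp hfst
  have z2 := integral_gaussQuantile_comp hsnd
  have iK : Integrable (fun p : ℝ × ℝ => k * gaussQuantile p.2 + m) (pairLaw ℓ) :=
    (i2.const_mul k).add (integrable_const m)
  have iJ : Integrable (fun p : ℝ × ℝ =>
      (k * gaussQuantile p.2 + m) + (μ - 1) * gaussQuantile p.1) (pairLaw ℓ) :=
    iK.add (i1.const_mul (μ - 1))
  have total : ∫ p, ((k * gaussQuantile p.2 + m) + (μ - 1) * gaussQuantile p.1) ∂(pairLaw ℓ)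
      = m := by
    rw [integral_add iK (i1.const_mul (μ - 1)),
      integral_add (i2.const_mul k) (integrable_const m), integral_const_mul, integral_const_mul,
      z1, z2]
    simp
  have iJ' := hℓ.integrable_mul_of_pairLaw iJ
  have i0' : Integrable (fun p : ℝ × ℝ => ℓ p.1 p.2 * 1) (unif.prod unif) :=
    hℓ.integrable_mul_of_pairLaw (J := fun _ => 1) (integrable_const (1 : ℝ))
  rw [← total, hℓ.integral_pairLaw, integral_prod_symm _ iJ']
  apply integral_eq_zero_of_ae
  filter_upwards [iJ'.swap.prod_right_ae, i0'.swap.prod_right_ae, h, ae_unif_mem]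
    with v j1 j0 hv hvI
  simp only [Function.comp_apply, Prod.swap_prod_mk, Pi.zero_apply, mul_one] at j1 j0 ⊢
  exact integral_score_eq_zero (f := fun u => ℓ u v) (fun u hu => hℓ.pos _ hu _ hvI) hv j0 j1

end IsCopulaDensity

/-! ### Mixing changes of sources are Gaussian -/

namespace IsSquareDiffeo

variable {T S : ℝ × ℝ → ℝ × ℝ}

lemma fderiv_det_ne_zero (d : IsSquareDiffeo T S) {u : ℝ × ℝ} (hu : u ∈ unitSq) :
    (fderiv ℝ S u (1, 0)).1 * (fderiv ℝ S u (0, 1)).2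
      - (fderiv ℝ S u (1, 0)).2 * (fderiv ℝ S u (0, 1)).1 ≠ 0 := by
  intro h0
  set α := (fderiv ℝ S u (1, 0)).1
  set β := (fderiv ℝ S u (1, 0)).2
  set γ := (fderiv ℝ S u (0, 1)).1
  set δ := (fderiv ℝ S u (0, 1)).2
  have key : ∀ s t : ℝ, s * α + t * γ = 0 → s * β + t * δ = 0 → s = 0 ∧ t = 0 := by
    intro s t h1 h2
    by_contra hst
    refine d.symm.fderiv_ne_zero hu (e := (s, t)) (fun h => hst ?_) ?_
    · simpa [Prod.ext_iff] using h
    · have : ((s, t) : ℝ × ℝ) = s • ((1, 0) : ℝ × ℝ) + t • ((0, 1) : ℝ × ℝ) := by simp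
      rw [this, map_add, map_smul, map_smul]
      exact Prod.ext h1 h2
  obtain ⟨hγ, hα⟩ := key γ (-α) (by ring) (by linarith)
  obtain ⟨hδ, hβ⟩ := key δ (-β) (by linarith) (by ring)
  have := key 1 0 (by linarith) (by linarith)
  exact one_ne_zero this.1

/-- Near a point where both first-order derivatives of `S₁` are nonzero, `S₁` takes all the values
of an interval at points with the same property. -/
lemma exists_interval_of_mixing (d : IsSquareDiffeo T S) {u₀ : ℝ × ℝ} (hu₀ : u₀ ∈ unitSq)
    (h₁ : (fderiv ℝ S u₀ (1, 0)).1 ≠ 0) (h₂ : (fderiv ℝ S u₀ (0, 1)).1 ≠ 0) :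
    ∃ a b, a < b ∧ Ioo a b ⊆ unitIoo ∧ ∀ u ∈ Ioo a b, ∃ u' ∈ unitSq, (S u').1 = u ∧
      (fderiv ℝ S u' (1, 0)).1 ≠ 0 ∧ (fderiv ℝ S u' (0, 1)).1 ≠ 0 := by
  obtain ⟨x₀, y₀⟩ := u₀
  have hc := d.symm.contDiffOn_fst
  have hstrict : HasStrictDerivAt (fun x => (S (x, y₀)).1) ((fderiv ℝ S (x₀, y₀) (1, 0)).1) x₀ := by
    have e1 := (hc.contDiffAt (isOpen_unitSq.mem_nhds hu₀)).hasStrictFDerivAt one_ne_zero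
    have e2 : HasStrictDerivAt (fun x : ℝ => (x, y₀)) ((1 : ℝ), (0 : ℝ)) x₀ :=
      (hasStrictDerivAt_id x₀).prodMk (hasStrictDerivAt_const x₀ y₀)
    have e3 := HasStrictFDerivAt.comp_hasStrictDerivAt x₀ (f := fun x : ℝ => (x, y₀)) e1 e2
    rw [d.symm.fderiv_fst_eq hu₀] at e3
    exact e3
  have hG : ∀ᶠ x in 𝓝 x₀, (x, y₀) ∈ unitSq ∧ (fderiv ℝ S (x, y₀) (1, 0)).1 ≠ 0 ∧
      (fderiv ℝ S (x, y₀) (0, 1)).1 ≠ 0 := by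
    have hcont : ContinuousAt (fun x : ℝ => (x, y₀)) x₀ := by fun_prop
    have h3 : ∀ᶠ p in 𝓝 (x₀, y₀), p ∈ unitSq ∧ (fderiv ℝ S p (1, 0)).1 ≠ 0 ∧
        (fderiv ℝ S p (0, 1)).1 ≠ 0 := by
      have k1 := (continuousOn_fderiv_apply hc (1, 0)).continuousAt (isOpen_unitSq.mem_nhds hu₀)
      have k2 := (continuousOn_fderiv_apply hc (0, 1)).continuousAt (isOpen_unitSq.mem_nhds hu₀)
      rw [← d.symm.fderiv_fst_eq hu₀] at h₁ h₂
      filter_upwards [isOpen_unitSq.mem_nhds hu₀, k1.eventually_ne h₁, k2.eventually_ne h₂]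
        with p hp a b
      rw [d.symm.fderiv_fst_eq hp] at a b
      exact ⟨hp, a, b⟩
    exact hcont.eventually h3
  have himg := image_mem_map (m := fun x => (S (x, y₀)).1) hG
  rw [hstrict.map_nhds_eq h₁] at himg
  obtain ⟨a, b, hab, hsub⟩ := mem_nhds_iff_exists_Ioo_subset.1 himg
  refine ⟨a, b, hab.1.trans hab.2, fun u hu => ?_, fun u hu => ?_⟩
  · obtain ⟨x, hx, rfl⟩ := hsub hu
    exact (d.mapsTo_inv hx.1).1
  · obtain ⟨x, hx, rfl⟩ := hsub hu
    exact ⟨(x, y₀), hx.1, rfl, hx.2.1, hx.2.2⟩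

lemma fderiv_comp_swap (d : IsSquareDiffeo T S) {u : ℝ × ℝ} (hu : u ∈ unitSq) (e : ℝ × ℝ) :
    fderiv ℝ (fun v => S v.swap) u.swap e = fderiv ℝ S u e.swap := by
  have h1 := (d.symm.differentiableAt hu).hasFDerivAt
  have h2 : HasFDerivAt (Prod.swap : ℝ × ℝ → ℝ × ℝ)
      (ContinuousLinearEquiv.prodComm ℝ ℝ ℝ : ℝ × ℝ →L[ℝ] ℝ × ℝ) u.swap :=
    (ContinuousLinearEquiv.prodComm ℝ ℝ ℝ).hasFDerivAt
  have h3 := HasFDerivAt.comp u.swap (g := S) (f := Prod.swap) h1 h2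
  have h4 := h3.fderiv
  change fderiv ℝ (S ∘ Prod.swap) u.swap e = _
  rw [h4]
  rfl

/-- If the first old source is a genuine mixture of the two new ones at some point, then the two
sources are Gaussian in suitable coordinates and the change of sources is linear in these
coordinates. -/
theorem exists_gaussian_coordinates_of_mixing (d : IsSquareDiffeo T S) {ℓ₁ ℓ₂ : ℕ → ℝ → ℝ → ℝ}
    (hℓ₁ : ∀ h, 1 ≤ h → IsCopulaDensity (ℓ₁ h)) (hℓ₂ : ∀ h, 1 ≤ h → IsCopulaDensity (ℓ₂ h))
    (hsep : ∀ h, 1 ≤ h → IsSeparableUnder S (ℓ₁ h) (ℓ₂ h))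
    (hns : ∀ u ∈ unitIoo, ¬ ∀ h, 1 ≤ h → ∀ᵐ v ∂unif, score (ℓ₁ h) u v = 0)
    {u₀ : ℝ × ℝ} (hu₀ : u₀ ∈ unitSq)
    (h₁ : (fderiv ℝ S u₀ (1, 0)).1 ≠ 0) (h₂ : (fderiv ℝ S u₀ (0, 1)).1 ≠ 0) :
    ∃ a₁ a₂ b₁ b₂ : ℝ, a₁ ≠ 0 ∧ a₂ ≠ 0 ∧ b₁ ≠ 0 ∧ b₂ ≠ 0 ∧ a₁ * b₂ - a₂ * b₁ ≠ 0 ∧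
      ∃ P Q : ℝ → ℝ, ContinuousOn P unitIoo ∧ ContinuousOn Q unitIoo ∧ ∀ v ∈ unitSq,
        a₁ * gaussQuantile v.1 + a₂ * gaussQuantile v.2 = P (T v).1 ∧
        b₁ * gaussQuantile v.1 + b₂ * gaussQuantile v.2 = Q (T v).2 := by
  obtain ⟨a, b, hab, hsub, hint⟩ := d.exists_interval_of_mixing hu₀ h₁ h₂
  obtain ⟨h, hh, u, hu, hnc⟩ : ∃ h, 1 ≤ h ∧ ∃ u ∈ Ioo a b,
      ¬ ∃ c, ∀ᵐ v ∂unif, score (ℓ₁ h) u v = c := by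
    by_contra hcon
    push Not at hcon
    have hm : (a + b) / 2 ∈ Ioo a b := ⟨by linarith, by linarith⟩
    refine hns _ (hsub hm) fun h hh => ?_
    filter_upwards [(hℓ₁ h hh).score_eq_zero_of_ae_const hsub (hcon h hh)] with v hv using hv _ hm
  obtain ⟨u', hu', rfl, hα, hγ⟩ := hint u hu
  obtain ⟨Ψ₁, hΨ₁, e₁⟩ :=
    (hsep h hh).exists_score_combination_eq_comp_fst d (hℓ₁ h hh) (hℓ₂ h hh) hu'
  obtain ⟨Ψ₂, hΨ₂, e₂⟩ := (hsep h hh).swap_target.exists_score_combination_eq_comp_fst d.swap_left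
    (hℓ₁ h hh) (hℓ₂ h hh) (u' := u'.swap) ⟨hu'.2, hu'.1⟩
  simp only [d.fderiv_comp_swap hu', Prod.swap_swap, Prod.swap_prod_mk, Prod.fst_swap] at e₂
  have hm := d.mapsTo_inv hu'
  refine d.exists_gaussian_coordinates ((hℓ₁ h hh).measurable_score_right hm.1)
    ((hℓ₂ h hh).measurable_score_right hm.2) hΨ₁ hΨ₂ hα hγ (d.fderiv_det_ne_zero hu') e₁ e₂ ?_
  rintro ⟨c, hc⟩
  refine hnc ⟨c, ?_⟩
  filter_upwards [hc, ae_unif_mem] with v hv hvI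
  rwa [indicator_of_mem hvI] at hv

end IsSquareDiffeo

/-! ### Linear mixing of Gaussian coordinates -/

/-- In Gaussian coordinates for the old sources and the coordinates `X⁻¹`, `Y⁻¹` for the new ones,
the change of sources `S` is linear, with a matrix without zero entries. -/
structure IsLinearMixing (S : ℝ × ℝ → ℝ × ℝ) (m₁₁ m₁₂ m₂₁ m₂₂ : ℝ) (X Y : ℝ → ℝ) : Prop where
  ne₁₁ : m₁₁ ≠ 0
  ne₁₂ : m₁₂ ≠ 0
  ne₂₁ : m₂₁ ≠ 0
  ne₂₂ : m₂₂ ≠ 0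
  det : m₁₁ * m₂₂ - m₁₂ * m₂₁ ≠ 0
  mem_fst : ∀ p, X p ∈ unitIoo
  mem_snd : ∀ q, Y q ∈ unitIoo
  apply_eq : ∀ p q, S (X p, Y q) = (gaussCdf (m₁₁ * p + m₁₂ * q), gaussCdf (m₂₁ * p + m₂₂ * q))

lemma IsSquareDiffeo.exists_isLinearMixing {T S : ℝ × ℝ → ℝ × ℝ} (d : IsSquareDiffeo T S)
    {a₁ a₂ b₁ b₂ : ℝ} (ha₁ : a₁ ≠ 0) (ha₂ : a₂ ≠ 0) (hb₁ : b₁ ≠ 0) (hb₂ : b₂ ≠ 0)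
    (hD : a₁ * b₂ - a₂ * b₁ ≠ 0) {P Q : ℝ → ℝ}
    (h : ∀ v ∈ unitSq, a₁ * gaussQuantile v.1 + a₂ * gaussQuantile v.2 = P (T v).1 ∧
        b₁ * gaussQuantile v.1 + b₂ * gaussQuantile v.2 = Q (T v).2) :
    ∃ X Y, IsLinearMixing S b₂ (-a₂) (-b₁) a₁ X Y := by
  set V : ℝ → ℝ → ℝ × ℝ := fun p q => (gaussCdf (b₂ * p + -a₂ * q), gaussCdf (-b₁ * p + a₁ * q))
    with hV
  have hVm : ∀ p q, V p q ∈ unitSq := fun p q => ⟨gaussCdf_mem _, gaussCdf_mem _⟩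
  have hX : ∀ p, (T (V p 0)).1 ∈ unitIoo := fun p => (d.mapsTo (hVm p 0)).1
  have hY : ∀ q, (T (V 0 q)).2 ∈ unitIoo := fun q => (d.mapsTo (hVm 0 q)).2
  refine ⟨fun p => (T (V p 0)).1, fun q => (T (V 0 q)).2, hb₂, neg_ne_zero.2 ha₂, neg_ne_zero.2 hb₁,
    ha₁, ?_, hX, hY, fun p q => ?_⟩
  · convert hD using 1; ring
  · have h1 := (h _ (hVm p 0)).1
    have h2 := (h _ (hVm 0 q)).2
    have hm : ((T (V p 0)).1, (T (V 0 q)).2) ∈ unitSq := ⟨hX p, hY q⟩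
    have hw := d.mapsTo_inv hm
    have h3 := h _ hw
    rw [d.rightInv _ hm] at h3
    obtain ⟨h3, h4⟩ := h3
    simp only at h3 h4
    rw [← h1] at h3
    rw [← h2] at h4
    simp only [hV, gaussQuantile_gaussCdf] at h3 h4
    set w := S ((T (V p 0)).1, (T (V 0 q)).2)
    apply Prod.ext
    · change w.1 = gaussCdf _
      rw [← gaussCdf_gaussQuantile hw.1]
      congr 1
      apply mul_left_cancel₀ hD
      linear_combination b₂ * h3 - a₂ * h4
    · change w.2 = gaussCdf _
      rw [← gaussCdf_gaussQuantile hw.2]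
      congr 1
      apply mul_left_cancel₀ hD
      linear_combination a₁ * h4 - b₁ * h3

/-- The coefficient of `y` in the quadratic polynomial `log ℓ (Φ y) v`. -/
noncomputable def linearCoeff (ℓ : ℝ → ℝ → ℝ) (v : ℝ) : ℝ :=
  (Real.log (ℓ (gaussCdf 1) v) - Real.log (ℓ (gaussCdf (-1)) v)) / 2

/-- Twice the coefficient of `y ^ 2` in the quadratic polynomial `log ℓ (Φ y) v`. -/
noncomputable def quadraticCoeff (ℓ : ℝ → ℝ → ℝ) (v : ℝ) : ℝ :=
  Real.log (ℓ (gaussCdf 1) v) + Real.log (ℓ (gaussCdf (-1)) v) - 2 * Real.log (ℓ (gaussCdf 0) v)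

/-- `log ℓ (Φ y) v` is a quadratic polynomial in `y`. -/
def IsLogQuadraticAt (ℓ : ℝ → ℝ → ℝ) (v : ℝ) : Prop :=
  ∀ y, Real.log (ℓ (gaussCdf y) v) = Real.log (ℓ (gaussCdf 0) v) + linearCoeff ℓ v * y
    + quadraticCoeff ℓ v / 2 * y ^ 2

lemma isLogQuadraticAt_of_exists {ℓ : ℝ → ℝ → ℝ} {v : ℝ}
    (h : ∃ β μ : ℝ, ∀ y, Real.log (ℓ (gaussCdf y) v)
      = Real.log (ℓ (gaussCdf 0) v) + β * y + μ / 2 * y ^ 2) : IsLogQuadraticAt ℓ v := by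
  obtain ⟨β, μ, hy⟩ := h
  intro y
  rw [linearCoeff, quadraticCoeff, hy y, hy 1, hy (-1)]
  ring

namespace IsCopulaDensity

variable {ℓ : ℝ → ℝ → ℝ}

lemma measurable_left (hℓ : IsCopulaDensity ℓ) (u : ℝ) : Measurable fun v => ℓ u v :=
  hℓ.measurable.comp (f := fun v : ℝ => (u, v)) (by fun_prop)

lemma measurable_linearCoeff (hℓ : IsCopulaDensity ℓ) : Measurable (linearCoeff ℓ) :=
  ((hℓ.measurable_left _).log.sub (hℓ.measurable_left _).log).div_const 2

lemma hasDerivAt_log_gaussCdf (hℓ : IsCopulaDensity ℓ) {v : ℝ} (hv : v ∈ unitIoo) (y : ℝ) :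
    HasDerivAt (fun y => Real.log (ℓ (gaussCdf y) v))
      (score ℓ (gaussCdf y) v * gaussDensity y) y :=
  HasDerivAt.comp y (hℓ.hasDerivAt_log (gaussCdf_mem y) hv) (hasDerivAt_gaussCdf y)

/-- At the median, the score of a density that is log-quadratic in Gaussian coordinates is, up to
the factor `φ(0)`, its linear coefficient; if that coefficient is affine in `N(v)`, it is linear. -/
lemma score_half_of_linearCoeff (hℓ : IsCopulaDensity ℓ) (hq : ∀ᵐ v ∂unif, IsLogQuadraticAt ℓ v)
    {μ κ c : ℝ} (hμ : ∀ᵐ v ∂unif, quadraticCoeff ℓ v = μ)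
    (hκ : ∀ᵐ v ∂unif, linearCoeff ℓ v = κ * gaussQuantile v + c) :
    ∀ᵐ v ∂unif, score ℓ (1 / 2) v * gaussDensity 0 = κ * gaussQuantile v := by
  have hc : c = 0 := by
    refine hℓ.linear_coefficient_eq_zero (e := fun v => Real.log (ℓ (gaussCdf 0) v)) (k := κ)
      (μ := μ) ?_
    filter_upwards [hq, hμ, hκ] with v h1 h2 h3 y
    rw [h1 y, h2, h3]
  filter_upwards [hq, hκ, ae_unif_mem] with v h1 h3 hv
  have e1 := hℓ.hasDerivAt_log_gaussCdf hv 0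
  rw [gaussCdf_zero] at e1
  refine e1.unique ?_
  rw [show (fun y => Real.log (ℓ (gaussCdf y) v)) = _ from funext h1]
  have := (((hasDerivAt_id (0 : ℝ)).const_mul (linearCoeff ℓ v)).const_add
    (Real.log (ℓ (gaussCdf 0) v))).add
    (((hasDerivAt_id (0 : ℝ)).pow 2).const_mul (quadraticCoeff ℓ v / 2))
  refine this.congr_deriv ?_
  rw [h3, hc]
  simp

end IsCopulaDensity

namespace IsLinearMixing

variable {T S : ℝ × ℝ → ℝ × ℝ} {m₁₁ m₁₂ m₂₁ m₂₂ : ℝ} {X Y : ℝ → ℝ} {ℓ₁ ℓ₂ : ℝ → ℝ → ℝ}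

lemma swap_source (m : IsLinearMixing S m₁₁ m₁₂ m₂₁ m₂₂ X Y) :
    IsLinearMixing (fun v => (S v).swap) m₂₁ m₂₂ m₁₁ m₁₂ X Y where
  ne₁₁ := m.ne₂₁
  ne₁₂ := m.ne₂₂
  ne₂₁ := m.ne₁₁
  ne₂₂ := m.ne₁₂
  det := fun h => m.det (by linarith)
  mem_fst := m.mem_fst
  mem_snd := m.mem_snd
  apply_eq := fun p q => by rw [m.apply_eq]; rfl

lemma logPairDensity_eq (m : IsLinearMixing S m₁₁ m₁₂ m₂₁ m₂₂ X Y) (p q : ℝ) (v : ℝ × ℝ) :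
    logPairDensity S ℓ₁ ℓ₂ (X p, Y q) v = Real.log (ℓ₁ (gaussCdf (m₁₁ * p + m₁₂ * q)) v.1)
      + Real.log (ℓ₂ (gaussCdf (m₂₁ * p + m₂₂ * q)) v.2) := by
  rw [logPairDensity, m.apply_eq]

lemma isLogQuadraticAt_fst (m : IsLinearMixing S m₁₁ m₁₂ m₂₁ m₂₂ X Y) (d : IsSquareDiffeo T S)
    (hℓ₁ : IsCopulaDensity ℓ₁) (hℓ₂ : IsCopulaDensity ℓ₂) (h : IsSeparableUnder S ℓ₁ ℓ₂) :
    ∀ᵐ v ∂unif, IsLogQuadraticAt ℓ₁ v := by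
  filter_upwards [Measure.ae_ae_of_ae_prod (h.cross_difference d hℓ₁ hℓ₂), ae_unif_mem]
    with v hv hvI
  obtain ⟨w, hw, hwI⟩ := (hv.and ae_unif_mem).exists
  apply isLogQuadraticAt_of_exists
  refine exists_quadratic_of_cross_difference (f := fun y => Real.log (ℓ₁ (gaussCdf y) v))
    (k := fun y => Real.log (ℓ₂ (gaussCdf y) w))
    (fun y => (hℓ₁.hasDerivAt_log_gaussCdf hvI y).differentiableAt)
    (fun y => (hℓ₂.hasDerivAt_log_gaussCdf hwI y).differentiableAt) m.ne₁₁ m.ne₁₂ m.det ?_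
  intro p p' q q'
  have := hw _ (m.mem_fst p) _ (m.mem_fst p') _ (m.mem_snd q) _ (m.mem_snd q')
  simpa only [m.logPairDensity_eq] using this

lemma isLogQuadraticAt_snd (m : IsLinearMixing S m₁₁ m₁₂ m₂₁ m₂₂ X Y) (d : IsSquareDiffeo T S)
    (hℓ₁ : IsCopulaDensity ℓ₁) (hℓ₂ : IsCopulaDensity ℓ₂) (h : IsSeparableUnder S ℓ₁ ℓ₂) :
    ∀ᵐ v ∂unif, IsLogQuadraticAt ℓ₂ v :=
  m.swap_source.isLogQuadraticAt_fst d.swap_right hℓ₂ hℓ₁ h.swap_source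

lemma ae_isLogQuadraticAt (m : IsLinearMixing S m₁₁ m₁₂ m₂₁ m₂₂ X Y) (d : IsSquareDiffeo T S)
    (hℓ₁ : IsCopulaDensity ℓ₁) (hℓ₂ : IsCopulaDensity ℓ₂) (h : IsSeparableUnder S ℓ₁ ℓ₂) :
    ∀ᵐ v ∂(unif.prod unif), IsLogQuadraticAt ℓ₁ v.1 ∧ IsLogQuadraticAt ℓ₂ v.2 := by
  filter_upwards [Measure.quasiMeasurePreserving_fst (μ := unif) (ν := unif) |>.ae
      (m.isLogQuadraticAt_fst d hℓ₁ hℓ₂ h),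
    Measure.quasiMeasurePreserving_snd (μ := unif) (ν := unif) |>.ae
      (m.isLogQuadraticAt_snd d hℓ₁ hℓ₂ h)] with v h1 h2 using ⟨h1, h2⟩

/-- The quadratic coefficients do not depend on the conditioning value. -/
lemma exists_quadraticCoeff_eq (m : IsLinearMixing S m₁₁ m₁₂ m₂₁ m₂₂ X Y) (d : IsSquareDiffeo T S)
    (hℓ₁ : IsCopulaDensity ℓ₁) (hℓ₂ : IsCopulaDensity ℓ₂) (h : IsSeparableUnder S ℓ₁ ℓ₂) :
    ∃ μ, ∀ᵐ v ∂unif, quadraticCoeff ℓ₁ v = μ := by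
  have key : ∀ᵐ v ∂(unif.prod unif),
      m₁₁ * m₁₂ * quadraticCoeff ℓ₁ v.1 + m₂₁ * m₂₂ * quadraticCoeff ℓ₂ v.2 = 0 := by
    filter_upwards [h.cross_difference d hℓ₁ hℓ₂, m.ae_isLogQuadraticAt d hℓ₁ hℓ₂ h]
      with v hv ⟨h1, h2⟩
    have := hv _ (m.mem_fst 1) _ (m.mem_fst 0) _ (m.mem_snd 1) _ (m.mem_snd 0)
    simp only [m.logPairDensity_eq] at this
    rw [h1, h2, h1 (m₁₁ * 1 + m₁₂ * 0), h2 (m₂₁ * 1 + m₂₂ * 0), h1 (m₁₁ * 0 + m₁₂ * 1),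
      h2 (m₂₁ * 0 + m₂₂ * 1), h1 (m₁₁ * 0 + m₁₂ * 0), h2 (m₂₁ * 0 + m₂₂ * 0)] at this
    linear_combination this
  obtain ⟨w, hw⟩ := (Measure.ae_ae_of_ae_prod (IsSquareDiffeo.ae_swap key)).exists
  refine ⟨-(m₂₁ * m₂₂ * quadraticCoeff ℓ₂ w) / (m₁₁ * m₁₂), ?_⟩
  filter_upwards [hw] with v hv
  simp only [Prod.swap_prod_mk] at hv
  rw [eq_div_iff (mul_ne_zero m.ne₁₁ m.ne₁₂)]
  linarith

/-- The scores at the median are proportional to the Gaussian coordinate, with a ratio that is the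
same for all densities separable under `S`. -/
theorem score_half_combination_eq_zero (m : IsLinearMixing S m₁₁ m₁₂ m₂₁ m₂₂ X Y)
    (d : IsSquareDiffeo T S)
    (hℓ₁ : IsCopulaDensity ℓ₁) (hℓ₂ : IsCopulaDensity ℓ₂) (h : IsSeparableUnder S ℓ₁ ℓ₂) :
    ∀ᵐ v ∂unif, m₁₁ * m₁₂ * score ℓ₁ (1 / 2) v + m₂₁ * m₂₂ * score ℓ₂ (1 / 2) v = 0 := by
  obtain ⟨μ₁, hμ₁⟩ := m.exists_quadraticCoeff_eq d hℓ₁ hℓ₂ h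
  obtain ⟨μ₂, hμ₂⟩ := m.swap_source.exists_quadraticCoeff_eq d.swap_right hℓ₂ hℓ₁ h.swap_source
  have hq₁ := m.isLogQuadraticAt_fst d hℓ₁ hℓ₂ h
  have hq₂ := m.isLogQuadraticAt_snd d hℓ₁ hℓ₂ h
  obtain ⟨Ψ₁, hΨ₁, e₁⟩ :=
    h.exists_increment_eq_comp_fst d hℓ₁ hℓ₂ (m.mem_fst 1) (m.mem_fst 0) (m.mem_snd 0)
  obtain ⟨Ψ₂, hΨ₂, e₂⟩ := h.swap_target.exists_increment_eq_comp_fst d.swap_left hℓ₁ hℓ₂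
    (m.mem_snd 1) (m.mem_snd 0) (m.mem_fst 0)
  have q₁ := Measure.quasiMeasurePreserving_fst (μ := unif) (ν := unif) |>.ae hμ₁
  have q₂ := Measure.quasiMeasurePreserving_snd (μ := unif) (ν := unif) |>.ae hμ₂
  have r₁ : ∀ᵐ v ∂(unif.prod unif), m₁₁ * linearCoeff ℓ₁ v.1 + m₂₁ * linearCoeff ℓ₂ v.2
      = Ψ₁ (T v).1 - (μ₁ / 2 * m₁₁ ^ 2 + μ₂ / 2 * m₂₁ ^ 2) := by
    filter_upwards [e₁, m.ae_isLogQuadraticAt d hℓ₁ hℓ₂ h, q₁, q₂] with v e ⟨h1, h2⟩ e1 e2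
    simp only [m.logPairDensity_eq] at e
    rw [← e, h1, h2, h1 (m₁₁ * 0 + m₁₂ * 0), h2 (m₂₁ * 0 + m₂₂ * 0), e1, e2]
    ring
  have r₂ : ∀ᵐ v ∂(unif.prod unif), m₁₂ * linearCoeff ℓ₁ v.1 + m₂₂ * linearCoeff ℓ₂ v.2
      = Ψ₂ (T v).2 - (μ₁ / 2 * m₁₂ ^ 2 + μ₂ / 2 * m₂₂ ^ 2) := by
    filter_upwards [e₂, m.ae_isLogQuadraticAt d hℓ₁ hℓ₂ h, q₁, q₂] with v e ⟨h1, h2⟩ e1 e2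
    change logPairDensity S ℓ₁ ℓ₂ (X 0, Y 1) v - logPairDensity S ℓ₁ ℓ₂ (X 0, Y 0) v
      = Ψ₂ (T v).2 at e
    simp only [m.logPairDensity_eq] at e
    rw [← e, h1, h2, h1 (m₁₁ * 0 + m₁₂ * 0), h2 (m₂₁ * 0 + m₂₂ * 0), e1, e2]
    ring
  obtain ⟨b₁, b₂, ψ₁, ψ₂, hb₁, hb₂, -, -, he₁, he₂, heq⟩ := d.exists_continuous_versions
    hℓ₁.measurable_linearCoeff hℓ₂.measurable_linearCoeff (hΨ₁.sub_const _) (hΨ₂.sub_const _)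
    m.ne₁₁ m.ne₂₁ m.ne₁₂ m.ne₂₂ r₁ r₂
  have hform : ∀ p q, m₁₁ * b₁ (gaussCdf (m₁₁ * p + m₁₂ * q))
        + m₂₁ * b₂ (gaussCdf (m₂₁ * p + m₂₂ * q)) = ψ₁ (X p) ∧
      m₁₂ * b₁ (gaussCdf (m₁₁ * p + m₁₂ * q))
        + m₂₂ * b₂ (gaussCdf (m₂₁ * p + m₂₂ * q)) = ψ₂ (Y q) := by
    intro p q
    have hm : (X p, Y q) ∈ unitSq := ⟨m.mem_fst p, m.mem_snd q⟩
    have h1 := heq _ (d.mapsTo_inv hm)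
    rw [d.rightInv _ hm, m.apply_eq] at h1
    exact h1
  have hc₁ : Continuous fun y => b₁ (gaussCdf y) :=
    hb₁.comp_continuous continuous_gaussCdf gaussCdf_mem
  have hc₂ : Continuous fun y => b₂ (gaussCdf y) :=
    hb₂.comp_continuous continuous_gaussCdf gaussCdf_mem
  obtain ⟨κ₁, hκ₁⟩ := eq_affine_of_map_add_add hc₁.measurable
    (map_add_add_of_combinations (f := fun y => b₁ (gaussCdf y)) (k := fun y => b₂ (gaussCdf y))
      m.ne₁₁ m.ne₁₂ m.det
      (fun p q q' => by rw [(hform p q).1, (hform p q').1])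
      (fun p p' q => by rw [(hform p q).2, (hform p' q).2]))
  obtain ⟨κ₂, hκ₂⟩ := eq_affine_of_map_add_add hc₂.measurable
    (map_add_add_of_combinations (f := fun y => b₂ (gaussCdf y)) (k := fun y => b₁ (gaussCdf y))
      m.ne₂₁ m.ne₂₂
      m.swap_source.det
      (fun p q q' => by rw [add_comm, (hform p q).1, add_comm, (hform p q').1])
      (fun p p' q => by rw [add_comm, (hform p q).2, add_comm, (hform p' q).2]))
  have hrel : m₁₁ * m₁₂ * κ₁ + m₂₁ * m₂₂ * κ₂ = 0 := by
    have h1 := (hform 0 1).1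
    rw [← (hform 0 0).1, hκ₁, hκ₂, hκ₁ (m₁₁ * 0 + m₁₂ * 0), hκ₂ (m₂₁ * 0 + m₂₂ * 0)] at h1
    linear_combination h1
  have s₁ := hℓ₁.score_half_of_linearCoeff hq₁ hμ₁ (κ := κ₁) (c := b₁ (gaussCdf 0)) (by
    filter_upwards [he₁, ae_unif_mem] with v hv hvI
    rw [hv, add_comm, ← hκ₁, gaussCdf_gaussQuantile hvI])
  have s₂ := hℓ₂.score_half_of_linearCoeff hq₂ hμ₂ (κ := κ₂) (c := b₂ (gaussCdf 0)) (by
    filter_upwards [he₂, ae_unif_mem] with v hv hvI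
    rw [hv, add_comm, ← hκ₂, gaussCdf_gaussQuantile hvI])
  filter_upwards [s₁, s₂] with v h1 h2
  apply mul_right_cancel₀ (gaussDensity_pos 0).ne'
  linear_combination m₁₁ * m₁₂ * h1 + m₂₁ * m₂₂ * h2 + gaussQuantile v * hrel

end IsLinearMixing

/-! ### Changes of sources without mixing -/

lemma marginMap_marginMap (s : ℤˣ) (u : ℝ) : marginMap s (marginMap s u) = u := by
  unfold marginMap; split_ifs <;> ring

lemma marginMap_mem (s : ℤˣ) {u : ℝ} (hu : u ∈ unitIoo) : marginMap s u ∈ unitIoo := by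
  unfold marginMap
  split_ifs
  · exact hu
  · exact ⟨by linarith [hu.2], by linarith [hu.1]⟩

/-- A continuous injective map of the unit interval that preserves the uniform law is the identity
or the reflection. -/
lemma exists_eq_marginMap {τ : ℝ → ℝ} (hc : ContinuousOn τ unitIoo) (hinj : InjOn τ unitIoo)
    (hmaps : MapsTo τ unitIoo unitIoo) (hlaw : HasLaw τ unif unif) :
    ∃ s : ℤˣ, ∀ x ∈ unitIoo, τ x = marginMap s x := by
  have hpre : ∀ t : Set ℝ, MeasurableSet t → unif (τ ⁻¹' t) = unif t := fun t ht => by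
    rw [← Measure.map_apply_of_aemeasurable hlaw.aemeasurable ht, hlaw.map_eq]
  have hI : ∀ {t t' : Set ℝ}, (∀ v ∈ unitIoo, v ∈ t ↔ v ∈ t') → unif t = unif t' := by
    intro t t' h
    apply measure_congr
    filter_upwards [ae_unif_mem] with v hv
    exact propext (h v hv)
  rcases hc.strictMonoOn_of_injOn_Ioo zero_lt_one hinj with hm | hm
  · refine ⟨1, fun x hx => ?_⟩
    have h1 : unif (Iic x) = unif (Iic (τ x)) := by
      rw [← hpre (Iic (τ x)) measurableSet_Iic]
      exact hI fun v hv => (hm.le_iff_le hv hx).symm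
    rw [unif_Iic hx, unif_Iic (hmaps hx),
      ENNReal.ofReal_eq_ofReal_iff hx.1.le (hmaps hx).1.le] at h1
    rw [marginMap, if_pos rfl, ← h1]
  · refine ⟨-1, fun x hx => ?_⟩
    have h1 : unif (Iic x) = unif (Ici (τ x)) := by
      rw [← hpre (Ici (τ x)) measurableSet_Ici]
      exact hI fun v hv => (hm.le_iff_ge hx hv).symm
    rw [unif_Iic hx, unif_Ici (hmaps hx), ENNReal.ofReal_eq_ofReal_iff hx.1.le
      (by linarith [(hmaps hx).2])] at h1
    rw [marginMap, if_neg (by decide)]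
    linarith

/-- If a measure-preserving map has a component that is almost everywhere a function `τ` of one
coordinate, then `τ` preserves the uniform law. -/
lemma hasLaw_unif_of_ae_eq {τ : ℝ → ℝ} (hτ : Measurable τ) {f π : ℝ × ℝ → ℝ}
    (hf : MeasurePreserving f (unif.prod unif) unif)
    (hπ : MeasurePreserving π (unif.prod unif) unif)
    (h : ∀ᵐ v ∂(unif.prod unif), τ (π v) = f v) : HasLaw τ unif unif := by
  refine ⟨hτ.aemeasurable, ?_⟩
  conv_lhs => rw [← hπ.map_eq]
  rw [Measure.map_map hτ hπ.measurable]
  exact (Measure.map_congr h).trans hf.map_eq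

namespace IsSquareDiffeo

variable {T S : ℝ × ℝ → ℝ × ℝ}

/-- A diffeomorphism of the square with diagonal derivative acts separately on the coordinates. -/
lemma exists_marginMap_of_diagonal (d : IsSquareDiffeo T S)
    (h₁ : ∀ v ∈ unitSq, (fderiv ℝ T v (0, 1)).1 = 0)
    (h₂ : ∀ v ∈ unitSq, (fderiv ℝ T v (1, 0)).2 = 0) :
    ∃ s₁ s₂ : ℤˣ, ∀ v ∈ unitSq, T v = (marginMap s₁ v.1, marginMap s₂ v.2) := by
  have c₁ : ∀ x ∈ unitIoo, ∀ y ∈ unitIoo, (T (x, y)).1 = (T (x, 1 / 2)).1 := by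
    intro x hx y hy
    have hd : ∀ y ∈ unitIoo, HasDerivAt (fun y => (T (x, y)).1) 0 y := fun y hy => by
      have := hasDerivAt_slice_snd d.contDiffOn_fst (v := x) (w := y) ⟨hx, hy⟩
      rwa [d.fderiv_fst_eq (v := (x, y)) ⟨hx, hy⟩, h₁ (x, y) ⟨hx, hy⟩] at this
    exact isOpen_unitIoo.is_const_of_deriv_eq_zero isPreconnected_Ioo
      (fun y hy => (hd y hy).differentiableAt.differentiableWithinAt)
      (fun y hy => (hd y hy).deriv) hy half_mem_unitIoo
  have c₂ : ∀ x ∈ unitIoo, ∀ y ∈ unitIoo, (T (x, y)).2 = (T (1 / 2, y)).2 := by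
    intro x hx y hy
    have hd : ∀ x ∈ unitIoo, HasDerivAt (fun x => (T (x, y)).2) 0 x := fun x hx => by
      have := hasDerivAt_slice_fst d.contDiffOn_snd (v := x) (w := y) ⟨hx, hy⟩
      rwa [d.fderiv_snd_eq (v := (x, y)) ⟨hx, hy⟩, h₂ (x, y) ⟨hx, hy⟩] at this
    exact isOpen_unitIoo.is_const_of_deriv_eq_zero isPreconnected_Ioo
      (fun y hy => (hd y hy).differentiableAt.differentiableWithinAt)
      (fun y hy => (hd y hy).deriv) hx half_mem_unitIoo
  have hh := half_mem_unitIoo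
  have m₁ : MapsTo (fun x => (T (x, 1 / 2)).1) unitIoo unitIoo := fun x hx =>
    (d.mapsTo (x := (x, 1 / 2)) ⟨hx, hh⟩).1
  have m₂ : MapsTo (fun y => (T (1 / 2, y)).2) unitIoo unitIoo := fun y hy =>
    (d.mapsTo (x := (1 / 2, y)) ⟨hh, hy⟩).2
  have l₁ : HasLaw (fun x => (T (x, 1 / 2)).1) unif unif :=
    hasLaw_unif_of_ae_eq (d.measurable.comp (by fun_prop)).fst
      (measurePreserving_fst.comp d.measurePreserving) measurePreserving_fst (by
        filter_upwards [ae_mem] with v hv using (c₁ v.1 hv.1 v.2 hv.2).symm)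
  have l₂ : HasLaw (fun y => (T (1 / 2, y)).2) unif unif :=
    hasLaw_unif_of_ae_eq (d.measurable.comp (by fun_prop)).snd
      (measurePreserving_snd.comp d.measurePreserving) measurePreserving_snd (by
        filter_upwards [ae_mem] with v hv using (c₂ v.1 hv.1 v.2 hv.2).symm)
  obtain ⟨s₁, hs₁⟩ := exists_eq_marginMap (fun x hx =>
      (hasDerivAt_slice_fst d.contDiffOn_fst ⟨hx, hh⟩).continuousAt.continuousWithinAt)
    (fun x hx y hy hxy => by
      have e : T (x, 1 / 2) = T (y, 1 / 2) := Prod.ext hxy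
        ((c₂ x hx _ hh).trans (c₂ y hy _ hh).symm)
      have := congrArg (fun p => (S p).1) e
      simpa only [d.leftInv (x, 1 / 2) ⟨hx, hh⟩, d.leftInv (y, 1 / 2) ⟨hy, hh⟩] using this) m₁ l₁
  obtain ⟨s₂, hs₂⟩ := exists_eq_marginMap (fun y hy =>
      (hasDerivAt_slice_snd d.contDiffOn_snd ⟨hh, hy⟩).continuousAt.continuousWithinAt)
    (fun x hx y hy hxy => by
      have e : T (1 / 2, x) = T (1 / 2, y) := Prod.ext
        ((c₁ _ hh x hx).trans (c₁ _ hh y hy).symm) hxy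
      have := congrArg (fun p => (S p).2) e
      simpa only [d.leftInv (1 / 2, x) ⟨hh, hx⟩, d.leftInv (1 / 2, y) ⟨hh, hy⟩] using this) m₂ l₂
  refine ⟨s₁, s₂, fun v hv => Prod.ext ?_ ?_⟩
  · exact (c₁ v.1 hv.1 v.2 hv.2).trans (hs₁ _ hv.1)
  · exact (c₂ v.1 hv.1 v.2 hv.2).trans (hs₂ _ hv.2)

/-- If at every point each component of `T` depends, to first order, on one coordinate only, then
`T` is a permutation of the coordinates combined with reflections: by connectedness of the square
the permutation is the same at all points. -/
lemma exists_marginMap_of_not_mixing (d : IsSquareDiffeo T S)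
    (h₁ : ∀ v ∈ unitSq, (fderiv ℝ T v (1, 0)).1 = 0 ∨ (fderiv ℝ T v (0, 1)).1 = 0)
    (h₂ : ∀ v ∈ unitSq, (fderiv ℝ T v (1, 0)).2 = 0 ∨ (fderiv ℝ T v (0, 1)).2 = 0) :
    (∃ s₁ s₂ : ℤˣ, ∀ v ∈ unitSq, T v = (marginMap s₁ v.1, marginMap s₂ v.2)) ∨
      ∃ s₁ s₂ : ℤˣ, ∀ v ∈ unitSq, T v = (marginMap s₁ v.2, marginMap s₂ v.1) := by
  have hdet := fun v hv => d.symm.fderiv_det_ne_zero (u := v) hv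
  have ho : ∀ e : ℝ × ℝ, IsOpen (unitSq ∩ (fun v => (fderiv ℝ T v e).1) ⁻¹' {0}ᶜ) := by
    intro e
    have hcont : ContinuousOn (fun v => (fderiv ℝ T v e).1) unitSq :=
      (continuousOn_fderiv_apply d.contDiffOn_fst e).congr fun v hv => (d.fderiv_fst_eq hv e).symm
    exact hcont.isOpen_inter_preimage isOpen_unitSq isOpen_compl_singleton
  have hconn : IsPreconnected unitSq := isPreconnected_Ioo.prod isPreconnected_Ioo
  rcases isPreconnected_iff_subset_of_disjoint.1 hconn _ _ (ho (1, 0)) (ho (0, 1))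
    (fun v hv => by
      by_contra hcon
      simp only [mem_union, mem_inter_iff, hv, mem_preimage, mem_compl_iff, mem_singleton_iff,
        true_and, not_or, not_not] at hcon
      apply hdet v hv
      rw [hcon.1, hcon.2]; ring)
    (by
      ext v
      simp only [mem_inter_iff, mem_preimage, mem_compl_iff, mem_singleton_iff, mem_empty_iff_false,
        iff_false]
      rintro ⟨hv, ⟨-, a⟩, -, b⟩
      exact (h₁ v hv).elim a b) with h | h
  · left
    have k₁ : ∀ v ∈ unitSq, (fderiv ℝ T v (0, 1)).1 = 0 := fun v hv =>
      (h₁ v hv).resolve_left (h hv).2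
    refine d.exists_marginMap_of_diagonal k₁ fun v hv => (h₂ v hv).resolve_right fun h0 => ?_
    apply hdet v hv
    rw [k₁ v hv, h0]; ring
  · right
    have k₁ : ∀ v ∈ unitSq, (fderiv ℝ T v (1, 0)).1 = 0 := fun v hv =>
      (h₁ v hv).resolve_right (h hv).2
    have k₂ : ∀ v ∈ unitSq, (fderiv ℝ T v (0, 1)).2 = 0 := fun v hv =>
      (h₂ v hv).resolve_left fun h0 => by
        apply hdet v hv
        rw [k₁ v hv, h0]; ring
    obtain ⟨s₁, s₂, hs⟩ := d.swap_right.exists_marginMap_of_diagonal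
      (fun v hv => by
        have hv' : v.swap ∈ unitSq := ⟨hv.2, hv.1⟩
        have := d.symm.fderiv_comp_swap hv' (0, 1)
        rw [Prod.swap_swap] at this
        rw [this]; exact k₁ _ hv')
      (fun v hv => by
        have hv' : v.swap ∈ unitSq := ⟨hv.2, hv.1⟩
        have := d.symm.fderiv_comp_swap hv' (1, 0)
        rw [Prod.swap_swap] at this
        rw [this]; exact k₂ _ hv')
    exact ⟨s₁, s₂, fun v hv => hs v.swap ⟨hv.2, hv.1⟩⟩

/-- If the scores of the two sources are linearly independent and the sources obtained
through the inverse of `S` are independent, then the first component of `S` depends, to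
first order, on one coordinate only. -/
lemma fderiv_fst_eq_zero_or (d : IsSquareDiffeo T S) {ℓ₁ ℓ₂ : ℕ → ℝ → ℝ → ℝ}
    (hℓ₁ : ∀ h, 1 ≤ h → IsCopulaDensity (ℓ₁ h)) (hℓ₂ : ∀ h, 1 ≤ h → IsCopulaDensity (ℓ₂ h))
    (hsep : ∀ h, 1 ≤ h → IsSeparableUnder S (ℓ₁ h) (ℓ₂ h))
    (hind : ∀ u ∈ unitIoo, ∀ a b : ℝ, (∀ h, 1 ≤ h → ∀ᵐ v ∂unif,
      a * score (ℓ₁ h) u v + b * score (ℓ₂ h) u v = 0) → a = 0 ∧ b = 0)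
    {u : ℝ × ℝ} (hu : u ∈ unitSq) :
    (fderiv ℝ S u (1, 0)).1 = 0 ∨ (fderiv ℝ S u (0, 1)).1 = 0 := by
  by_contra hcon
  push Not at hcon
  obtain ⟨a₁, a₂, b₁, b₂, ha₁, ha₂, hb₁, hb₂, hD, P, Q, -, -, hPQ⟩ :=
    d.exists_gaussian_coordinates_of_mixing hℓ₁ hℓ₂ hsep (fun w hw h0 => by
      refine one_ne_zero (hind w hw 1 0 fun h hh => ?_).1
      filter_upwards [h0 h hh] with v hv
      rw [hv]; ring) hu hcon.1 hcon.2
  obtain ⟨X, Y, m⟩ := d.exists_isLinearMixing ha₁ ha₂ hb₁ hb₂ hD hPQ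
  have := hind _ half_mem_unitIoo _ _ fun h hh =>
    m.score_half_combination_eq_zero d (hℓ₁ h hh) (hℓ₂ h hh) (hsep h hh)
  exact mul_ne_zero m.ne₁₁ m.ne₁₂ this.1

lemma fderiv_swap_apply (d : IsSquareDiffeo T S) {v : ℝ × ℝ} (hv : v ∈ unitSq) (e : ℝ × ℝ) :
    fderiv ℝ (fun v => (T v).swap) v e = (fderiv ℝ T v e).swap := by
  have h3 := HasFDerivAt.comp v (g := Prod.swap)
    (ContinuousLinearEquiv.prodComm ℝ ℝ ℝ).hasFDerivAt (d.differentiableAt hv).hasFDerivAt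
  have h4 := h3.fderiv
  change fderiv ℝ (Prod.swap ∘ T) v e = _
  exact congrArg (fun L => L e) h4

/-- Under linear independence of the scores, a change of sources that preserves independence is a
permutation of the sources combined with reflections. -/
theorem eq_marginMap_of_separable (d : IsSquareDiffeo T S) {ℓ₁ ℓ₂ : ℕ → ℝ → ℝ → ℝ}
    (hℓ₁ : ∀ h, 1 ≤ h → IsCopulaDensity (ℓ₁ h)) (hℓ₂ : ∀ h, 1 ≤ h → IsCopulaDensity (ℓ₂ h))
    (hsep : ∀ h, 1 ≤ h → IsSeparableUnder S (ℓ₁ h) (ℓ₂ h))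
    (hind : ∀ u ∈ unitIoo, ∀ a b : ℝ, (∀ h, 1 ≤ h → ∀ᵐ v ∂unif,
      a * score (ℓ₁ h) u v + b * score (ℓ₂ h) u v = 0) → a = 0 ∧ b = 0) :
    (∃ s₁ s₂ : ℤˣ, ∀ v ∈ unitSq, T v = (marginMap s₁ v.1, marginMap s₂ v.2)) ∨
      ∃ s₁ s₂ : ℤˣ, ∀ v ∈ unitSq, T v = (marginMap s₁ v.2, marginMap s₂ v.1) := by
  have h₁ := fun u (hu : u ∈ unitSq) => d.fderiv_fst_eq_zero_or hℓ₁ hℓ₂ hsep hind hu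
  have h₂ : ∀ u ∈ unitSq, (fderiv ℝ S u (1, 0)).2 = 0 ∨ (fderiv ℝ S u (0, 1)).2 = 0 := by
    intro u hu
    have := d.swap_right.fderiv_fst_eq_zero_or hℓ₂ hℓ₁ (fun h hh => (hsep h hh).swap_source)
      (fun u hu a b hab => (hind u hu b a fun h hh => by
        filter_upwards [hab h hh] with v hv; rw [add_comm]; exact hv).symm) hu
    rwa [d.symm.fderiv_swap_apply hu, d.symm.fderiv_swap_apply hu] at this
  rcases d.symm.exists_marginMap_of_not_mixing h₁ h₂ with ⟨s₁, s₂, hs⟩ | ⟨s₁, s₂, hs⟩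
  · refine Or.inl ⟨s₁, s₂, fun v hv => ?_⟩
    have := hs _ (d.mapsTo hv)
    rw [d.leftInv v hv] at this
    refine Prod.ext ?_ ?_
    · rw [congrArg Prod.fst this, marginMap_marginMap]
    · rw [congrArg Prod.snd this, marginMap_marginMap]
  · refine Or.inr ⟨s₂, s₁, fun v hv => ?_⟩
    have := hs _ (d.mapsTo hv)
    rw [d.leftInv v hv] at this
    refine Prod.ext ?_ ?_
    · rw [congrArg Prod.snd this, marginMap_marginMap]
    · rw [congrArg Prod.fst this, marginMap_marginMap]

end IsSquareDiffeo

/-! ### Densities and independent pairs -/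

section densities

variable {α β γ δ : Type*} [MeasurableSpace α] [MeasurableSpace β] [MeasurableSpace γ]
  [MeasurableSpace δ]

/-- Exchange of the two middle entries of a quadruple. -/
def midSwap (p : (α × β) × (γ × δ)) : (α × γ) × (β × δ) := ((p.1.1, p.2.1), (p.1.2, p.2.2))

lemma measurable_midSwap : Measurable (midSwap : (α × β) × (γ × δ) → (α × γ) × (β × δ)) := by
  unfold midSwap; fun_prop

lemma measurePreserving_midSwap (μ : Measure α) (ν : Measure β) (μ' : Measure γ) (ν' : Measure δ)
    [SFinite μ] [SFinite ν] [SFinite μ'] [SFinite ν'] :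
    MeasurePreserving midSwap ((μ.prod ν).prod (μ'.prod ν')) ((μ.prod μ').prod (ν.prod ν')) := by
  refine ⟨measurable_midSwap, Measure.ext_of_lintegral _ fun f hf => ?_⟩
  have hfs : Measurable fun p : (α × β) × (γ × δ) => f (midSwap p) := hf.comp measurable_midSwap
  rw [lintegral_map hf measurable_midSwap, lintegral_prod _ hfs.aemeasurable,
    lintegral_prod _ hf.aemeasurable, lintegral_prod _ hfs.lintegral_prod_right'.aemeasurable,
    lintegral_prod _ hf.lintegral_prod_right'.aemeasurable]
  refine lintegral_congr fun a => ?_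
  have hm : Measurable fun q : (β × γ) × δ => f ((a, q.1.2), (q.1.1, q.2)) :=
    hf.comp (by fun_prop)
  calc ∫⁻ b, ∫⁻ q, f (midSwap ((a, b), q)) ∂(μ'.prod ν') ∂ν
      = ∫⁻ b, ∫⁻ c, ∫⁻ e, f ((a, c), (b, e)) ∂ν' ∂μ' ∂ν := by
        refine lintegral_congr fun b => lintegral_prod _ ?_
        exact (hf.comp (measurable_midSwap.comp (by fun_prop))).aemeasurable
    _ = ∫⁻ c, ∫⁻ b, ∫⁻ e, f ((a, c), (b, e)) ∂ν' ∂ν ∂μ' :=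
        lintegral_lintegral_swap hm.lintegral_prod_right'.aemeasurable
    _ = ∫⁻ c, ∫⁻ q, f ((a, c), q) ∂(ν.prod ν') ∂μ' := by
        refine lintegral_congr fun c => ?_
        have hc : Measurable fun q : β × δ => f ((a, c), q) := hf.comp (by fun_prop)
        rw [lintegral_prod _ hc.aemeasurable]

lemma map_fst_withDensity_prod (μ : Measure α) (ν : Measure β) [SFinite μ] [SFinite ν]
    {f : α × β → ℝ≥0∞} (hf : Measurable f) :
    ((μ.prod ν).withDensity f).map Prod.fst = μ.withDensity fun x => ∫⁻ y, f (x, y) ∂ν := by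
  refine Measure.ext_of_lintegral _ fun a ha => ?_
  rw [lintegral_map ha measurable_fst, lintegral_withDensity_eq_lintegral_mul _ hf (by fun_prop),
    lintegral_withDensity_eq_lintegral_mul _ hf.lintegral_prod_right' ha,
    lintegral_prod _ (hf.mul (by fun_prop)).aemeasurable]
  refine lintegral_congr fun x => ?_
  have hfx : Measurable fun y => f (x, y) := hf.comp (by fun_prop)
  simp only [Pi.mul_apply]
  rw [lintegral_mul_const _ hfx]

lemma map_snd_withDensity_prod (μ : Measure α) (ν : Measure β) [SFinite μ] [SFinite ν]
    {f : α × β → ℝ≥0∞} (hf : Measurable f) :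
    ((μ.prod ν).withDensity f).map Prod.snd = ν.withDensity fun y => ∫⁻ x, f (x, y) ∂μ := by
  refine Measure.ext_of_lintegral _ fun a ha => ?_
  rw [lintegral_map ha measurable_snd, lintegral_withDensity_eq_lintegral_mul _ hf (by fun_prop),
    lintegral_withDensity_eq_lintegral_mul _ hf.lintegral_prod_left' ha,
    lintegral_prod_symm _ (hf.mul (by fun_prop)).aemeasurable]
  refine lintegral_congr fun y => ?_
  have hfy : Measurable fun x => f (x, y) := hf.comp (by fun_prop)
  simp only [Pi.mul_apply]
  rw [lintegral_mul_const _ hfy]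

lemma map_withDensity_of_leftInverse {μ : Measure α} {ν : Measure β} {R : α → β} {R' : β → α}
    (hR : MeasurePreserving R μ ν) (hR' : Measurable R') (hinv : ∀ᵐ p ∂μ, R' (R p) = p)
    {f : α → ℝ≥0∞} (hf : Measurable f) :
    (μ.withDensity f).map R = ν.withDensity (fun q => f (R' q)) := by
  refine Measure.ext_of_lintegral _ fun a ha => ?_
  have haR : Measurable fun p => a (R p) := ha.comp hR.measurable
  have hfR : Measurable fun q => f (R' q) := hf.comp hR'
  rw [lintegral_map ha hR.measurable, lintegral_withDensity_eq_lintegral_mul _ hf haR,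
    lintegral_withDensity_eq_lintegral_mul _ hfR ha, ← hR.map_eq,
    lintegral_map (hfR.mul ha) hR.measurable]
  apply lintegral_congr_ae
  filter_upwards [hinv] with p hp
  simp only [Pi.mul_apply, hp]

/-- If a law with positive density with respect to a product of probability measures is a product of
laws, then the log-density is a sum of functions of the two coordinates. -/
lemma exists_log_eq_add {μ : Measure α} {ν : Measure β} [IsProbabilityMeasure μ]
    [IsProbabilityMeasure ν] {q : α × β → ℝ} (hq : Measurable q)
    (hpos : ∀ᵐ p ∂(μ.prod ν), 0 < q p) {M₁ : Measure α} {M₂ : Measure β} [IsProbabilityMeasure M₁]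
    [IsProbabilityMeasure M₂]
    (h : (μ.prod ν).withDensity (fun p => ENNReal.ofReal (q p)) = M₁.prod M₂) :
    ∃ (a : α → ℝ) (b : β → ℝ), ∀ᵐ p ∂(μ.prod ν), Real.log (q p) = a p.1 + b p.2 := by
  have hq' : Measurable fun p => ENNReal.ofReal (q p) := hq.ennreal_ofReal
  set f₁ : α → ℝ≥0∞ := fun x => ∫⁻ y, ENNReal.ofReal (q (x, y)) ∂ν with hf₁
  set f₂ : β → ℝ≥0∞ := fun y => ∫⁻ x, ENNReal.ofReal (q (x, y)) ∂μ with hf₂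
  have h₁ : M₁ = μ.withDensity f₁ := by
    rw [← map_fst_withDensity_prod μ ν hq', h, Measure.map_fst_prod]; simp
  have h₂ : M₂ = ν.withDensity f₂ := by
    rw [← map_snd_withDensity_prod μ ν hq', h, Measure.map_snd_prod]; simp
  have hm₁ : Measurable f₁ := hq'.lintegral_prod_right'
  have hm₂ : Measurable f₂ := hq'.lintegral_prod_left'
  have hfin : ∫⁻ p, ENNReal.ofReal (q p) ∂(μ.prod ν) ≠ ∞ := by
    rw [← setLIntegral_univ, ← withDensity_apply _ MeasurableSet.univ, h]
    exact measure_ne_top _ _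
  have hprod : (μ.withDensity f₁).prod (ν.withDensity f₂)
      = (μ.prod ν).withDensity fun p => f₁ p.1 * f₂ p.2 := prod_withDensity hm₁ hm₂
  rw [h₁, h₂, hprod, withDensity_eq_iff hq'.aemeasurable (by fun_prop) hfin] at h
  refine ⟨fun x => Real.log (f₁ x).toReal, fun y => Real.log (f₂ y).toReal, ?_⟩
  filter_upwards [h, hpos] with p hp h0
  have hne : f₁ p.1 * f₂ p.2 ≠ 0 := by rw [← hp]; simpa using h0
  have hne' : f₁ p.1 * f₂ p.2 ≠ ∞ := by rw [← hp]; exact ENNReal.ofReal_ne_top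
  rw [mul_ne_zero_iff] at hne
  have t₁ : f₁ p.1 ≠ ∞ := fun e => hne' (by rw [e, ENNReal.top_mul hne.2])
  have t₂ : f₂ p.2 ≠ ∞ := fun e => hne' (by rw [e, ENNReal.mul_top hne.1])
  have e1 : q p = (f₁ p.1).toReal * (f₂ p.2).toReal := by
    rw [← ENNReal.toReal_mul, ← hp, ENNReal.toReal_ofReal h0.le]
  rw [e1, Real.log_mul (ENNReal.toReal_pos hne.1 t₁).ne' (ENNReal.toReal_pos hne.2 t₂).ne']

end densities

/-- A change of sources that turns two independent pairs with densities `ℓ₁`, `ℓ₂` into independent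
pairs makes the joint density separable. -/
lemma IsSquareDiffeo.isSeparableUnder {T S : ℝ × ℝ → ℝ × ℝ} (d : IsSquareDiffeo T S)
    {ℓ₁ ℓ₂ : ℝ → ℝ → ℝ} (hm₁ : Measurable (Function.uncurry ℓ₁))
    (hm₂ : Measurable (Function.uncurry ℓ₂)) (hp₁ : ∀ u ∈ unitIoo, ∀ v ∈ unitIoo, 0 < ℓ₁ u v)
    (hp₂ : ∀ u ∈ unitIoo, ∀ v ∈ unitIoo, 0 < ℓ₂ u v) {M₁ M₂ : Measure (ℝ × ℝ)}
    [IsProbabilityMeasure M₁] [IsProbabilityMeasure M₂]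
    (h : (((unif.prod unif).withDensity fun p => ENNReal.ofReal (ℓ₁ p.1 p.2)).prod
      ((unif.prod unif).withDensity fun p => ENNReal.ofReal (ℓ₂ p.1 p.2))).map
        (midSwap ∘ Prod.map T T ∘ midSwap) = M₁.prod M₂) :
    IsSeparableUnder S ℓ₁ ℓ₂ := by
  have k₁ : Measurable fun p : ℝ × ℝ => ℓ₁ p.1 p.2 := hm₁
  have k₂ : Measurable fun p : ℝ × ℝ => ℓ₂ p.1 p.2 := hm₂
  have hρ := measurePreserving_midSwap unif unif unif unif
  have hR := hρ.comp ((d.measurePreserving.prod d.measurePreserving).comp hρ)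
  have hSm := d.measurable_inv
  have hR' : Measurable (midSwap ∘ Prod.map S S ∘ (midSwap :
      (ℝ × ℝ) × (ℝ × ℝ) → (ℝ × ℝ) × (ℝ × ℝ))) :=
    measurable_midSwap.comp ((hSm.prodMap hSm).comp measurable_midSwap)
  have hmem : ∀ᵐ p ∂((unif.prod unif).prod (unif.prod unif)), p.1 ∈ unitSq ∧ p.2 ∈ unitSq := by
    filter_upwards [Measure.quasiMeasurePreserving_fst (μ := unif.prod unif)
      (ν := unif.prod unif) |>.ae ae_mem, Measure.quasiMeasurePreserving_snd (μ := unif.prod unif)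
      (ν := unif.prod unif) |>.ae ae_mem] with p h1 h2 using ⟨h1, h2⟩
  have hinv : ∀ᵐ p ∂((unif.prod unif).prod (unif.prod unif)),
      (midSwap ∘ Prod.map S S ∘ midSwap) ((midSwap ∘ Prod.map T T ∘ midSwap) p) = p := by
    filter_upwards [hmem] with p hp
    have e1 := d.leftInv (p.1.1, p.2.1) ⟨hp.1.1, hp.2.1⟩
    have e2 := d.leftInv (p.1.2, p.2.2) ⟨hp.1.2, hp.2.2⟩
    simp only [Function.comp_apply, midSwap, Prod.map, Prod.mk.eta, e1, e2]
  rw [prod_withDensity (by fun_prop) (by fun_prop),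
    map_withDensity_of_leftInverse hR hR' hinv (by fun_prop)] at h
  set q : (ℝ × ℝ) × (ℝ × ℝ) → ℝ := fun p =>
    ℓ₁ (S (p.1.1, p.2.1)).1 (S (p.1.2, p.2.2)).1 * ℓ₂ (S (p.1.1, p.2.1)).2 (S (p.1.2, p.2.2)).2
    with hq
  have hposS : ∀ p : (ℝ × ℝ) × (ℝ × ℝ), p.1 ∈ unitSq → p.2 ∈ unitSq →
      0 < ℓ₁ (S (p.1.1, p.2.1)).1 (S (p.1.2, p.2.2)).1 ∧
      0 < ℓ₂ (S (p.1.1, p.2.1)).2 (S (p.1.2, p.2.2)).2 := by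
    intro p h1 h2
    have e1 := d.mapsTo_inv (x := (p.1.1, p.2.1)) ⟨h1.1, h2.1⟩
    have e2 := d.mapsTo_inv (x := (p.1.2, p.2.2)) ⟨h1.2, h2.2⟩
    exact ⟨hp₁ _ e1.1 _ e2.1, hp₂ _ e1.2 _ e2.2⟩
  have hqm : Measurable q := by
    have a1 : Measurable fun p : (ℝ × ℝ) × (ℝ × ℝ) => S (p.1.1, p.2.1) := hSm.comp (by fun_prop)
    have a2 : Measurable fun p : (ℝ × ℝ) × (ℝ × ℝ) => S (p.1.2, p.2.2) := hSm.comp (by fun_prop)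
    exact (k₁.comp (a1.fst.prodMk a2.fst)).mul (k₂.comp (a1.snd.prodMk a2.snd))
  have hdens : ((unif.prod unif).prod (unif.prod unif)).withDensity
      (fun p => ENNReal.ofReal (q p)) = M₁.prod M₂ := by
    rw [← h]
    apply withDensity_congr_ae
    filter_upwards [hmem] with p hp
    exact ENNReal.ofReal_mul (hposS p hp.1 hp.2).1.le
  obtain ⟨a, b, hab⟩ := exists_log_eq_add hqm (by
    filter_upwards [hmem] with p hp
    exact mul_pos (hposS p hp.1 hp.2).1 (hposS p hp.1 hp.2).2) hdens
  refine ⟨fun x y => a (x, y), fun x y => b (x, y), ?_⟩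
  filter_upwards [hρ.quasiMeasurePreserving.ae hab, hρ.quasiMeasurePreserving.ae hmem] with p hp hpm
  have := hposS _ hpm.1 hpm.2
  rw [hq, Real.log_mul this.1.ne' this.2.ne'] at hp
  exact hp

/-! ### The change of sources between two representations -/

/-- The pair of coordinates of a point of the plane. -/
def toPair (f : Fin 2 → ℝ) : ℝ × ℝ := (f 0, f 1)

/-- The point of the plane with given pair of coordinates. -/
def ofPair (p : ℝ × ℝ) : Fin 2 → ℝ := ![p.1, p.2]

lemma toPair_ofPair (p : ℝ × ℝ) : toPair (ofPair p) = p := rfl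

lemma ofPair_toPair (f : Fin 2 → ℝ) : ofPair (toPair f) = f := by
  ext j; fin_cases j <;> rfl

lemma contDiff_toPair : ContDiff ℝ 1 toPair := (contDiff_apply ℝ ℝ 0).prodMk (contDiff_apply ℝ ℝ 1)

lemma contDiff_ofPair : ContDiff ℝ 1 ofPair :=
  contDiff_pi.2 fun j => by fin_cases j <;> [exact contDiff_fst; exact contDiff_snd]

lemma toPair_mem {f : Fin 2 → ℝ} (hf : f ∈ openSquare) : toPair f ∈ unitSq := ⟨hf 0, hf 1⟩

lemma ofPair_mem {p : ℝ × ℝ} (hp : p ∈ unitSq) : ofPair p ∈ openSquare := fun j => by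
  fin_cases j <;> [exact hp.1; exact hp.2]

/-- The pair of sources at time `t`. -/
def sourcePair {Ω : Type*} (x : Fin 2 → ℕ → Ω → ℝ) (t : ℕ) (ω : Ω) : ℝ × ℝ := (x 0 t ω, x 1 t ω)

lemma IsTransitionDensity.map_eq_withDensity {Ω : Type*} [MeasurableSpace Ω] {P : Measure Ω}
    {x : ℕ → Ω → ℝ} {ℓ : ℝ → ℝ → ℝ} {h : ℕ} (hℓ : IsTransitionDensity P x h ℓ) (t : ℕ) :
    P.map (fun ω => (x (t + h) ω, x t ω))
      = (unif.prod unif).withDensity fun p => ENNReal.ofReal (ℓ p.1 p.2) := by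
  rw [hℓ.law t, prod_unif_eq]

namespace IsRepresentation

variable {Ω Ω' : Type*} [MeasurableSpace Ω] [MeasurableSpace Ω'] {P : Measure Ω} {P' : Measure Ω'}
  {Y : Set (Fin 2 → ℝ)} {A A' : (Fin 2 → ℝ) → (Fin 2 → ℝ)} {g g' : Fin 2 → ℝ → ℝ → ℝ}
  {x ε : Fin 2 → ℕ → Ω → ℝ} {x' ε' : Fin 2 → ℕ → Ω' → ℝ}

lemma measurable_state (hrep : IsRepresentation P Y A g x ε) (j : Fin 2) (t : ℕ) :
    Measurable (x j t) := (hrep.source j).measurable_state t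

lemma measurable_sourcePair (hrep : IsRepresentation P Y A g x ε) (t : ℕ) :
    Measurable (sourcePair x t) :=
  (hrep.measurable_state 0 t).prodMk (hrep.measurable_state 1 t)

lemma ae_sourcePair_mem (hrep : IsRepresentation P Y A g x ε) (t : ℕ) :
    ∀ᵐ ω ∂P, sourcePair x t ω ∈ unitSq := by
  have h : ∀ j, ∀ᵐ ω ∂P, x j t ω ∈ unitIoo := fun j =>
    ae_of_ae_map (hrep.measurable_state j t).aemeasurable (by
      rw [((hrep.source j).uniform t).map_eq]; exact ae_unif_mem)
  filter_upwards [h 0, h 1] with ω h0 h1 using ⟨h0, h1⟩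

/-- By independence of the sources, the states of the two sources at two times form two
independent pairs. -/
lemma map_states_eq_prod [IsProbabilityMeasure P] (hrep : IsRepresentation P Y A g x ε)
    (t s : ℕ) : P.map (fun ω => ((x 0 t ω, x 0 s ω), (x 1 t ω, x 1 s ω)))
      = (P.map fun ω => (x 0 t ω, x 0 s ω)).prod (P.map fun ω => (x 1 t ω, x 1 s ω)) := by
  have hm : Measurable fun w : ℕ → ℝ => (w t, w s) := by fun_prop
  have h := hrep.indep.comp hm hm
  exact h.map_prod_eq_prod_map_map
    ((hrep.measurable_state 0 t).prodMk (hrep.measurable_state 0 s)).aemeasurable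
    ((hrep.measurable_state 1 t).prodMk (hrep.measurable_state 1 s)).aemeasurable

lemma map_sourcePair [IsProbabilityMeasure P] (hrep : IsRepresentation P Y A g x ε) (t : ℕ) :
    P.map (sourcePair x t) = unif.prod unif := by
  have hm : Measurable fun w : ℕ → ℝ => w t := by fun_prop
  have h := hrep.indep.comp hm hm
  have h2 := h.map_prod_eq_prod_map_map (hrep.measurable_state 0 t).aemeasurable
    (hrep.measurable_state 1 t).aemeasurable
  have e0 := ((hrep.source 0).uniform t).map_eq
  have e1 := ((hrep.source 1).uniform t).map_eq
  change P.map (sourcePair x t) = (P.map (x 0 t)).prod (P.map (x 1 t)) at h2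
  rw [h2, e0, e1]

/-- The pair of sources is a measurable function of the observation. -/
lemma exists_decoder (hrep : IsRepresentation P Y A g x ε) (hY : IsOpen Y) :
    ∃ G : (Fin 2 → ℝ) → ℝ × ℝ, Measurable G ∧ ContDiffOn ℝ 1 G Y ∧ MapsTo G Y unitSq ∧
      (∀ p ∈ unitSq, G (A (ofPair p)) = p) ∧ ∀ y ∈ Y, A (ofPair (G y)) = y := by
  classical
  obtain ⟨-, hAm, C, hC, hCm, hl, hr⟩ := hrep.diffeo
  have hG : ContDiffOn ℝ 1 (fun y => toPair (C y)) Y := contDiff_toPair.comp_contDiffOn hC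
  have he : EqOn (Y.piecewise (fun y => toPair (C y)) fun _ => 0) (fun y => toPair (C y)) Y :=
    piecewise_eqOn _ _ _
  refine ⟨Y.piecewise (fun y => toPair (C y)) fun _ => 0,
    hG.continuousOn.measurable_piecewise continuousOn_const hY.measurableSet, hG.congr he,
    fun y hy => ?_, fun p hp => ?_, fun y hy => ?_⟩
  · rw [he hy]; exact toPair_mem (hCm hy)
  · rw [he (hAm (ofPair_mem hp))]
    simp only
    rw [hl (ofPair_mem hp), toPair_ofPair]
  · rw [he hy]
    simp only
    rw [ofPair_toPair, hr hy]

/-- Two representations of processes with the same law are related by a change of sources. -/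
theorem exists_isSquareDiffeo [IsProbabilityMeasure P] [IsProbabilityMeasure P'] (hY : IsOpen Y)
    (hrep : IsRepresentation P Y A g x ε) (hrep' : IsRepresentation P' Y A' g' x' ε')
    {μ : Measure (ℕ → Fin 2 → ℝ)} (hμ : HasLaw (observed A x) μ P)
    (hμ' : HasLaw (observed A' x') μ P') :
    ∃ T S, IsSquareDiffeo T S ∧ (∀ p ∈ unitSq, A' (ofPair (T p)) = A (ofPair p)) ∧
      ∀ t s, P.map (fun ω => (T (sourcePair x t ω), T (sourcePair x s ω)))
        = P'.map fun ω => (sourcePair x' t ω, sourcePair x' s ω) := by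
  classical
  obtain ⟨G, hGm, hGc, hGmaps, hGA, hAG⟩ := hrep.exists_decoder hY
  obtain ⟨G', hGm', hGc', hGmaps', hGA', hAG'⟩ := hrep'.exists_decoder hY
  have hAmaps : ∀ p ∈ unitSq, A (ofPair p) ∈ Y := fun p hp => hrep.diffeo.2.1 (ofPair_mem hp)
  have hAmaps' : ∀ p ∈ unitSq, A' (ofPair p) ∈ Y := fun p hp => hrep'.diffeo.2.1 (ofPair_mem hp)
  have hc : ContDiffOn ℝ 1 (fun p => G' (A (ofPair p))) unitSq :=
    hGc'.comp (hrep.diffeo.1.comp contDiff_ofPair.contDiffOn fun p hp => ofPair_mem hp) hAmaps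
  have hc' : ContDiffOn ℝ 1 (fun p => G (A' (ofPair p))) unitSq :=
    hGc.comp (hrep'.diffeo.1.comp contDiff_ofPair.contDiffOn fun p hp => ofPair_mem hp) hAmaps'
  set T := unitSq.piecewise (fun p => G' (A (ofPair p))) fun _ => 0 with hT
  set S := unitSq.piecewise (fun p => G (A' (ofPair p))) fun _ => 0 with hS
  have eT : ∀ p ∈ unitSq, T p = G' (A (ofPair p)) := piecewise_eqOn _ _ _
  have eS : ∀ p ∈ unitSq, S p = G (A' (ofPair p)) := piecewise_eqOn _ _ _
  have mT : MapsTo T unitSq unitSq := fun p hp => by rw [eT p hp]; exact hGmaps' (hAmaps p hp)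
  have mS : MapsTo S unitSq unitSq := fun p hp => by rw [eS p hp]; exact hGmaps (hAmaps' p hp)
  have hTm : Measurable T := hc.continuousOn.measurable_piecewise continuousOn_const
    isOpen_unitSq.measurableSet
  have hSm : Measurable S := hc'.continuousOn.measurable_piecewise continuousOn_const
    isOpen_unitSq.measurableSet
  have hrel : ∀ p ∈ unitSq, A' (ofPair (T p)) = A (ofPair p) := fun p hp => by
    rw [eT p hp, hAG' _ (hAmaps p hp)]
  have hrel' : ∀ p ∈ unitSq, A (ofPair (S p)) = A' (ofPair p) := fun p hp => by
    rw [eS p hp, hAG _ (hAmaps' p hp)]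
  have transfer : ∀ t s, P.map (fun ω => (T (sourcePair x t ω), T (sourcePair x s ω)))
      = P'.map fun ω => (sourcePair x' t ω, sourcePair x' s ω) := by
    intro t s
    have hD : Measurable fun w : ℕ → Fin 2 → ℝ => (G' (w t), G' (w s)) :=
      (hGm'.comp (measurable_pi_apply t)).prodMk (hGm'.comp (measurable_pi_apply s))
    have h1 : μ.map (fun w => (G' (w t), G' (w s)))
        = P.map (fun ω => (T (sourcePair x t ω), T (sourcePair x s ω))) := by
      rw [← hμ.map_eq, AEMeasurable.map_map_of_aemeasurable hD.aemeasurable hμ.aemeasurable]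
      apply Measure.map_congr
      filter_upwards [hrep.ae_sourcePair_mem t, hrep.ae_sourcePair_mem s] with ω ht hs
      rw [eT _ ht, eT _ hs]
      simp only [Function.comp_apply, observed]
      rw [← ofPair_toPair fun j => x j t ω, ← ofPair_toPair fun j => x j s ω]
      rfl
    have h2 : μ.map (fun w => (G' (w t), G' (w s)))
        = P'.map fun ω => (sourcePair x' t ω, sourcePair x' s ω) := by
      rw [← hμ'.map_eq, AEMeasurable.map_map_of_aemeasurable hD.aemeasurable hμ'.aemeasurable]
      apply Measure.map_congr
      filter_upwards [hrep'.ae_sourcePair_mem t, hrep'.ae_sourcePair_mem s] with ω ht hs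
      rw [← hGA' _ ht, ← hGA' _ hs]
      simp only [Function.comp_apply, observed]
      rw [← ofPair_toPair fun j => x' j t ω, ← ofPair_toPair fun j => x' j s ω]
      rfl
    rw [← h1, h2]
  refine ⟨T, S, ⟨hc.congr eT, hc'.congr eS, mT, mS, fun p hp => ?_, fun p hp => ?_, hTm, hSm, ?_⟩,
    hrel, transfer⟩
  · rw [eS _ (mT hp), hrel p hp, hGA p hp]
  · rw [eT _ (mS hp), hrel' p hp, hGA' p hp]
  · have h1 := congrArg (Measure.map Prod.fst) (transfer 0 0)
    have hz := hrep.measurable_sourcePair 0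
    have hz' := hrep'.measurable_sourcePair 0
    have hTz : Measurable fun ω => T (sourcePair x 0 ω) := hTm.comp hz
    rw [Measure.map_map measurable_fst (hTz.prodMk hTz),
      Measure.map_map measurable_fst (hz'.prodMk hz')] at h1
    change P.map (T ∘ sourcePair x 0) = P'.map (sourcePair x' 0) at h1
    rw [← Measure.map_map hTm hz, hrep.map_sourcePair, hrep'.map_sourcePair] at h1
    exact h1

/-- Since the states are uniform, a transition density has uniform margins. -/
lemma isCopulaDensity (hrep : IsRepresentation P Y A g x ε) {ℓ : ℝ → ℝ → ℝ} {j : Fin 2}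
    {h : ℕ} (hℓ : IsTransitionDensity P (x j) h ℓ)
    (hdiff : ∀ u ∈ unitIoo, ∀ v ∈ unitIoo, DifferentiableAt ℝ (fun w => ℓ w v) u) :
    IsCopulaDensity ℓ := by
  have hlaw := hℓ.map_eq_withDensity 0
  have hm : Measurable fun p : ℝ × ℝ => ENNReal.ofReal (ℓ p.1 p.2) :=
    (show Measurable fun p : ℝ × ℝ => ℓ p.1 p.2 from hℓ.measurable).ennreal_ofReal
  have hx := hrep.measurable_state j
  have key : ∀ f : ℝ → ℝ≥0∞, Measurable f → unif.withDensity f = unif → ∀ᵐ v ∂unif, f v = 1 := by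
    intro f hf h1
    have h2 : unif.withDensity f = unif.withDensity 1 := by rw [h1, withDensity_one]
    exact (withDensity_eq_iff_of_sigmaFinite hf.aemeasurable aemeasurable_const).1 h2
  refine ⟨hℓ.measurable, hℓ.pos, hdiff, key _ hm.lintegral_prod_left' ?_,
    key _ hm.lintegral_prod_right' ?_⟩
  · rw [← map_snd_withDensity_prod unif unif hm, ← hlaw,
      Measure.map_map measurable_snd ((hx _).prodMk (hx _))]
    exact ((hrep.source j).uniform 0).map_eq
  · rw [← map_fst_withDensity_prod unif unif hm, ← hlaw,
      Measure.map_map measurable_fst ((hx _).prodMk (hx _))]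
    exact ((hrep.source j).uniform (0 + h)).map_eq

lemma isSeparableUnder [IsProbabilityMeasure P] [IsProbabilityMeasure P']
    (hrep : IsRepresentation P Y A g x ε) (hrep' : IsRepresentation P' Y A' g' x' ε')
    {T S : ℝ × ℝ → ℝ × ℝ} (d : IsSquareDiffeo T S)
    (htr : ∀ t s, P.map (fun ω => (T (sourcePair x t ω), T (sourcePair x s ω)))
        = P'.map fun ω => (sourcePair x' t ω, sourcePair x' s ω)) {h : ℕ} {ℓ₁ ℓ₂ : ℝ → ℝ → ℝ}
    (hℓ₁ : IsTransitionDensity P (x 0) h ℓ₁) (hℓ₂ : IsTransitionDensity P (x 1) h ℓ₂) :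
    IsSeparableUnder S ℓ₁ ℓ₂ := by
  have hx := hrep.measurable_state
  have hx' := hrep'.measurable_state
  have hz := hrep.measurable_sourcePair
  have hz' := hrep'.measurable_sourcePair
  have : IsProbabilityMeasure (P'.map fun ω => (x' 0 (0 + h) ω, x' 0 0 ω)) :=
    Measure.isProbabilityMeasure_map ((hx' _ _).prodMk (hx' _ _)).aemeasurable
  have : IsProbabilityMeasure (P'.map fun ω => (x' 1 (0 + h) ω, x' 1 0 ω)) :=
    Measure.isProbabilityMeasure_map ((hx' _ _).prodMk (hx' _ _)).aemeasurable
  refine d.isSeparableUnder hℓ₁.measurable hℓ₂.measurable hℓ₁.pos hℓ₂.pos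
    (M₁ := P'.map fun ω => (x' 0 (0 + h) ω, x' 0 0 ω))
    (M₂ := P'.map fun ω => (x' 1 (0 + h) ω, x' 1 0 ω)) ?_
  rw [← hℓ₁.map_eq_withDensity 0, ← hℓ₂.map_eq_withDensity 0,
    ← hrep.map_states_eq_prod, ← hrep'.map_states_eq_prod]
  have hT := d.measurable
  have h1 := congrArg (Measure.map midSwap) (htr (0 + h) 0)
  have hTz : ∀ t, Measurable fun ω => T (sourcePair x t ω) := fun t => hT.comp (hz t)
  rw [Measure.map_map measurable_midSwap ((hTz _).prodMk (hTz _)),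
    Measure.map_map measurable_midSwap ((hz' _).prodMk (hz' _))] at h1
  rw [Measure.map_map (measurable_midSwap.comp ((hT.prodMap hT).comp measurable_midSwap))
    (((hx _ _).prodMk (hx _ _)).prodMk ((hx _ _).prodMk (hx _ _)))]
  exact h1

end IsRepresentation

/-! ### The autoregressive functions -/

section noise

/-- The law of the state and the next noise. -/
noncomputable abbrev stateNoise : Measure (ℝ × ℝ) := unif.prod (gaussianReal 0 1)

lemma aemeasurable_stateNoise {H : ℝ → ℝ → ℝ}
    (hH : ContinuousOn (Function.uncurry H) (unitIoo ×ˢ univ)) :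
    AEMeasurable (Function.uncurry H) stateNoise := by
  have h : stateNoise = (volume.prod (gaussianReal 0 1)).restrict (unitIoo ×ˢ univ) := by
    rw [← Measure.prod_restrict, Measure.restrict_univ]
  rw [h]
  exact hH.aemeasurable (isOpen_unitIoo.measurableSet.prod MeasurableSet.univ)

/-- Two functions of the state and the noise that are increasing in the noise and give the same
transition law are equal, by continuity. Here is one of the two inequalities: if `H < c < K` near
`(v, e)`, then, for states near `v`, the event `H ≤ c` contains the event that the noise is
at most `e + r / 2`, and the event `K ≤ c` is contained in the event that the noise is at
most `e`. -/
lemma le_of_map_stateNoise_eq {H K : ℝ → ℝ → ℝ}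
    (hH : ContinuousOn (Function.uncurry H) (unitIoo ×ˢ univ))
    (hK : ContinuousOn (Function.uncurry K) (unitIoo ×ˢ univ))
    (hHm : ∀ v ∈ unitIoo, Monotone (H v)) (hKm : ∀ v ∈ unitIoo, Monotone (K v))
    (h : stateNoise.map (fun p => (H p.1 p.2, p.1)) = stateNoise.map fun p => (K p.1 p.2, p.1))
    {v e : ℝ} (hv : v ∈ unitIoo) : K v e ≤ H v e := by
  by_contra! hlt
  obtain ⟨c, hc1, hc2⟩ := exists_between hlt
  have ho : IsOpen (unitIoo ×ˢ (univ : Set ℝ)) := isOpen_unitIoo.prod isOpen_univ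
  have hnhds : unitIoo ×ˢ (univ : Set ℝ) ∈ 𝓝 (v, e) := ho.mem_nhds ⟨hv, mem_univ _⟩
  have h1 : ∀ᶠ p in 𝓝 (v, e), p.1 ∈ unitIoo ∧ H p.1 p.2 < c ∧ c < K p.1 p.2 := by
    filter_upwards [hnhds, (hH.continuousAt hnhds).eventually (gt_mem_nhds hc1),
      (hK.continuousAt hnhds).eventually (lt_mem_nhds hc2)] with p a b d using ⟨a.1, b, d⟩
  obtain ⟨r, hr, hball⟩ := Metric.eventually_nhds_iff_ball.1 h1
  set V := Ioo (v - r) (v + r) with hV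
  have hVe : ∀ w ∈ V, ∀ t, |t - e| < r → w ∈ unitIoo ∧ H w t < c ∧ c < K w t := by
    intro w hw t ht
    apply hball (w, t)
    rw [Metric.mem_ball, Prod.dist_eq, max_lt_iff, Real.dist_eq, Real.dist_eq, abs_lt]
    exact ⟨⟨by linarith [hw.1], by linarith [hw.2]⟩, ht⟩
  have hset : MeasurableSet (Iic c ×ˢ V) := measurableSet_Iic.prod measurableSet_Ioo
  have e1 := congrArg (fun m => m (Iic c ×ˢ V)) h
  have mH : AEMeasurable (fun p : ℝ × ℝ => (H p.1 p.2, p.1)) stateNoise :=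
    (aemeasurable_stateNoise hH).prodMk measurable_fst.aemeasurable
  have mK : AEMeasurable (fun p : ℝ × ℝ => (K p.1 p.2, p.1)) stateNoise :=
    (aemeasurable_stateNoise hK).prodMk measurable_fst.aemeasurable
  simp only [Measure.map_apply_of_aemeasurable mH hset,
    Measure.map_apply_of_aemeasurable mK hset] at e1
  have i1 : V ×ˢ Iic (e + r / 2) ⊆ (fun p : ℝ × ℝ => (H p.1 p.2, p.1)) ⁻¹' (Iic c ×ˢ V) := by
    rintro ⟨w, t⟩ ⟨hw, ht⟩
    have := hVe w hw (e + r / 2) (by rw [add_sub_cancel_left, abs_of_pos] <;> linarith)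
    exact ⟨(hHm w this.1 ht).trans this.2.1.le, hw⟩
  have i2 : (fun p : ℝ × ℝ => (K p.1 p.2, p.1)) ⁻¹' (Iic c ×ˢ V) ⊆ V ×ˢ Iic e := by
    rintro ⟨w, t⟩ ⟨ht, hw⟩
    refine ⟨hw, show t ≤ e from le_of_not_gt fun hlt => ?_⟩
    have := hVe w hw e (by simpa using hr)
    exact absurd (this.2.2.trans_le (hKm w this.1 hlt.le)) (not_lt.2 ht)
  have e2 : stateNoise (V ×ˢ Iic (e + r / 2)) ≤ stateNoise (V ×ˢ Iic e) :=
    (measure_mono i1).trans (e1.le.trans (measure_mono i2))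
  rw [Measure.prod_prod, Measure.prod_prod] at e2
  have hVsub : V ⊆ unitIoo := fun w hw => (hVe w hw e (by simpa using hr)).1
  have hVpos : unif V ≠ 0 := by
    rw [unif, Measure.restrict_apply measurableSet_Ioo, inter_eq_left.2 hVsub, hV, Real.volume_Ioo]
    simpa using hr
  rw [ENNReal.mul_le_mul_iff_right hVpos (measure_ne_top _ _)] at e2
  have e3 := (ENNReal.toReal_le_toReal (measure_ne_top _ _) (measure_ne_top _ _)).2 e2
  exact absurd (strictMono_gaussCdf (show e < e + r / 2 by linarith)) (not_lt.2 e3)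

lemma eq_of_map_stateNoise_eq {H K : ℝ → ℝ → ℝ}
    (hH : ContinuousOn (Function.uncurry H) (unitIoo ×ˢ univ))
    (hK : ContinuousOn (Function.uncurry K) (unitIoo ×ˢ univ))
    (hHm : ∀ v ∈ unitIoo, Monotone (H v)) (hKm : ∀ v ∈ unitIoo, Monotone (K v))
    (h : stateNoise.map (fun p => (H p.1 p.2, p.1)) = stateNoise.map fun p => (K p.1 p.2, p.1))
    {v : ℝ} (hv : v ∈ unitIoo) (e : ℝ) : H v e = K v e :=
  le_antisymm (le_of_map_stateNoise_eq hK hH hKm hHm h.symm hv)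
    (le_of_map_stateNoise_eq hH hK hHm hKm h hv)

lemma marginMap_one : marginMap 1 = fun x => x := by ext x; simp [marginMap]

lemma marginMap_neg_one : marginMap (-1) = fun x => 1 - x := by
  ext x; rw [marginMap, if_neg (by decide)]

lemma continuous_marginMap (s : ℤˣ) : Continuous (marginMap s) := by
  rcases Int.units_eq_one_or s with rfl | rfl
  · rw [marginMap_one]; fun_prop
  · rw [marginMap_neg_one]; fun_prop

lemma measurePreserving_marginMap (s : ℤˣ) : MeasurePreserving (marginMap s) unif unif := by
  rcases Int.units_eq_one_or s with rfl | rfl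
  · rw [marginMap_one]; exact MeasurePreserving.id _
  · rw [marginMap_neg_one]
    have h := (Measure.measurePreserving_sub_left volume (1 : ℝ)).restrict_preimage
      isOpen_unitIoo.measurableSet
    have e : (fun x : ℝ => 1 - x) ⁻¹' unitIoo = unitIoo := by simp [unitIoo]
    rwa [e] at h

lemma measurePreserving_sign_mul (s : ℤˣ) :
    MeasurePreserving (fun e : ℝ => ((s : ℤ) : ℝ) * e) (gaussianReal 0 1) (gaussianReal 0 1) := by
  refine ⟨by fun_prop, ?_⟩
  rw [gaussianReal_map_const_mul]
  rcases Int.units_eq_one_or s with rfl | rfl <;> simp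

lemma IsAutoregressive.strictMono {g : ℝ → ℝ → ℝ} (hg : IsAutoregressive g) {v : ℝ}
    (hv : v ∈ unitIoo) : StrictMono (g v) := strictMono_of_deriv_pos (hg.deriv_pos v hv)

lemma IsMarkovSource.map_transition {Ω : Type*} [MeasurableSpace Ω] {P : Measure Ω}
    [IsProbabilityMeasure P] {g : ℝ → ℝ → ℝ} {x ε : ℕ → Ω → ℝ} (h : IsMarkovSource P g x ε) :
    P.map (fun ω => (x 1 ω, x 0 ω)) = stateNoise.map fun p => (g p.1 p.2, p.1) := by
  have hx := h.measurable_state 0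
  have hε := h.measurable_noise 1
  have hind : IndepFun (x 0) (ε 1) P :=
    ((h.indep_past 0).comp measurable_id (ψ := fun w : Fin (0 + 1) → ℝ => w 0) (by fun_prop)).symm
  have hlaw : P.map (fun ω => (x 0 ω, ε 1 ω)) = stateNoise := by
    rw [hind.map_prod_eq_prod_map_map hx.aemeasurable hε.aemeasurable, (h.uniform 0).map_eq,
      (h.gaussian 0).map_eq]
  have mg : AEMeasurable (fun p : ℝ × ℝ => (g p.1 p.2, p.1)) stateNoise :=
    (aemeasurable_stateNoise h.autoregressive.continuousOn).prodMk measurable_fst.aemeasurable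
  rw [← hlaw] at mg ⊢
  rw [AEMeasurable.map_map_of_aemeasurable mg (hx.prodMk hε).aemeasurable]
  apply Measure.map_congr
  filter_upwards [h.recursion 0] with ω hω
  simp only [Function.comp_apply]
  rw [hω]

/-- If the new source is, in law, the old one up to a reflection, then its autoregressive function
is the old one, with the noise reflected as well. -/
lemma IsMarkovSource.autoregressive_eq {Ω Ω' : Type*} [MeasurableSpace Ω] [MeasurableSpace Ω']
    {P : Measure Ω} {P' : Measure Ω'} [IsProbabilityMeasure P] [IsProbabilityMeasure P']
    {g g' : ℝ → ℝ → ℝ} {x ε : ℕ → Ω → ℝ} {x' ε' : ℕ → Ω' → ℝ} (h : IsMarkovSource P g x ε)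
    (h' : IsMarkovSource P' g' x' ε') (s : ℤˣ)
    (hlaw : P.map (fun ω => (marginMap s (x 1 ω), marginMap s (x 0 ω)))
      = P'.map fun ω => (x' 1 ω, x' 0 ω)) {v : ℝ} (hv : v ∈ unitIoo) (e : ℝ) :
    g' (marginMap s v) (((s : ℤ) : ℝ) * e) = marginMap s (g v e) := by
  have hs : Measurable (marginMap s) := (continuous_marginMap s).measurable
  have hss : Measurable fun p : ℝ × ℝ => (marginMap s p.1, marginMap s p.2) := by fun_prop
  have mg : AEMeasurable (fun p : ℝ × ℝ => (g p.1 p.2, p.1)) stateNoise :=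
    (aemeasurable_stateNoise h.autoregressive.continuousOn).prodMk measurable_fst.aemeasurable
  have mg' : AEMeasurable (fun p : ℝ × ℝ => (g' p.1 p.2, p.1)) stateNoise :=
    (aemeasurable_stateNoise h'.autoregressive.continuousOn).prodMk measurable_fst.aemeasurable
  have hpres : MeasurePreserving (Prod.map (marginMap s) fun e : ℝ => ((s : ℤ) : ℝ) * e)
      stateNoise stateNoise := (measurePreserving_marginMap s).prod (measurePreserving_sign_mul s)
  set K : ℝ → ℝ → ℝ := fun v e => marginMap s (g' (marginMap s v) (((s : ℤ) : ℝ) * e)) with hK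
  have hKc : ContinuousOn (Function.uncurry K) (unitIoo ×ˢ univ) := by
    have c1 : Continuous fun p : ℝ × ℝ => (marginMap s p.1, ((s : ℤ) : ℝ) * p.2) :=
      ((continuous_marginMap s).comp continuous_fst).prodMk (by fun_prop)
    exact (continuous_marginMap s).comp_continuousOn
      (h'.autoregressive.continuousOn.comp c1.continuousOn
        fun p hp => ⟨marginMap_mem s hp.1, mem_univ _⟩)
  have hKm : ∀ v ∈ unitIoo, Monotone (K v) := by
    intro v hv a b hab
    have hm := (h'.autoregressive.strictMono (marginMap_mem s hv)).monotone
    rcases Int.units_eq_one_or s with rfl | rfl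
    · simpa [hK, marginMap] using hm (by simpa using hab)
    · have : g' (marginMap (-1) v) (((-1 : ℤˣ) : ℤ) * b) ≤
          g' (marginMap (-1) v) (((-1 : ℤˣ) : ℤ) * a) :=
        hm (by simpa using hab)
      simp only [hK]
      rw [marginMap_neg_one] at this ⊢
      linarith
  have key : stateNoise.map (fun p => (g p.1 p.2, p.1))
      = stateNoise.map fun p => (K p.1 p.2, p.1) := by
    have e1 := congrArg (Measure.map fun p : ℝ × ℝ => (marginMap s p.1, marginMap s p.2)) hlaw
    rw [h'.map_transition, Measure.map_map hss (by
      exact (hs.comp (h.measurable_state 1)).prodMk (hs.comp (h.measurable_state 0)))] at e1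
    simp only [Function.comp_def, marginMap_marginMap] at e1
    rw [← h.map_transition, e1, AEMeasurable.map_map_of_aemeasurable hss.aemeasurable mg']
    conv_lhs => rw [← hpres.map_eq]
    rw [AEMeasurable.map_map_of_aemeasurable (by
      rw [hpres.map_eq]; exact hss.comp_aemeasurable mg') hpres.measurable.aemeasurable]
    apply Measure.map_congr
    refine ae_of_all _ fun p => ?_
    simp only [Function.comp_apply, Prod.map, marginMap_marginMap, hK]
  have := eq_of_map_stateNoise_eq h.autoregressive.continuousOn hKc
    (fun v hv => (h.autoregressive.strictMono hv).monotone) hKm key hv e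
  rw [this, hK]
  simp only [marginMap_marginMap]

end noise

/-! ### Essential uniqueness -/

/-- Both forms of the change of sources, in terms of a permutation of the sources. -/
lemma exists_perm_of_eq_marginMap {T : ℝ × ℝ → ℝ × ℝ}
    (h : (∃ s₁ s₂ : ℤˣ, ∀ v ∈ unitSq, T v = (marginMap s₁ v.1, marginMap s₂ v.2)) ∨
      ∃ s₁ s₂ : ℤˣ, ∀ v ∈ unitSq, T v = (marginMap s₁ v.2, marginMap s₂ v.1)) :
    ∃ (σ : Equiv.Perm (Fin 2)) (s : Fin 2 → ℤˣ), ∀ v ∈ unitSq, ∀ j,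
      ofPair (T v) j = marginMap (s j) (ofPair v (σ j)) := by
  rcases h with ⟨s₁, s₂, hs⟩ | ⟨s₁, s₂, hs⟩
  · refine ⟨1, ![s₁, s₂], fun v hv j => ?_⟩
    rw [hs v hv]
    fin_cases j <;> rfl
  · refine ⟨Equiv.swap 0 1, ![s₁, s₂], fun v hv j => ?_⟩
    rw [hs v hv]
    fin_cases j <;> simp [ofPair]

lemma ofPair_sourcePair {Ω : Type*} (x : Fin 2 → ℕ → Ω → ℝ) (t : ℕ) (ω : Ω) (j : Fin 2) :
    ofPair (sourcePair x t ω) j = x j t ω := by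
  fin_cases j <;> rfl

theorem proposition9 {Ω : Type u} [MeasurableSpace Ω] (P : Measure Ω)
    [IsProbabilityMeasure P]
    (Y : Set (Fin 2 → ℝ)) (hY : IsOpen Y)
    (A : (Fin 2 → ℝ) → (Fin 2 → ℝ)) (g : Fin 2 → ℝ → ℝ → ℝ)
    (x ε : Fin 2 → ℕ → Ω → ℝ) (hrep : IsRepresentation P Y A g x ε)
    (μ : Measure (ℕ → Fin 2 → ℝ)) (hμ : HasLaw (observed A x) μ P)
    (ℓ : Fin 2 → ℕ → ℝ → ℝ → ℝ)
    (hℓ : ∀ j, ∀ h : ℕ, 1 ≤ h → IsTransitionDensity P (x j) h (ℓ j h))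
    (hdiff : ∀ j, ∀ h : ℕ, 1 ≤ h → ∀ u ∈ unitIoo, ∀ v ∈ unitIoo,
      DifferentiableAt ℝ (fun w => ℓ j h w v) u)
    (hind : ∀ u ∈ unitIoo, ScoresLinearlyIndependentAt ℓ u) :
    IsEssentiallyUnique.{v} μ Y A g := by
  intro Ω' _ P' _ A' g' x' ε' hrep' hμ'
  obtain ⟨T, S, d, hA, htr⟩ := IsRepresentation.exists_isSquareDiffeo hY hrep hrep' hμ hμ'
  have hcop : ∀ j h, 1 ≤ h → IsCopulaDensity (ℓ j h) := fun j h hh =>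
    hrep.isCopulaDensity (hℓ j h hh) (hdiff j h hh)
  obtain ⟨σ, s, hT⟩ := exists_perm_of_eq_marginMap <|
    d.eq_marginMap_of_separable (hcop 0) (hcop 1)
      (fun h hh => hrep.isSeparableUnder hrep' d htr (hℓ 0 h hh) (hℓ 1 h hh)) hind
  refine ⟨σ, s, fun f hf => ?_, fun j v hv e => ?_⟩
  · have h1 := hA _ (toPair_mem hf)
    rw [ofPair_toPair] at h1
    rw [← h1]
    congr 1
    ext j
    rw [hT _ (toPair_mem hf), ofPair_toPair]
  · refine (hrep.source (σ j)).autoregressive_eq (hrep'.source j) (s j) ?_ hv e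
    have hTm := d.measurable
    have hz := hrep.measurable_sourcePair
    have hz' := hrep'.measurable_sourcePair
    have hp : Measurable fun p : ℝ × ℝ => ofPair p j :=
      (measurable_pi_apply j).comp contDiff_ofPair.continuous.measurable
    have hpp : Measurable fun q : (ℝ × ℝ) × (ℝ × ℝ) => (ofPair q.1 j, ofPair q.2 j) :=
      (hp.comp measurable_fst).prodMk (hp.comp measurable_snd)
    have hTz : ∀ t, Measurable fun ω => T (sourcePair x t ω) := fun t => hTm.comp (hz t)
    have e1 := congrArg (Measure.map fun q : (ℝ × ℝ) × (ℝ × ℝ) => (ofPair q.1 j, ofPair q.2 j))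
      (htr 1 0)
    rw [Measure.map_map hpp ((hTz 1).prodMk (hTz 0)),
      Measure.map_map hpp ((hz' 1).prodMk (hz' 0))] at e1
    refine Eq.trans (Measure.map_congr ?_) (e1.trans (Measure.map_congr ?_))
    · filter_upwards [hrep.ae_sourcePair_mem 0, hrep.ae_sourcePair_mem 1] with ω h0 h1
      simp only [Function.comp_apply, hT _ h0, hT _ h1, ofPair_sourcePair]
    · refine ae_of_all _ fun ω => ?_
      simp only [Function.comp_apply, ofPair_sourcePair]
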